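/- **Setting.** Let $\Omega=\{|x-a|<c_1,\ |y-b|<c_2\}$ with $c_1,c_2>0$ and $a-c_1>0$, and let $\Gamma=\{x=a+c_1,\ |y-b|<c_2\}$ be its right side. Let $R>0$, $\varepsilon\in(0,1)$. Let $H_2$ be the space of bounded (strongly measurable) families $\varphi\mapsto(r,s)(\cdot,\varphi)\in H^3(\Omega)\times H^3(\Omega)$, $\varphi\in(0,2\pi)$, with norm $\|(r,s)\|_{H_2}=\sup_\varphi\big(\|r(\cdot,\varphi)\|_{H^3(\Omega)}^2+\|s(\cdot,\varphi)\|_{H^3(\Omega)}^2\big)^{1/2}$. Let $H_0^3(\Omega)=\{v\in H^3(\Omega): v|_{\partial\Omega}=0,\ \partial_n v|_\Gamma=0\}$. For $(r,s)\in H^3(\Omega)^2$ put $$L_1(r,s)=\Delta r+2\nabla r\cdot\nabla\tfrac{r-s}{\varepsilon},\qquad L_2(r,s)=\Delta s+2\nabla r\cdot\nabla\tfrac{r-s}{\varepsilon},$$ $$J_{\lambda,\alpha}(r,s)=\sqrt\varepsilon\int_\Omega\big(L_1(r,s)^2+L_2(r,s)^2\big)e^{2\lambda x^2}\,dx\,dy+\alpha\|(r,s)\|^2_{H^3(\Omega)\times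 H^3(\Omega)},$$ and let $J'_{\lambda,\alpha}(r,s)\in H^3_0(\Omega)\times H_0^3(\Omega)$ be the Riesz representative, in the inner product of $H^3(\Omega)^2$, of the Fréchet derivative of $J_{\lambda,\alpha}$ at $(r,s)$ in the directions $H_0^3(\Omega)\times H_0^3(\Omega)$. For data $g_0(\mathbf x,\varphi)$ on $\partial\Omega$ and $g_1(\mathbf x,\varphi)$ on $\Gamma$ put $s_0=\ln g_0$, $s_1=g_1/g_0$, and let $B(\varrho)$ be the set of $(r,s)\in H_2$ with $\|(r,s)\|_{H_2}<\varrho$ and, for all $\varphi\in(0,2\pi)$, $r=\partial_\varphi s_0$, $s=\partial_\varphi s_0-\varepsilon s_0$ on $\partial\Omega$ and $\partial_n r=\partial_\varphi s_1$, $\partial_n s=\partial_\varphi s_1-\varepsilon s_1$ on $\Gamma$. Let $\overline{B_0(2R)}$ be the set of $Q\in H_2$ with $\|Q\|_{H_2}\le 2R$ and $Q(\cdot,\varphi)\in H_0^3(\Omega)\times H_0^3(\Omega)$ for all $\varphi$. *Exact solution.* Let $G\subset\mathbb R^2$ be a bounded domain with sufficiently smooth boundary and $A>0$ such that the open disk $D_A$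 of radius $A$ about $(a,b)$ lies in $G$, its boundary circle $C_A$ does not meet $\partial G$, and $\Omega\subset D_A$. Let $f(\mathbf x)=C_\rho\exp\big(-|\mathbf x|^2/(\rho^2-|\mathbf x|^2)\big)$ for $|\mathbf x|<\rho$ and $f=0$ otherwise, with $\rho\in(0,1)$, $\int f=1$, and $f(\mathbf x-\mathbf x_0)=0$ for all $\mathbf x\in\overline\Omega$, $\mathbf x_0\in C_A$. Let $\sigma^*\in C^2(\overline G)$, $\sigma^*\ge1$ in $G$, $\sigma^*=1$ in $G\setminus\Omega$, and for $\mathbf x_0\in C_A$ let $u^*(\cdot,\mathbf x_0)\in C^2(\overline G)$ solve $\operatorname{div}(\sigma^*\nabla u^*)=-f(\cdot-\mathbf x_0)$ in $G$, $u^*=0$ on $\partial G$. With $\mathbf x_0(\varphi)=(a+A\cos\varphi,b+A\sin\varphi)$ put $w^*(\mathbf x,\varphi)=\ln\big(\sqrt{\sigma^*(\mathbf x)}\,u^*(\mathbf x,\mathbf x_0(\varphi))\big)$, $r^*=\partial_\varphi w^*$, $s^*=\partial_\varphi w^*-\varepsilon w^*$, and $a^*=-\Delta(\sqrt{\sigma^*})/\sqrt{\sigma^*}$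 in $\Omega$. Let $B^*(\varrho)$ be the set $B(\varrho)$ for the exact data $g_0^*=u^*|_{\partial\Omega}$, $g_1^*=\partial_n u^*|_\Gamma$. **Theorem.** There are $\Lambda\ge1$ and $K>0$, depending only on $R,\Omega,\varepsilon$, such that the following holds for every $\lambda_2\ge\Lambda$ and every noise level $\xi\in(0,1)$, with $\alpha=\xi^2$. There is $\gamma_0\in(0,1)$ such that for every step $\gamma\in(0,\gamma_0]$ there is $\theta=\theta(\gamma)\in(0,1)$ with the following property. Let the exact solution be as above, let $g_0>0,g_1$ be (noisy) data differentiable in $\varphi$, let $P\in B(R)$, $P^*\in B^*(R)$ with $\|P-P^*\|_{H_2}<\xi$, and let $\overline C_1>0$ satisfy $R/3-\overline C_1\xi>0$ and $(r^*,s^*)\in B^*(R/3-\overline C_1\xi)$. Then there is a unique $(\bar r_{\min},\bar s_{\min})\in P+\overline{B_0(2R)}$ that, for every $\varphi$, minimizes $J_{\lambda_2,\alpha}(Q(\cdot,\varphi))$ over $Q\in P+\overline{B_0(2R)}$. Assume that $$\|(\bar r_{\min},\bar s_{\min})-(r^*,s^*)\|_{H_2}\le\overline C_1\xi .$$ Let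 $(r_0,s_0)\in B(R/3)$ be arbitrary. Then the gradient descent $(r_n,s_n)=(r_{n-1},s_{n-1})-\gamma J'_{\lambda_2,\alpha}(r_{n-1},s_{n-1})$, $n\ge1$ (performed for each $\varphi$), is well defined in $H_2$, all its terms belong to $B(R)$, and for all $n\ge0$ $$\|(r_n,s_n)-(r^*,s^*)\|_{H_2}\le\overline C_1\xi+\theta^n\|(\bar r_{\min},\bar s_{\min})-(r_0,s_0)\|_{H_2},$$ $$\|a_n-a^*\|_{L_2(\Omega)}\le K\Big(\overline C_1\xi+\theta^n\|(\bar r_{\min},\bar s_{\min})-(r_0,s_0)\|_{H_2}\Big),$$ where $a_n=-\frac1{2\pi}\int_0^{2\pi}\big(\Delta w_n+|\nabla w_n|^2\big)d\varphi$ and $w_n=(r_n-s_n)/\varepsilon$. -/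

import Mathlib

open MeasureTheory Set
open scoped ENNReal ContDiff

noncomputable section

namespace EIT

/-! ### Classical derivatives and the geometry -/

/-- Partial derivative with respect to the first variable. -/
def pdx (g : ℝ × ℝ → ℝ) (z : ℝ × ℝ) : ℝ := fderiv ℝ g z (1, 0)

/-- Partial derivative with respect to the second variable. -/
def pdy (g : ℝ × ℝ → ℝ) (z : ℝ × ℝ) : ℝ := fderiv ℝ g z (0, 1)

/-- The classical Laplacian. -/
def lap (g : ℝ × ℝ → ℝ) (z : ℝ × ℝ) : ℝ := pdx (pdx g) z + pdy (pdy g) z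

/-- The open disk of radius `A` centred at `(a, b)`. -/
def disk (a b A : ℝ) : Set (ℝ × ℝ) := {z | (z.1 - a) ^ 2 + (z.2 - b) ^ 2 < A ^ 2}

/-- The circle of radius `A` centred at `(a, b)`. -/
def circ (a b A : ℝ) : Set (ℝ × ℝ) := {z | (z.1 - a) ^ 2 + (z.2 - b) ^ 2 = A ^ 2}

/-- The open rectangle `|x - a| < c₁`, `|y - b| < c₂`. -/
def rect (a b c₁ c₂ : ℝ) : Set (ℝ × ℝ) := {z | |z.1 - a| < c₁ ∧ |z.2 - b| < c₂}

/-- The right side of the rectangle; its outward normal derivative is `∂/∂x`. -/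
def rightSide (a b c₁ c₂ : ℝ) : Set (ℝ × ℝ) :=
  {z | z.1 = a + c₁ ∧ z.2 ∈ Ioo (b - c₂) (b + c₂)}

/-- The range `(0, 2π)` of the source angle. -/
abbrev Angle : Type := Ioo (0 : ℝ) (2 * Real.pi)

/-- The position of the source at the angle `φ`. -/
def sourcePoint (a b A φ : ℝ) : ℝ × ℝ := (a + A * Real.cos φ, b + A * Real.sin φ)

/-! ### The forward problem -/

/-- The unnormalised smooth bump of radius `ρ`. -/
def bump (ρ : ℝ) (z : ℝ × ℝ) : ℝ :=
  if z.1 ^ 2 + z.2 ^ 2 < ρ ^ 2 then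
    Real.exp (-((z.1 ^ 2 + z.2 ^ 2) / (ρ ^ 2 - (z.1 ^ 2 + z.2 ^ 2))))
  else 0

/-- The delta-like source `f`: the bump of radius `ρ`, normalised to have integral one. -/
def source (ρ : ℝ) (z : ℝ × ℝ) : ℝ := (∫ y, bump ρ y)⁻¹ * bump ρ z

/-- The geometric setting: a bounded domain `G` contains the disk of radius `A` together with its
boundary circle, the disk contains the rectangle, and sources on the circle vanish on the closed
rectangle. -/
structure IsSetting (a b c₁ c₂ A ρ : ℝ) (G : Set (ℝ × ℝ)) : Prop where
  isOpen : IsOpen G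
  isConnected : IsConnected G
  isBounded : Bornology.IsBounded G
  A_pos : 0 < A
  disk_subset : disk a b A ⊆ G
  circ_frontier : circ a b A ∩ frontier G = ∅
  rect_subset : rect a b c₁ c₂ ⊆ disk a b A
  rho_mem : ρ ∈ Ioo (0 : ℝ) 1
  source_eq_zero : ∀ x₀ ∈ circ a b A, ∀ z ∈ closure (rect a b c₁ c₂), source ρ (z - x₀) = 0

/-- Admissible conductivities: `σ` is `C²` up to the boundary of `G`, `σ ≥ 1`, and `σ = 1` outside
`Ω`. -/
structure IsConductivity (G Ω : Set (ℝ × ℝ)) (σ : ℝ × ℝ → ℝ) : Prop where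
  contDiffOn : ContDiffOn ℝ 2 σ (closure G)
  one_le : ∀ z ∈ G, 1 ≤ σ z
  eq_one : ∀ z ∈ G \ Ω, σ z = 1

/-- `u` is the potential generated by a source at `x₀`: it is `C²` up to the boundary,
`div (σ ∇u) = -f(· - x₀)` in `G`, and `u = 0` on the boundary of `G`. -/
structure IsPotential (G : Set (ℝ × ℝ)) (ρ : ℝ) (σ : ℝ × ℝ → ℝ) (x₀ : ℝ × ℝ)
    (u : ℝ × ℝ → ℝ) : Prop where
  contDiffOn : ContDiffOn ℝ 2 u (closure G)
  equation : ∀ z ∈ G,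
    pdx (fun y => σ y * pdx u y) z + pdy (fun y => σ y * pdy u y) z = -source ρ (z - x₀)
  boundary : ∀ z ∈ frontier G, u z = 0

/-- The function `w(z, φ) = ln (√σ(z) u(z, x₀(φ)))`; here `u z x₀` is the potential at `z` of the
source at `x₀`. -/
def logPotential (a b A : ℝ) (σ : ℝ × ℝ → ℝ) (u : ℝ × ℝ → ℝ × ℝ → ℝ) (z : ℝ × ℝ) (φ : ℝ) : ℝ :=
  Real.log (√(σ z) * u z (sourcePoint a b A φ))

/-- The coefficient of the equation `Δp + a p = 0` satisfied by `p = √σ u` in `Ω`. -/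
def coeff (σ : ℝ × ℝ → ℝ) (z : ℝ × ℝ) : ℝ := -(lap (fun y => √(σ y)) z / √(σ z))

/-! ### Sobolev spaces -/

/-- Two-dimensional multi-indices of order at most `k`. -/
abbrev MultiIndex (k : ℕ) : Type :=
  {α : Fin (k + 1) × Fin (k + 1) // (α.1 : ℕ) + (α.2 : ℕ) ≤ k}

/-- The space `L²(Ω)`. -/
abbrev L2 (Ω : Set (ℝ × ℝ)) : Type := Lp ℝ 2 (volume.restrict Ω)

/-- The classical partial derivative of order `(i, j)`. -/
def pd (i j : ℕ) (η : ℝ × ℝ → ℝ) : ℝ × ℝ → ℝ := pdx^[i] (pdy^[j] η)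

/-- Test functions: smooth, with compact support inside `Ω`. -/
def IsTest (Ω : Set (ℝ × ℝ)) (η : ℝ × ℝ → ℝ) : Prop :=
  ContDiff ℝ ∞ η ∧ HasCompactSupport η ∧ tsupport η ⊆ Ω

theorem contDiff_pd {η : ℝ × ℝ → ℝ} (h : ContDiff ℝ ∞ η) (h' : HasCompactSupport η) (i j : ℕ) :
    ContDiff ℝ ∞ (pd i j η) ∧ HasCompactSupport (pd i j η) := by
  have step : ∀ (v : ℝ × ℝ) (g : ℝ × ℝ → ℝ), ContDiff ℝ ∞ g ∧ HasCompactSupport g →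
      ContDiff ℝ ∞ (fun z => fderiv ℝ g z v) ∧ HasCompactSupport (fun z => fderiv ℝ g z v) := by
    intro v g hg
    exact ⟨(hg.1.fderiv_right (m := ∞) (by simp)).clm_apply contDiff_const,
      hg.2.fderiv_apply ℝ v⟩
  have hy : ContDiff ℝ ∞ (pdy^[j] η) ∧ HasCompactSupport (pdy^[j] η) := by
    induction j with
    | zero => exact ⟨h, h'⟩
    | succ n ih =>
      rw [Function.iterate_succ_apply']
      exact step (0, 1) _ ih
  unfold pd
  induction i with
  | zero => exact hy
  | succ n ih =>
    rw [Function.iterate_succ_apply']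
    exact step (1, 0) _ ih

theorem integrable_mul_pd {Ω : Set (ℝ × ℝ)} {η : ℝ × ℝ → ℝ} (hη : IsTest Ω η) (i j : ℕ)
    (f : L2 Ω) : Integrable (fun z => f z * pd i j η z) (volume.restrict Ω) := by
  have h := contDiff_pd hη.1 hη.2.1 i j
  exact MemLp.integrable_mul (p := 2) (q := 2) (Lp.memLp f) (h.1.continuous.memLp_of_hasCompactSupport h.2)

theorem integrable_mul_test {Ω : Set (ℝ × ℝ)} {η : ℝ × ℝ → ℝ} (hη : IsTest Ω η)
    (f : L2 Ω) : Integrable (fun z => f z * η z) (volume.restrict Ω) :=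
  integrable_mul_pd hη 0 0 f

/-- The Sobolev space `Hᵏ(Ω)`. A function is given together with its weak derivatives of order at
most `k`, all of them in `L²(Ω)` (the family is determined by its member of order zero), and the
norm is `‖u‖² = ∑_{|α| ≤ k} ‖∂^α u‖²`. -/
def Sobolev (k : ℕ) (Ω : Set (ℝ × ℝ)) : Submodule ℝ (PiLp 2 fun _ : MultiIndex k => L2 Ω) where
  carrier := {u | ∀ α : MultiIndex k, ∀ η : ℝ × ℝ → ℝ, IsTest Ω η →
    ∫ z in Ω, u ⟨(0, 0), by simp⟩ z * pd α.1.1 α.1.2 η z =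
      (-1) ^ ((α.1.1 : ℕ) + (α.1.2 : ℕ)) * ∫ z in Ω, u α z * η z}
  zero_mem' := by
    intro α η _
    have h0 : ∀ g : ℝ × ℝ → ℝ,
        ∫ z in Ω, ((0 : L2 Ω) : ℝ × ℝ → ℝ) z * g z = 0 := by
      intro g
      rw [integral_congr_ae (g := fun _ => (0 : ℝ)) ?_]
      · simp
      · filter_upwards [Lp.coeFn_zero ℝ 2 (volume.restrict Ω)] with z hz
        rw [hz]; simp
    simp only [PiLp.zero_apply]
    rw [h0, h0, mul_zero]
  add_mem' := by
    intro u v hu hv α η hη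
    have hadd : ∀ (f g : L2 Ω) (t : ℝ × ℝ → ℝ),
        Integrable (fun z => f z * t z) (volume.restrict Ω) →
        Integrable (fun z => g z * t z) (volume.restrict Ω) →
        ∫ z in Ω, (f + g : L2 Ω) z * t z = (∫ z in Ω, f z * t z) + ∫ z in Ω, g z * t z := by
      intro f g t hf hg
      rw [← integral_add hf hg]
      refine integral_congr_ae ?_
      filter_upwards [Lp.coeFn_add f g] with z hz
      simp only [hz, Pi.add_apply]
      ring
    simp only [PiLp.add_apply]
    rw [hadd _ _ _ (integrable_mul_pd hη _ _ _) (integrable_mul_pd hη _ _ _),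
      hadd _ _ _ (integrable_mul_test hη _) (integrable_mul_test hη _), hu α η hη, hv α η hη]
    ring
  smul_mem' := by
    intro c u hu α η hη
    have hsmul : ∀ (f : L2 Ω) (t : ℝ × ℝ → ℝ),
        ∫ z in Ω, (c • f : L2 Ω) z * t z = c * ∫ z in Ω, f z * t z := by
      intro f t
      rw [← integral_const_mul]
      refine integral_congr_ae ?_
      filter_upwards [Lp.coeFn_smul c f] with z hz
      simp only [hz, Pi.smul_apply, smul_eq_mul]
      ring
    simp only [PiLp.smul_apply]
    rw [hsmul, hsmul, hu α η hη]
    ring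

/-- The Hilbert space `H³(Ω)`. -/
def H3 (Ω : Set (ℝ × ℝ)) : Type := Sobolev 3 Ω

instance (Ω : Set (ℝ × ℝ)) : NormedAddCommGroup (H3 Ω) :=
  inferInstanceAs (NormedAddCommGroup (Sobolev 3 Ω))

instance (Ω : Set (ℝ × ℝ)) : InnerProductSpace ℝ (H3 Ω) :=
  inferInstanceAs (InnerProductSpace ℝ (Sobolev 3 Ω))

variable {Ω : Set (ℝ × ℝ)}

/-- The function underlying an element of `H³(Ω)`. -/
def val (u : H3 Ω) : L2 Ω := u.1 ⟨(0, 0), by decide⟩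

/-- The weak derivative `u_x`. -/
def dx (u : H3 Ω) : L2 Ω := u.1 ⟨(1, 0), by decide⟩

/-- The weak derivative `u_y`. -/
def dy (u : H3 Ω) : L2 Ω := u.1 ⟨(0, 1), by decide⟩

/-- The weak derivative `u_xx`. -/
def dxx (u : H3 Ω) : L2 Ω := u.1 ⟨(2, 0), by decide⟩

/-- The weak derivative `u_yy`. -/
def dyy (u : H3 Ω) : L2 Ω := u.1 ⟨(0, 2), by decide⟩

/-- The boundary conditions `u = β₀` on `∂Ω` and `u_x = β₁` on `Γ`. Elements of `H³(Ω)` are `C¹` up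
to the boundary, and the conditions are those on the continuous representatives of `u`, `u_x`. -/
def HasBoundaryValues (Γ : Set (ℝ × ℝ)) (u : H3 Ω) (β₀ β₁ : ℝ × ℝ → ℝ) : Prop :=
  (∃ U : ℝ × ℝ → ℝ, ContinuousOn U (closure Ω) ∧ val u =ᵐ[volume.restrict Ω] U ∧
    ∀ z ∈ frontier Ω, U z = β₀ z) ∧
  (∃ U : ℝ × ℝ → ℝ, ContinuousOn U (closure Ω) ∧ dx u =ᵐ[volume.restrict Ω] U ∧
    ∀ z ∈ Γ, U z = β₁ z)

/-- The space `H³(Ω) × H³(Ω)` with its Hilbert norm `‖(r, s)‖² = ‖r‖² + ‖s‖²`. -/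
abbrev Pair (Ω : Set (ℝ × ℝ)) : Type := WithLp 2 (H3 Ω × H3 Ω)

/-- The subspace `H₀³(Ω)` of `H³(Ω)`: `u = 0` on `∂Ω` and `u_x = 0` on `Γ`. -/
def H3₀ (Ω Γ : Set (ℝ × ℝ)) : Submodule ℝ (H3 Ω) where
  carrier := {u | HasBoundaryValues Γ u 0 0}
  zero_mem' := by
    refine ⟨⟨0, continuousOn_const, ?_, by simp⟩, ⟨0, continuousOn_const, ?_, by simp⟩⟩
    · exact Lp.coeFn_zero ℝ 2 (volume.restrict Ω)
    · exact Lp.coeFn_zero ℝ 2 (volume.restrict Ω)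
  add_mem' := by
    rintro u v ⟨⟨U, hU, hUu, hU0⟩, ⟨U', hU', hUu', hU0'⟩⟩ ⟨⟨V, hV, hVv, hV0⟩, ⟨V', hV', hVv', hV0'⟩⟩
    refine ⟨⟨U + V, hU.add hV, ?_, fun z hz => by simp [hU0 z hz, hV0 z hz]⟩,
      ⟨U' + V', hU'.add hV', ?_, fun z hz => by simp [hU0' z hz, hV0' z hz]⟩⟩
    · exact (Lp.coeFn_add (val u) (val v)).trans (hUu.add hVv)
    · exact (Lp.coeFn_add (dx u) (dx v)).trans (hUu'.add hVv')
  smul_mem' := by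
    rintro c u ⟨⟨U, hU, hUu, hU0⟩, ⟨U', hU', hUu', hU0'⟩⟩
    refine ⟨⟨c • U, hU.const_smul c, ?_, fun z hz => by simp [hU0 z hz]⟩,
      ⟨c • U', hU'.const_smul c, ?_, fun z hz => by simp [hU0' z hz]⟩⟩
    · exact (Lp.coeFn_smul c (val u)).trans (hUu.const_smul c)
    · exact (Lp.coeFn_smul c (dx u)).trans (hUu'.const_smul c)

/-- The subspace `H₀³(Ω) × H₀³(Ω)` of `H³(Ω) × H³(Ω)`. -/
def Pair₀ (Ω Γ : Set (ℝ × ℝ)) : Submodule ℝ (Pair Ω) where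
  carrier := {x | x.fst ∈ H3₀ Ω Γ ∧ x.snd ∈ H3₀ Ω Γ}
  zero_mem' := ⟨(H3₀ Ω Γ).zero_mem, (H3₀ Ω Γ).zero_mem⟩
  add_mem' hx hy := ⟨(H3₀ Ω Γ).add_mem hx.1 hy.1, (H3₀ Ω Γ).add_mem hx.2 hy.2⟩
  smul_mem' c _ hx := ⟨(H3₀ Ω Γ).smul_mem c hx.1, (H3₀ Ω Γ).smul_mem c hx.2⟩

/-- The space `H₂` of bounded, strongly measurable families `φ ↦ (r, s)(·, φ)` of elements of
`H³(Ω) × H³(Ω)`, with the norm `sup_φ ‖(r, s)(·, φ)‖`. -/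
def H₂ (Ω : Set (ℝ × ℝ)) : Submodule ℝ (lp (fun _ : Angle => Pair Ω) ∞) where
  carrier := {X | StronglyMeasurable fun φ => X φ}
  zero_mem' := stronglyMeasurable_const
  add_mem' hX hY := hX.add hY
  smul_mem' c _ hX := hX.const_smul c

/-! ### Boundary data and the sets `B(R)` -/

/-- Boundary data `g₀` on `∂Ω`, `g₁` on `Γ` as functions of the point and the angle: `g₀` is
positive, and both are differentiable in the angle. -/
structure IsData (Ω Γ : Set (ℝ × ℝ)) (g₀ g₁ : ℝ × ℝ → ℝ → ℝ) : Prop where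
  pos : ∀ z ∈ frontier Ω, ∀ φ : Angle, 0 < g₀ z φ
  diff₀ : ∀ z ∈ frontier Ω, ∀ φ : Angle, DifferentiableAt ℝ (g₀ z) φ
  diff₁ : ∀ z ∈ Γ, ∀ φ : Angle, DifferentiableAt ℝ (g₁ z) φ

/-- The boundary conditions generated by the data `g₀`, `g₁`. With `s₀ = ln g₀` and `s₁ = g₁ / g₀`
they are `r = ∂_φ s₀`, `s = ∂_φ s₀ - ε s₀` on `∂Ω`, and `∂_n r = ∂_φ s₁`,
`∂_n s = ∂_φ s₁ - ε s₁` on `Γ`. -/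
def MatchesData (Γ : Set (ℝ × ℝ)) (ε : ℝ) (g₀ g₁ : ℝ × ℝ → ℝ → ℝ) (X : H₂ Ω) : Prop :=
  ∀ φ : Angle,
    HasBoundaryValues Γ (X.1 φ).fst
      (fun z => deriv (fun t => Real.log (g₀ z t)) φ)
      (fun z => deriv (fun t => g₁ z t / g₀ z t) φ) ∧
    HasBoundaryValues Γ (X.1 φ).snd
      (fun z => deriv (fun t => Real.log (g₀ z t)) φ - ε * Real.log (g₀ z φ))
      (fun z => deriv (fun t => g₁ z t / g₀ z t) φ - ε * (g₁ z φ / g₀ z φ))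

/-- The set `B(R)` for the data `g₀`, `g₁`. -/
def ballB (Γ : Set (ℝ × ℝ)) (ε : ℝ) (g₀ g₁ : ℝ × ℝ → ℝ → ℝ) (R : ℝ) : Set (H₂ Ω) :=
  {X | ‖X‖ < R ∧ MatchesData Γ ε g₀ g₁ X}

/-- The closed ball `B₀(R)` of families with zero boundary conditions. -/
def closedBallB₀ (Γ : Set (ℝ × ℝ)) (R : ℝ) : Set (H₂ Ω) :=
  {X | ‖X‖ ≤ R ∧ ∀ φ : Angle, X.1 φ ∈ Pair₀ Ω Γ}

/-- `X = (r*, s*)` is the exact pair `r* = ∂_φ w*`, `s* = ∂_φ w* - ε w*`, where `w*` is the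
logarithmic potential of the conductivity `σ` with potentials `u`. -/
def IsExactPair (a b A ε : ℝ) (σ : ℝ × ℝ → ℝ) (u : ℝ × ℝ → ℝ × ℝ → ℝ) (X : H₂ Ω) : Prop :=
  ∀ φ : Angle, ∀ᵐ z ∂(volume.restrict Ω),
    HasDerivAt (fun t => logPotential a b A σ u z t) (val (X.1 φ).fst z) φ ∧
    val (X.1 φ).snd z = val (X.1 φ).fst z - ε * logPotential a b A σ u z φ

/-! ### The functional and the gradient descent -/

/-- The nonlinear part `2 ∇r · ∇((r - s) / ε)` of both operators. -/
def nonlin (ε : ℝ) (x : Pair Ω) (z : ℝ × ℝ) : ℝ :=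
  2 * (dx x.fst z * ((dx x.fst z - dx x.snd z) / ε) +
    dy x.fst z * ((dy x.fst z - dy x.snd z) / ε))

/-- `L₁(r, s) = Δr + 2 ∇r · ∇((r - s) / ε)`. -/
def L₁ (ε : ℝ) (x : Pair Ω) (z : ℝ × ℝ) : ℝ := dxx x.fst z + dyy x.fst z + nonlin ε x z

/-- `L₂(r, s) = Δs + 2 ∇r · ∇((r - s) / ε)`. -/
def L₂ (ε : ℝ) (x : Pair Ω) (z : ℝ × ℝ) : ℝ := dxx x.snd z + dyy x.snd z + nonlin ε x z

/-- The functional `J` with the Carleman weight `exp (2 lam x²)`, on a pair `(r, s)(·, φ)`. -/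
def J (ε lam α : ℝ) (x : Pair Ω) : ℝ :=
  √ε * (∫ z in Ω, (L₁ ε x z ^ 2 + L₂ ε x z ^ 2) * Real.exp (2 * lam * z.1 ^ 2)) + α * ‖x‖ ^ 2

/-- `M = Q + P`, where `Q` minimizes `F(Q)(φ) = J((Q + P)(φ))` over the closed ball `B₀(2R)`, for
every angle `φ`. -/
def IsMinimizer (Γ : Set (ℝ × ℝ)) (ε lam α R : ℝ) (P M : H₂ Ω) : Prop :=
  M - P ∈ closedBallB₀ Γ (2 * R) ∧
  ∀ Q ∈ closedBallB₀ (Ω := Ω) Γ (2 * R), ∀ φ : Angle,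
    J ε lam α (M.1 φ) ≤ J ε lam α ((Q + P).1 φ)

/-- `g ∈ H₀³(Ω) × H₀³(Ω)` is the gradient of `J` at `x`: it represents, through the inner product of
`H³(Ω) × H³(Ω)`, the Fréchet derivative of `J` at `x` in the directions `H₀³(Ω) × H₀³(Ω)`. -/
def IsGradient (Γ : Set (ℝ × ℝ)) (ε lam α : ℝ) (x : Pair Ω) (g : Pair₀ Ω Γ) : Prop :=
  HasFDerivAt (fun h : Pair₀ Ω Γ => J ε lam α (x + (h : Pair Ω)))
    ((innerSL ℝ (g : Pair Ω)).comp (Pair₀ Ω Γ).subtypeL) 0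

/-- The gradient descent with step `γ`, started at `X₀`. -/
def IsDescent (Γ : Set (ℝ × ℝ)) (ε lam α γ : ℝ) (X₀ : H₂ Ω) (X : ℕ → H₂ Ω) : Prop :=
  X 0 = X₀ ∧ ∀ n, ∀ φ : Angle, ∃ g : Pair₀ Ω Γ,
    IsGradient Γ ε lam α ((X n).1 φ) g ∧ (X (n + 1)).1 φ = (X n).1 φ - γ • (g : Pair Ω)

/-- `c` is the coefficient reconstructed from the family `X = (r, s)`: with `w = (r - s) / ε`,
`c = -(1 / 2π) ∫ (Δw + |∇w|²) dφ` over `(0, 2π)`, a Bochner integral in `L²(Ω)`. -/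
def IsReconstruction (ε : ℝ) (X : H₂ Ω) (c : L2 Ω) : Prop :=
  ∃ F : ℝ → L2 Ω,
    (∀ φ : Angle, F φ =ᵐ[volume.restrict Ω] fun z =>
      ((dxx (X.1 φ).fst z - dxx (X.1 φ).snd z) / ε + (dyy (X.1 φ).fst z - dyy (X.1 φ).snd z) / ε) +
      (((dx (X.1 φ).fst z - dx (X.1 φ).snd z) / ε) ^ 2 +
        ((dy (X.1 φ).fst z - dy (X.1 φ).snd z) / ε) ^ 2)) ∧
    IntegrableOn F (Ioo 0 (2 * Real.pi)) ∧
    c = -((1 / (2 * Real.pi)) • ∫ φ in Ioo 0 (2 * Real.pi), F φ)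

end EIT

end

open EIT

/-! For each angle the functional is, up to the factor `√ε`, a sum of two squared `L²` norms of
quadratic maps `x ↦ Sπx + B(x, x)` (the weighted `L₁`, `L₂`), plus `α‖x‖²`. For a quadratic map `q`
the first-order remainder of `‖q‖²` in a direction `h = y - x` is exactly `‖q(y) - q(x)‖² + 2⟨q(x),
B(h, h)⟩` (`quadSq_sub`). On the ball of radius `3R` all gradients are bounded, because `H³` embeds
in `C¹`, so pointwise the remainder is at least `½|Δh|² - C(1 + |Δx|)|∇h|²` times the weight
(`pointwise_lower`, `component_lower`).

The negative term is absorbed by a Carleman estimate for `h ∈ H₀³` (`exists_carleman_H3₀`): with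
weight `exp(2λx²)`, the integral of `|∇h|²` is at most `C/√λ` times that of `|Δh|²`. The factor
`|Δx|` is only an `H¹` function and need not be bounded. A second Carleman bound, for second
derivatives of `h`, together with Ladyzhenskaya's inequality shows that even `∫|Δx||∇h|²` is
`O(λ^(-1/2)) ∫|Δh|²`. Hence for `λ ≥ Λ(R, Ω, ε)` both squares together have nonnegative remainder
and the functional is strongly convex with constant `α`, whatever `α > 0` is
(`exists_convexOnBall`).

The rest of the optimization is Hilbert space theory (`ConvexOnBall`). Minimizing sequences are
Cauchy; the minimizer is unique and continuous in the centre `P`, hence measurable in the angle. The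
assumed distance of the minimizer to the exact pair puts it in the ball of radius `R/3`, so the norm
constraint is inactive and the gradient vanishes there. A gradient step then contracts towards it by
`θ = √(1 - αγ)` once `γ` is small against `α` and the Lipschitz constant of the derivative, and the
iterates never leave the ball of radius `R` (`norm_descent_sub_le`).

For the coefficient, the potential is positive by the strong minimum principle, so `w* = ln(√σ u)`
is of class `C²` in `Ω` and `Δw* + |∇w*|² = Δ√σ/√σ = -a*` for every angle
(`contDiffAt_log_potential`). The map `(r, s) ↦ Δw + |∇w|²` is Lipschitz on bounded sets from `H³ ×
H³` to `L²` (`exists_recon`), and averaging over the angle keeps the error bound.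

Integrations by parts and traces are done on one-dimensional slices: on a rectangle, elements of
`H³` have representatives that are absolutely continuous along lines (`exists_mixRep`). -/

namespace EIT

/-! ### Absolutely continuous functions of one variable -/

/-- Lebesgue measure on the open interval `(s, t)`. -/
noncomputable abbrev ivl (s t : ℝ) : Measure ℝ := volume.restrict (Ioo s t)

/-- `f` is absolutely continuous on `[s, t]`, with derivative `f'` almost everywhere. -/
structure ACD (s t : ℝ) (f f' : ℝ → ℝ) : Prop where
  ac : AbsolutelyContinuousOnInterval f s t
  deriv : ∀ᵐ x ∂(ivl s t), HasDerivAt f (f' x) x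

theorem intervalIntegral_eq_ivl {s t : ℝ} (hst : s ≤ t) (f : ℝ → ℝ) :
    ∫ x in s..t, f x = ∫ x, f x ∂(ivl s t) := by
  rw [intervalIntegral.integral_of_le hst, integral_Ioc_eq_integral_Ioo]

theorem intervalIntegrable_iff_ivl {s t : ℝ} (hst : s ≤ t) (f : ℝ → ℝ) :
    IntervalIntegrable f volume s t ↔ Integrable f (ivl s t) := by
  rw [intervalIntegrable_iff_integrableOn_Ioo_of_le hst, IntegrableOn]

theorem ae_ivl_of_forall {s t : ℝ} {p : ℝ → Prop} (h : ∀ x ∈ Ioo s t, p x) :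
    ∀ᵐ x ∂(ivl s t), p x :=
  (ae_restrict_iff' measurableSet_Ioo).2 (Filter.Eventually.of_forall h)

namespace ACD

variable {s t : ℝ} {f f' g g' : ℝ → ℝ}

theorem ae_deriv_eq (h : ACD s t f f') : ∀ᵐ x ∂(ivl s t), _root_.deriv f x = f' x := by
  filter_upwards [h.deriv] with x hx using hx.deriv

theorem integrable (hst : s ≤ t) (h : ACD s t f f') : Integrable f' (ivl s t) :=
  ((intervalIntegrable_iff_ivl hst _).1 h.ac.intervalIntegrable_deriv).congr h.ae_deriv_eq

theorem integral_eq (hst : s ≤ t) (h : ACD s t f f') : ∫ x, f' x ∂(ivl s t) = f t - f s := by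
  rw [← h.ac.integral_deriv_eq_sub, intervalIntegral_eq_ivl hst]
  exact integral_congr_ae (h.ae_deriv_eq.mono fun x hx => hx.symm)

theorem mono {s' t' : ℝ} (hs : s ≤ s') (hst : s' ≤ t') (ht : t' ≤ t) (h : ACD s t f f') :
    ACD s' t' f f' := by
  refine ⟨h.ac.mono ?_, ae_restrict_of_ae_restrict_of_subset (Ioo_subset_Ioo hs ht) h.deriv⟩
  rw [uIcc_of_le hst, uIcc_of_le (by linarith)]
  exact Icc_subset_Icc hs ht

theorem eq_add_integral (h : ACD s t f f') {x : ℝ} (hx : x ∈ Icc s t) :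
    f x = f s + ∫ r in s..x, f' r := by
  rw [intervalIntegral_eq_ivl hx.1, (h.mono le_rfl hx.1 hx.2).integral_eq hx.1]
  ring

theorem add (hf : ACD s t f f') (hg : ACD s t g g') :
    ACD s t (fun x => f x + g x) (fun x => f' x + g' x) :=
  ⟨hf.ac.add hg.ac, by filter_upwards [hf.deriv, hg.deriv] with x h h' using h.add h'⟩

theorem mul (hf : ACD s t f f') (hg : ACD s t g g') :
    ACD s t (fun x => f x * g x) (fun x => f' x * g x + f x * g' x) :=
  ⟨hf.ac.mul hg.ac, by filter_upwards [hf.deriv, hg.deriv] with x h h' using h.mul h'⟩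

theorem of_contDiff (hf : ContDiff ℝ 1 f) (h : ∀ x, HasDerivAt f (f' x) x) : ACD s t f f' :=
  ⟨hf.contDiffOn.absolutelyContinuousOnInterval, ae_of_all _ h⟩

theorem congr_deriv (hf : ACD s t f f') (h : f' =ᵐ[ivl s t] g') : ACD s t f g' :=
  ⟨hf.ac, by filter_upwards [hf.deriv, h] with x h1 h2 using h2 ▸ h1⟩

theorem congr (hst : s ≤ t) (hf : ACD s t f f') (h : EqOn f g (Icc s t)) : ACD s t g f' := by
  refine ⟨?_, ?_⟩
  · have hac := hf.ac
    rw [absolutelyContinuousOnInterval_iff] at hac ⊢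
    intro ε hε
    obtain ⟨δ, hδ, H⟩ := hac ε hε
    refine ⟨δ, hδ, fun E hE hlt => ?_⟩
    convert H E hE hlt using 1
    refine Finset.sum_congr rfl fun i hi => ?_
    have hm := hE.1 i hi
    rw [uIcc_of_le hst] at hm
    rw [h hm.1, h hm.2]
  · filter_upwards [hf.deriv, ae_ivl_of_forall fun x hx => hx] with x h1 hxs
    exact h1.congr_of_eventuallyEq (Filter.eventually_of_mem (Ioo_mem_nhds hxs.1 hxs.2)
      fun r hr => (h (Ioo_subset_Icc_self hr)).symm)

theorem primitive (hst : s ≤ t) (hf : Integrable f' (ivl s t)) (k : ℝ) :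
    ACD s t (fun x => k + ∫ r in s..x, f' r) f' := by
  have hi := (intervalIntegrable_iff_ivl hst f').2 hf
  refine ⟨?_, ?_⟩
  · have hk : AbsolutelyContinuousOnInterval (fun _ : ℝ => k) s t :=
      (contDiff_const (n := 1)).contDiffOn.absolutelyContinuousOnInterval
    exact hk.add (hi.absolutelyContinuousOnInterval_intervalIntegral (by simp))
  · rw [ae_restrict_iff' measurableSet_Ioo]
    filter_upwards [hi.ae_hasDerivAt_integral] with x hx hxs
    refine (hx ?_ s (by simp)).const_add k
    rw [uIcc_of_le hst]
    exact Ioo_subset_Icc_self hxs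

/-- An absolutely continuous function that vanishes has derivative zero. -/
theorem deriv_ae_eq_zero (hf : ACD s t f f') (h : ∀ x ∈ Ioo s t, f x = 0) :
    f' =ᵐ[ivl s t] 0 := by
  filter_upwards [hf.deriv, ae_ivl_of_forall (fun x hx => hx)] with x hx hxs
  have h0 : f =ᶠ[nhds x] fun _ => 0 :=
    Filter.eventually_of_mem (Ioo_mem_nhds hxs.1 hxs.2) fun y hy => h y hy
  exact (hx.congr_of_eventuallyEq h0.symm).unique (hasDerivAt_const x 0)

/-- The size of an absolutely continuous function, pointwise against its mean. -/
theorem le_average (hst : s < t) (hf : ACD s t f f') {x : ℝ} (hx : x ∈ Icc s t) :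
    f x ≤ (t - s)⁻¹ * (∫ r, f r ∂(ivl s t)) + ∫ r, |f' r| ∂(ivl s t) := by
  have hi := hf.integrable hst.le
  -- Any two values of `f` differ by at most the total variation `∫|f'|`; averaging this inequality
  -- over `y` gives the claim.
  have key : ∀ y ∈ Ioo s t, f x - ∫ r, |f' r| ∂(ivl s t) ≤ f y := by
    intro y hy
    have h1 := hf.eq_add_integral hx
    have h2 := hf.eq_add_integral (Ioo_subset_Icc_self hy)
    have hii : ∀ z ∈ Icc s t, IntervalIntegrable f' volume s z := fun z hz =>
      ((intervalIntegrable_iff_ivl hst.le f').2 hi).mono_set (by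
        rw [uIcc_of_le hz.1, uIcc_of_le hst.le]; exact Icc_subset_Icc le_rfl hz.2)
    have h3 := intervalIntegral.integral_interval_sub_left (hii x hx)
      (hii y (Ioo_subset_Icc_self hy))
    have h4 : |∫ r in y..x, f' r| ≤ ∫ r, |f' r| ∂(ivl s t) := by
      refine (intervalIntegral.norm_integral_le_integral_norm_uIoc (f := f')).trans ?_
      rw [← intervalIntegral_eq_ivl hst.le, intervalIntegral.integral_of_le hst.le]
      refine setIntegral_mono_set ?_ (ae_of_all _ fun r => abs_nonneg _)
        (LE.le.eventuallyLE ?_)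
      · rw [integrableOn_Ioc_iff_integrableOn_Ioo]; exact hi.abs
      · rintro r hr
        rw [mem_uIoc] at hr
        rcases hr with hr | hr
        · exact ⟨hy.1.trans hr.1, hr.2.trans hx.2⟩
        · exact ⟨lt_of_le_of_lt hx.1 hr.1, hr.2.trans hy.2.le⟩
    have h5 := le_abs_self (∫ r in y..x, f' r)
    linarith
  have hfi : Integrable f (ivl s t) := by
    have := hf.ac.continuousOn
    rw [uIcc_of_le hst.le] at this
    exact (this.integrableOn_Icc).mono_set Ioo_subset_Icc_self
  have h1 : ∫ _r, (f x - ∫ r, |f' r| ∂(ivl s t)) ∂(ivl s t) ≤ ∫ r, f r ∂(ivl s t) :=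
    integral_mono_ae (integrable_const _) hfi (ae_ivl_of_forall key)
  have hpos : 0 < t - s := sub_pos.2 hst
  rw [integral_const, smul_eq_mul] at h1
  have : (ivl s t).real univ = t - s := by
    simp [measureReal_def, hst.le]
  rw [this] at h1
  have h2 : (t - s)⁻¹ * ((t - s) * (f x - ∫ r, |f' r| ∂(ivl s t))) ≤
      (t - s)⁻¹ * ∫ r, f r ∂(ivl s t) := mul_le_mul_of_nonneg_left h1 (inv_nonneg.2 hpos.le)
  rw [inv_mul_cancel_left₀ hpos.ne'] at h2
  linarith

end ACD

/-! ### Test functions of product form -/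

/-- Smooth functions of one variable with compact support in `(s, t)`. -/
structure IsTest1 (s t : ℝ) (p : ℝ → ℝ) : Prop where
  smooth : ContDiff ℝ ∞ p
  compact : HasCompactSupport p
  supp : tsupport p ⊆ Ioo s t

namespace IsTest1

variable {s t : ℝ} {p q : ℝ → ℝ}

theorem eq_zero (hp : IsTest1 s t p) {x : ℝ} (hx : x ∉ Ioo s t) : p x = 0 :=
  image_eq_zero_of_notMem_tsupport fun h => hx (hp.supp h)

theorem continuous (hp : IsTest1 s t p) : Continuous p := hp.smooth.continuous

theorem deriv (hp : IsTest1 s t p) : IsTest1 s t (deriv p) :=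
  ⟨(contDiff_infty_iff_deriv.1 hp.smooth).2, hp.compact.deriv,
    fun _ hx => hp.supp (tsupport_deriv_subset hx)⟩

theorem iteratedDeriv (hp : IsTest1 s t p) (n : ℕ) : IsTest1 s t (iteratedDeriv n p) := by
  induction n with
  | zero => simpa using hp
  | succ n ih => rw [iteratedDeriv_succ]; exact ih.deriv

theorem sub_mul (hp : IsTest1 s t p) (hq : IsTest1 s t q) (c : ℝ) :
    IsTest1 s t (fun x => p x - c * q x) := by
  refine ⟨hp.smooth.sub (contDiff_const.mul hq.smooth), hp.compact.sub hq.compact.mul_left, ?_⟩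
  refine (tsupport_sub p (fun x => c * q x)).trans (union_subset hp.supp ?_)
  exact (tsupport_mul_subset_right (f := fun _ => c)).trans hq.supp

theorem exists_bound (hp : IsTest1 s t p) : ∃ C, ∀ x, |p x| ≤ C :=
  hp.compact.exists_bound_of_continuous hp.continuous

theorem acd (hp : IsTest1 s t p) : ACD s t p (_root_.deriv p) :=
  ACD.of_contDiff (hp.smooth.of_le (by simp)) fun x =>
    ((hp.smooth.differentiable (by simp)) x).hasDerivAt

theorem exists_integral_eq_one (hst : s < t) : ∃ p, IsTest1 s t p ∧ ∫ x, p x ∂(ivl s t) = 1 := by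
  let c := (s + t) / 2
  let b : ContDiffBump c := ⟨(t - s) / 8, (t - s) / 4, by linarith, by linarith⟩
  have hsub : tsupport (b.normed volume) ⊆ Ioo s t := by
    rw [b.tsupport_normed_eq, Real.closedBall_eq_Icc]
    intro x hx
    simp only [mem_Icc, b, c] at hx
    constructor <;> linarith [hx.1, hx.2]
  refine ⟨b.normed volume, ⟨b.contDiff_normed, b.hasCompactSupport_normed, hsub⟩, ?_⟩
  rw [setIntegral_eq_integral_of_forall_compl_eq_zero fun x hx => ?_]
  · exact b.integral_normed
  · exact image_eq_zero_of_notMem_tsupport fun h => hx (hsub h)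

/-- A test function with integral zero is the derivative of a test function. -/
theorem exists_primitive (hst : s < t) (hp : IsTest1 s t p) (h0 : ∫ x, p x ∂(ivl s t) = 0) :
    ∃ q, IsTest1 s t q ∧ _root_.deriv q = p := by
  let q : ℝ → ℝ := fun x => ∫ r in s..x, p r
  have hd : ∀ x, HasDerivAt q (p x) x := fun x =>
    intervalIntegral.integral_hasDerivAt_right (hp.continuous.intervalIntegrable _ _)
      (hp.continuous.stronglyMeasurableAtFilter _ _) hp.continuous.continuousAt
  have hder : _root_.deriv q = p := funext fun x => (hd x).deriv
  -- The support sits in a compact subinterval at positive distance from the endpoints. To its left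
  -- the primitive is trivially zero, to its right it equals the full integral, which is zero.
  obtain ⟨s', t', hs', ht', hst', hsup⟩ : ∃ s' t', s < s' ∧ t' < t ∧ s' ≤ t' ∧
      tsupport p ⊆ Icc s' t' := by
    rcases (tsupport p).eq_empty_or_nonempty with h | h
    · exact ⟨(s + t) / 2, (s + t) / 2, by linarith, by linarith, le_rfl, by simp [h]⟩
    · have hm := hp.compact.sInf_mem h
      have hM := hp.compact.sSup_mem h
      refine ⟨_, _, (hp.supp hm).1, (hp.supp hM).2, ?_, ?_⟩
      · exact csInf_le_csSup h hp.compact.bddBelow hp.compact.bddAbove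
      · exact fun x hx => ⟨csInf_le hp.compact.bddBelow hx, le_csSup hp.compact.bddAbove hx⟩
  have hpz : ∀ x, x ∉ Icc s' t' → p x = 0 := fun x hx =>
    image_eq_zero_of_notMem_tsupport fun h => hx (hsup h)
  have hqz : ∀ x, x ∉ Icc s' t' → q x = 0 := by
    intro x hx
    by_cases hxs : x < s'
    · have : ∀ r ∈ uIcc s x, p r = 0 := by
        intro r hr
        apply hpz
        intro h
        have : r ≤ max s x := hr.2
        have := max_lt hs' hxs
        linarith [h.1]
      show ∫ r in s..x, p r = 0
      rw [intervalIntegral.integral_congr (g := fun _ => (0 : ℝ)) this]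
      simp
    · have hxt : t' < x := by
        by_contra hc
        exact hx ⟨not_lt.1 hxs, not_lt.1 hc⟩
      have : ∀ r ∈ uIcc t x, p r = 0 := by
        intro r hr
        apply hpz
        intro h
        have h1 : min t x ≤ r := hr.1
        have := lt_min ht' hxt
        linarith [h.2]
      have h1 : (∫ r in s..t, p r) + ∫ r in t..x, p r = q x :=
        intervalIntegral.integral_add_adjacent_intervals (hp.continuous.intervalIntegrable _ _)
          (hp.continuous.intervalIntegrable _ _)
      rw [← h1, intervalIntegral_eq_ivl hst.le, h0,
        intervalIntegral.integral_congr (g := fun _ => (0 : ℝ)) this]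
      simp
  have hts : tsupport q ⊆ Icc s' t' := by
    refine closure_minimal (fun x hx => ?_) isClosed_Icc
    by_contra hc
    exact hx (hqz x hc)
  refine ⟨q, ⟨?_, ?_, hts.trans ?_⟩, hder⟩
  · rw [contDiff_infty_iff_deriv, hder]
    exact ⟨fun x => (hd x).differentiableAt, hp.smooth⟩
  · exact isCompact_Icc.of_isClosed_subset (isClosed_tsupport q) hts
  · exact fun x hx => ⟨lt_of_lt_of_le hs' hx.1, lt_of_le_of_lt hx.2 ht'⟩

end IsTest1

theorem ae_eq_zero_of_test1 {s t : ℝ} {f : ℝ → ℝ} (hf : Integrable f (ivl s t))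
    (h : ∀ p, IsTest1 s t p → ∫ x, f x * p x ∂(ivl s t) = 0) : f =ᵐ[ivl s t] 0 := by
  have := isOpen_Ioo (a := s) (b := t)|>.ae_eq_zero_of_integral_contDiff_smul_eq_zero (f := f)
    (μ := volume) (IntegrableOn.locallyIntegrableOn hf) (fun g hg hc hs => by
      rw [← h g ⟨hg, hc, hs⟩, setIntegral_eq_integral_of_forall_compl_eq_zero]
      · simp [mul_comm]
      · intro x hx
        simp [image_eq_zero_of_notMem_tsupport fun h' => hx (hs h')])
  exact (ae_restrict_iff' measurableSet_Ioo).2 this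

/-- An integrable function on a rectangle that annihilates all products of test functions is
zero. -/
theorem ae_eq_zero_of_tensor {x₀ x₁ y₀ y₁ : ℝ} {K : ℝ × ℝ → ℝ}
    (hK : Integrable K ((ivl x₀ x₁).prod (ivl y₀ y₁)))
    (h : ∀ p q, IsTest1 x₀ x₁ p → IsTest1 y₀ y₁ q →
      ∫ z, K z * (p z.1 * q z.2) ∂((ivl x₀ x₁).prod (ivl y₀ y₁)) = 0) :
    K =ᵐ[(ivl x₀ x₁).prod (ivl y₀ y₁)] 0 := by
  have hq : ∀ q, IsTest1 y₀ y₁ q →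
      Integrable (fun z : ℝ × ℝ => K z * q z.2) ((ivl x₀ x₁).prod (ivl y₀ y₁)) := by
    intro q hq
    obtain ⟨C, hC⟩ := hq.exists_bound
    exact hK.mul_bdd (c := C) (hq.continuous.comp continuous_snd).aestronglyMeasurable
      (ae_of_all _ fun z => hC _)
  have hpq : ∀ p q, IsTest1 x₀ x₁ p → IsTest1 y₀ y₁ q →
      Integrable (fun z : ℝ × ℝ => K z * (p z.1 * q z.2)) ((ivl x₀ x₁).prod (ivl y₀ y₁)) := by
    intro p q hp hq'
    obtain ⟨C, hC⟩ := hp.exists_bound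
    refine ((hq q hq').mul_bdd (c := C) (hp.continuous.comp continuous_fst).aestronglyMeasurable
      (ae_of_all _ fun z => hC _)).congr (ae_of_all _ fun z => ?_)
    simp only [Function.comp]; ring
  have step1 : ∀ q, IsTest1 y₀ y₁ q →
      (fun x => ∫ y, K (x, y) * q y ∂(ivl y₀ y₁)) =ᵐ[ivl x₀ x₁] 0 := by
    intro q hq'
    refine ae_eq_zero_of_test1 (hq q hq').integral_prod_left fun p hp => ?_
    rw [← h p q hp hq', integral_prod _ (hpq p q hp hq')]
    refine integral_congr_ae (ae_of_all _ fun x => ?_)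
    simp only
    rw [← integral_mul_const]
    congr 1; ext y; ring
  -- The set `A` is fixed before `q` varies, so the null set of `step1`, which depends on `q`, does
  -- no harm: only the integral over `A` is used.
  have step2 : ∀ A, MeasurableSet A → (fun y => ∫ x in A, K (x, y) ∂(ivl x₀ x₁)) =ᵐ[ivl y₀ y₁] 0 := by
    intro A hA
    have hKA : Integrable K (((ivl x₀ x₁).restrict A).prod (ivl y₀ y₁)) := by
      have := hK.restrict (s := A ×ˢ univ)
      rwa [← Measure.prod_restrict, Measure.restrict_univ] at this
    refine ae_eq_zero_of_test1 hKA.integral_prod_right fun q hq' => ?_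
    have hKq : Integrable (fun z : ℝ × ℝ => K z * q z.2) (((ivl x₀ x₁).restrict A).prod (ivl y₀ y₁)) := by
      have := (hq q hq').restrict (s := A ×ˢ univ)
      rwa [← Measure.prod_restrict, Measure.restrict_univ] at this
    simp_rw [← integral_mul_const]
    have h1 := integral_integral_swap (f := fun x y => K (x, y) * q y) hKq
    rw [← h1]
    rw [integral_congr_ae (g := fun _ => (0 : ℝ)) (ae_restrict_of_ae (step1 q hq'))]
    simp
  refine hK.ae_eq_zero_of_forall_setIntegral_eq_zero ?_
  intro S hS _
  have htot : ∫ z, K z ∂((ivl x₀ x₁).prod (ivl y₀ y₁)) = 0 := by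
    rw [integral_prod_symm _ hK]
    have := step2 univ MeasurableSet.univ
    simp only [Measure.restrict_univ] at this
    rw [integral_congr_ae this]; simp
  -- Dynkin's argument: product sets are handled by `step2`, complements by the vanishing of the
  -- total integral.
  induction S, hS using MeasurableSpace.induction_on_inter generateFrom_prod.symm isPiSystem_prod with
  | empty => simp
  | basic S hS =>
    obtain ⟨A, hA, B, hB, rfl⟩ := hS
    rw [← Measure.prod_restrict, integral_prod_symm]
    · rw [integral_congr_ae (g := fun _ => (0 : ℝ)) (ae_restrict_of_ae (step2 A hA))]
      simp
    · rw [Measure.prod_restrict]; exact hK.restrict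
  | compl S hS ih =>
    have := integral_add_compl hS hK
    rw [ih (measure_lt_top _ _)] at this
    linarith
  | iUnion f hd hm ih =>
    rw [integral_iUnion hm hd hK.integrableOn]
    simp [fun i => ih i (measure_lt_top _ _)]

end EIT


namespace EIT

/-! ### Weak derivatives on a rectangle and slices -/

/-- Lebesgue measure on the open rectangle `(x₀, x₁) × (y₀, y₁)`. -/
noncomputable abbrev box (x₀ x₁ y₀ y₁ : ℝ) : Measure (ℝ × ℝ) := (ivl x₀ x₁).prod (ivl y₀ y₁)

/-- `g` is the weak derivative of `f` in the first variable, tested with products. -/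
def WeakX (x₀ x₁ y₀ y₁ : ℝ) (f g : ℝ × ℝ → ℝ) : Prop :=
  ∀ p q, IsTest1 x₀ x₁ p → IsTest1 y₀ y₁ q →
    ∫ z, f z * (deriv p z.1 * q z.2) ∂(box x₀ x₁ y₀ y₁) =
      -∫ z, g z * (p z.1 * q z.2) ∂(box x₀ x₁ y₀ y₁)

/-- `g` is the weak derivative of `f` in the second variable, tested with products. -/
def WeakY (x₀ x₁ y₀ y₁ : ℝ) (f g : ℝ × ℝ → ℝ) : Prop :=
  ∀ p q, IsTest1 x₀ x₁ p → IsTest1 y₀ y₁ q →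
    ∫ z, f z * (p z.1 * deriv q z.2) ∂(box x₀ x₁ y₀ y₁) =
      -∫ z, g z * (p z.1 * q z.2) ∂(box x₀ x₁ y₀ y₁)

variable {x₀ x₁ y₀ y₁ : ℝ} {f g : ℝ × ℝ → ℝ}

theorem WeakY.swap (h : WeakY x₀ x₁ y₀ y₁ f g) :
    WeakX y₀ y₁ x₀ x₁ (fun z => f z.swap) (fun z => g z.swap) := by
  intro p q hp hq
  have h1 := h q p hq hp
  rw [← integral_prod_swap, ← integral_prod_swap (fun z => g z * (q z.1 * p z.2))] at h1
  simpa [mul_comm] using h1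

theorem ae_box_swap {P : ℝ × ℝ → Prop} (h : ∀ᵐ z ∂(box y₀ y₁ x₀ x₁), P z.swap) :
    ∀ᵐ z ∂(box x₀ x₁ y₀ y₁), P z := by
  rw [box, ← Measure.prod_swap]
  have := (Measure.measurePreserving_swap (μ := ivl y₀ y₁) (ν := ivl x₀ x₁)).quasiMeasurePreserving
  rw [(measurableEmbedding_prod_swap_aux).ae_map_iff]
  exact h
where
  measurableEmbedding_prod_swap_aux : MeasurableEmbedding (Prod.swap : ℝ × ℝ → ℝ × ℝ) :=
    MeasurableEquiv.prodComm.measurableEmbedding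

theorem integrable_mul_test2 (hf : Integrable f (box x₀ x₁ y₀ y₁)) {p q : ℝ → ℝ}
    (hp : IsTest1 x₀ x₁ p) (hq : IsTest1 y₀ y₁ q) :
    Integrable (fun z => f z * (p z.1 * q z.2)) (box x₀ x₁ y₀ y₁) := by
  obtain ⟨C, hC⟩ := hp.exists_bound
  obtain ⟨D, hD⟩ := hq.exists_bound
  refine hf.mul_bdd (c := C * D) ((hp.continuous.comp continuous_fst).mul
    (hq.continuous.comp continuous_snd)).aestronglyMeasurable (ae_of_all _ fun z => ?_)
  rw [norm_mul]
  exact mul_le_mul (hC _) (hD _) (abs_nonneg _) ((abs_nonneg _).trans (hC 0))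

/-- The primitive of `g` in the first variable. -/
noncomputable def primX (x₀ x₁ : ℝ) (g : ℝ × ℝ → ℝ) (z : ℝ × ℝ) : ℝ :=
  ∫ t, (if t ≤ z.1 then g (t, z.2) else 0) ∂(ivl x₀ x₁)

/-- The cut-off form of `primX` has a fixed domain of integration, which makes it jointly measurable
in both variables; on the closed interval it is the ordinary primitive. -/
theorem primX_eq {x : ℝ} (hx : x ∈ Icc x₀ x₁) (y : ℝ) :
    primX x₀ x₁ g (x, y) = ∫ t in x₀..x, g (t, y) := by
  have h : (fun t => if t ≤ x then g (t, y) else 0) = (Iic x).indicator fun t => g (t, y) := by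
    ext t; simp [indicator]
  rw [primX, intervalIntegral.integral_of_le hx.1]
  simp only
  rw [h, integral_indicator measurableSet_Iic, ← integral_Ioc_eq_integral_Ioo' ,
    Measure.restrict_restrict measurableSet_Iic]
  congr 2
  ext t
  simp only [mem_inter_iff, mem_Iic, mem_Ioc]
  constructor
  · rintro ⟨h1, h2, h3⟩; exact ⟨h2, h1⟩
  · rintro ⟨h1, h2⟩; exact ⟨h2, h1, h2.trans hx.2⟩
where
  integral_Ioc_eq_integral_Ioo' : ∫ t in Iic x, g (t, y) ∂(volume.restrict (Ioc x₀ x₁)) =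
      ∫ t in Iic x, g (t, y) ∂(ivl x₀ x₁) := by
    rw [ivl, restrict_Ioo_eq_restrict_Ioc]

theorem stronglyMeasurable_primX (hg : StronglyMeasurable g) :
    StronglyMeasurable (primX x₀ x₁ g) := by
  unfold primX
  refine StronglyMeasurable.integral_prod_right
    (f := fun (z : ℝ × ℝ) t => if t ≤ z.1 then g (t, z.2) else 0) ?_
  refine StronglyMeasurable.ite (measurableSet_le measurable_snd (measurable_fst.comp measurable_fst)) ?_
    stronglyMeasurable_const
  exact hg.comp_measurable (measurable_snd.prodMk (measurable_snd.comp measurable_fst))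

theorem integrable_primX (hg : Integrable g (box x₀ x₁ y₀ y₁)) (hgm : StronglyMeasurable g) :
    Integrable (primX x₀ x₁ g) (box x₀ x₁ y₀ y₁) := by
  refine Integrable.mono' (g := fun z => ∫ t, ‖g (t, z.2)‖ ∂(ivl x₀ x₁))
    (hg.norm.integral_prod_right.comp_snd _) (stronglyMeasurable_primX hgm).aestronglyMeasurable ?_
  have h := hg.prod_left_ae
  have h' : ∀ᵐ z ∂(box x₀ x₁ y₀ y₁), Integrable (fun t => g (t, z.2)) (ivl x₀ x₁) :=
    Measure.quasiMeasurePreserving_snd.ae h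
  filter_upwards [h'] with z hz
  refine (norm_integral_le_integral_norm _).trans (integral_mono_of_nonneg
    (ae_of_all _ fun _ => norm_nonneg _) hz.norm (ae_of_all _ fun t => ?_))
  simp only
  split_ifs
  · exact le_rfl
  · simp

theorem acd_primX (hx : x₀ ≤ x₁) {y : ℝ} (hg : Integrable (fun t => g (t, y)) (ivl x₀ x₁)) :
    ACD x₀ x₁ (fun x => primX x₀ x₁ g (x, y)) (fun x => g (x, y)) := by
  have h := ACD.primitive hx hg 0
  refine h.congr hx fun x hx' => ?_
  simp only [primX_eq hx', zero_add]

/-- A function with a weak `x`-derivative is, on almost every horizontal slice, a primitive of this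
derivative. -/
theorem WeakX.exists_slice (hx : x₀ < x₁) (hw : WeakX x₀ x₁ y₀ y₁ f g)
    (hf : Integrable f (box x₀ x₁ y₀ y₁)) (hg : Integrable g (box x₀ x₁ y₀ y₁))
    (hgm : StronglyMeasurable g) :
    ∃ c : ℝ → ℝ, Integrable c (ivl y₀ y₁) ∧
      f =ᵐ[box x₀ x₁ y₀ y₁] fun z => c z.2 + primX x₀ x₁ g z := by
  obtain ⟨χ, hχ, hχ1⟩ := IsTest1.exists_integral_eq_one hx
  set M := box x₀ x₁ y₀ y₁
  have hG := integrable_primX (x₀ := x₀) hg hgm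
  have hF : Integrable (fun z => f z - primX x₀ x₁ g z) M := hf.sub hG
  -- The primitive of `g` has weak derivative `g`, by parts on each slice. Hence `f - primX g` has
  -- weak `x`-derivative zero, and it remains to see that it depends on `y` alone.
  have hibp : ∀ p q, IsTest1 x₀ x₁ p → IsTest1 y₀ y₁ q →
      ∫ z, primX x₀ x₁ g z * (deriv p z.1 * q z.2) ∂M = -∫ z, g z * (p z.1 * q z.2) ∂M := by
    intro p q hp hq
    have i1 := integrable_mul_test2 hG hp.deriv hq
    have i2 := integrable_mul_test2 hg hp hq
    have i3 : Integrable (fun z : ℝ × ℝ => primX x₀ x₁ g z * (deriv p z.1 * q z.2) +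
        g z * (p z.1 * q z.2)) M := i1.add i2
    rw [eq_neg_iff_add_eq_zero, ← integral_add i1 i2, integral_prod_symm _ i3]
    have : ∀ᵐ y ∂(ivl y₀ y₁), ∫ x, (primX x₀ x₁ g (x, y) * (deriv p x * q y) +
        g (x, y) * (p x * q y)) ∂(ivl x₀ x₁) = 0 := by
      filter_upwards [hg.prod_left_ae] with y hy
      have h1 := ((acd_primX hx.le hy).mul hp.acd).integral_eq hx.le
      rw [hp.eq_zero (x := x₁) (by simp), hp.eq_zero (x := x₀) (by simp)] at h1
      have : (fun x => primX x₀ x₁ g (x, y) * (deriv p x * q y) + g (x, y) * (p x * q y)) =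
          fun x => (g (x, y) * p x + primX x₀ x₁ g (x, y) * deriv p x) * q y := by
        ext x; ring
      rw [this, integral_mul_const, h1]; ring
    rw [integral_congr_ae this]; simp
  have hF0 : ∀ p q, IsTest1 x₀ x₁ p → IsTest1 y₀ y₁ q →
      ∫ z, (f z - primX x₀ x₁ g z) * (deriv p z.1 * q z.2) ∂M = 0 := by
    intro p q hp hq
    simp_rw [sub_mul]
    rw [integral_sub (integrable_mul_test2 hf hp.deriv hq) (integrable_mul_test2 hG hp.deriv hq),
      hw p q hp hq, hibp p q hp hq, sub_self]
  -- The lemma of du Bois-Reymond with parameter: `χ` has integral one, so `c` is the only candidate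
  -- for a function of `y` alone. A test function `p` with integral `κ` differs from `κχ` by the
  -- derivative of a test function.
  let c : ℝ → ℝ := fun y => ∫ t, (f (t, y) - primX x₀ x₁ g (t, y)) * χ t ∂(ivl x₀ x₁)
  obtain ⟨B, hB⟩ := hχ.exists_bound
  have hFχ : Integrable (fun z : ℝ × ℝ => (f z - primX x₀ x₁ g z) * χ z.1) M :=
    hF.mul_bdd (c := B) (hχ.continuous.comp continuous_fst).aestronglyMeasurable
      (ae_of_all _ fun z => hB _)
  have hc : Integrable c (ivl y₀ y₁) := hFχ.integral_prod_right
  refine ⟨c, hc, ?_⟩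
  have hc2 : Integrable (fun z : ℝ × ℝ => c z.2) M := hc.comp_snd _
  have hdiff : (fun z => f z - primX x₀ x₁ g z - c z.2) =ᵐ[M] 0 := by
    refine ae_eq_zero_of_tensor (hF.sub hc2) fun p q hp hq => ?_
    simp_rw [sub_mul _ (c _)]
    rw [integral_sub (integrable_mul_test2 hF hp hq) (integrable_mul_test2 hc2 hp hq)]
    set κ := ∫ x, p x ∂(ivl x₀ x₁)
    have hpi : Integrable p (ivl x₀ x₁) :=
      (hp.continuous.integrable_of_hasCompactSupport hp.compact).restrict
    have hχi : Integrable χ (ivl x₀ x₁) :=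
      (hχ.continuous.integrable_of_hasCompactSupport hχ.compact).restrict
    obtain ⟨P, hP, hPd⟩ := IsTest1.exists_primitive hx (hp.sub_mul hχ κ) (by
      rw [integral_sub hpi (hχi.const_mul κ), integral_const_mul, hχ1]; simp [κ])
    have h1 := hF0 P q hP hq
    rw [hPd] at h1
    have h2 : ∫ z, (f z - primX x₀ x₁ g z) * (p z.1 * q z.2) ∂M =
        κ * ∫ z, (f z - primX x₀ x₁ g z) * (χ z.1 * q z.2) ∂M := by
      rw [← integral_const_mul, ← sub_eq_zero, ← integral_sub (integrable_mul_test2 hF hp hq)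
        ((integrable_mul_test2 hF hχ hq).const_mul κ), ← h1]
      congr 1; ext z; ring
    have h3 : ∫ z, (f z - primX x₀ x₁ g z) * (χ z.1 * q z.2) ∂M = ∫ y, c y * q y ∂(ivl y₀ y₁) := by
      rw [integral_prod_symm _ (integrable_mul_test2 hF hχ hq)]
      congr 1; ext y
      rw [← integral_mul_const]
      congr 1; ext x; ring
    have h4 : ∫ z, c z.2 * (p z.1 * q z.2) ∂M = κ * ∫ y, c y * q y ∂(ivl y₀ y₁) := by
      rw [← integral_prod_mul (μ := ivl x₀ x₁) (ν := ivl y₀ y₁) p (fun y => c y * q y)]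
      congr 1; ext z; ring
    rw [h2, h3, h4, sub_self]
  filter_upwards [hdiff] with z hz
  simp only [Pi.zero_apply] at hz
  linarith

/-- This serves for functions with just one more derivative, such as the Laplacian of an element of
`H³`, which have no continuous representative in general. -/
theorem WeakX.exists_acd (hx : x₀ < x₁) (hw : WeakX x₀ x₁ y₀ y₁ f g)
    (hf : Integrable f (box x₀ x₁ y₀ y₁)) (hg : Integrable g (box x₀ x₁ y₀ y₁))
    (hgm : StronglyMeasurable g) :
    ∃ F : ℝ × ℝ → ℝ, f =ᵐ[box x₀ x₁ y₀ y₁] F ∧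
      ∀ᵐ y ∂(ivl y₀ y₁), ACD x₀ x₁ (fun x => F (x, y)) (fun x => g (x, y)) := by
  obtain ⟨c, hc, hfc⟩ := hw.exists_slice hx hf hg hgm
  refine ⟨_, hfc, ?_⟩
  filter_upwards [hg.prod_left_ae] with y hy
  have := (ACD.of_contDiff (s := x₀) (t := x₁) (f := fun _ => c y) (f' := fun _ => 0)
    contDiff_const (fun x => hasDerivAt_const _ _)).add (acd_primX hx.le hy)
  simpa using this

end EIT


/-! ### Double primitives and continuous representatives of functions with a mixed derivative -/

namespace EIT

variable {x₀ x₁ y₀ y₁ : ℝ}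

theorem ACD.neg {s t : ℝ} {f f' : ℝ → ℝ} (hf : ACD s t f f') :
    ACD s t (fun x => -f x) (fun x => -f' x) :=
  ⟨hf.ac.neg, by filter_upwards [hf.deriv] with x h using h.neg⟩

theorem ACD.const (s t k : ℝ) : ACD s t (fun _ => k) (fun _ => 0) :=
  ACD.of_contDiff contDiff_const fun x => hasDerivAt_const x k

theorem ACD.abs_le_average {s t : ℝ} {f f' : ℝ → ℝ} (hst : s < t) (hf : ACD s t f f') {x : ℝ}
    (hx : x ∈ Icc s t) :
    |f x| ≤ (t - s)⁻¹ * (∫ r, |f r| ∂(ivl s t)) + ∫ r, |f' r| ∂(ivl s t) := by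
  have hpos : 0 ≤ (t - s)⁻¹ := inv_nonneg.2 (sub_pos.2 hst).le
  have h1 := hf.le_average hst hx
  have h2 := hf.neg.le_average hst hx
  simp only [abs_neg, integral_neg] at h2
  have h3 : |∫ r, f r ∂(ivl s t)| ≤ ∫ r, |f r| ∂(ivl s t) := abs_integral_le_integral_abs
  have h4 := mul_le_mul_of_nonneg_left ((le_abs_self _).trans h3) hpos
  have h5 := mul_le_mul_of_nonneg_left ((neg_le_abs _).trans h3) hpos
  exact abs_le'.2 ⟨by linarith, by linarith⟩

/-- The primitive of `g` in the second variable. -/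
noncomputable def primY (y₀ y₁ : ℝ) (g : ℝ × ℝ → ℝ) (z : ℝ × ℝ) : ℝ :=
  primX y₀ y₁ (fun w => g w.swap) z.swap

theorem WeakY.exists_slice {f g : ℝ × ℝ → ℝ} (hy : y₀ < y₁) (hw : WeakY x₀ x₁ y₀ y₁ f g)
    (hf : Integrable f (box x₀ x₁ y₀ y₁)) (hg : Integrable g (box x₀ x₁ y₀ y₁))
    (hgm : StronglyMeasurable g) :
    ∃ c : ℝ → ℝ, Integrable c (ivl x₀ x₁) ∧
      f =ᵐ[box x₀ x₁ y₀ y₁] fun z => c z.1 + primY y₀ y₁ g z := by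
  obtain ⟨c, hc, h⟩ := hw.swap.exists_slice hy hf.swap hg.swap
    (hgm.comp_measurable measurable_swap)
  refine ⟨c, hc, ae_box_swap ?_⟩
  filter_upwards [h] with z hz
  exact hz

/-- The primitive in one variable. -/
noncomputable def prim1 (s t : ℝ) (p : ℝ → ℝ) (x : ℝ) : ℝ :=
  ∫ r, (if r ≤ x then p r else 0) ∂(ivl s t)

theorem acd_prim1 {s t : ℝ} (hst : s ≤ t) {p : ℝ → ℝ} (hp : Integrable p (ivl s t)) :
    ACD s t (prim1 s t p) p :=
  acd_primX (g := fun z => p z.1) (y := 0) hst hp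

/-- The primitive in both variables. -/
noncomputable def prim2 (x₀ x₁ y₀ y₁ : ℝ) (h : ℝ × ℝ → ℝ) (z : ℝ × ℝ) : ℝ :=
  ∫ w, (if w.1 ≤ z.1 ∧ w.2 ≤ z.2 then h w else 0) ∂(box x₀ x₁ y₀ y₁)

variable {h : ℝ × ℝ → ℝ}

theorem integrable_prim2_aux (hh : Integrable h (box x₀ x₁ y₀ y₁)) (z : ℝ × ℝ) :
    Integrable (fun w : ℝ × ℝ => if w.1 ≤ z.1 ∧ w.2 ≤ z.2 then h w else 0)
      (box x₀ x₁ y₀ y₁) := by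
  have : (fun w : ℝ × ℝ => if w.1 ≤ z.1 ∧ w.2 ≤ z.2 then h w else 0) =
      (Iic z.1 ×ˢ Iic z.2).indicator h := by
    ext w; simp [indicator, Prod.le_def]
  rw [this]
  exact hh.indicator (measurableSet_Iic.prod measurableSet_Iic)

theorem prim2_eq_x (hh : Integrable h (box x₀ x₁ y₀ y₁)) (z : ℝ × ℝ) :
    prim2 x₀ x₁ y₀ y₁ h z = primX x₀ x₁ (primY y₀ y₁ h) z := by
  rw [prim2, integral_prod _ (integrable_prim2_aux hh z), primX]
  congr 1; ext t
  simp only [primY, primX, Prod.swap]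
  split_ifs with ht <;> simp [ht]

theorem prim2_eq_y (hh : Integrable h (box x₀ x₁ y₀ y₁)) (z : ℝ × ℝ) :
    prim2 x₀ x₁ y₀ y₁ h z = primY y₀ y₁ (primX x₀ x₁ h) z := by
  rw [prim2, integral_prod_symm _ (integrable_prim2_aux hh z), primY, primX]
  congr 1; ext t
  simp only [primX, Prod.swap]
  split_ifs with ht <;> simp [ht]

/-- Dominated convergence: the indicator of a quadrant is continuous in its corner at every point
off the two lines through the corner, and these lines are null sets. -/
theorem continuous_prim2 (hh : Integrable h (box x₀ x₁ y₀ y₁)) :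
    Continuous (prim2 x₀ x₁ y₀ y₁ h) := by
  rw [continuous_iff_continuousAt]
  intro z
  refine continuousAt_of_dominated (bound := fun w => ‖h w‖)
    (Filter.Eventually.of_forall fun z => (integrable_prim2_aux hh z).aestronglyMeasurable)
    (Filter.Eventually.of_forall fun z => ae_of_all _ fun w => ?_) hh.norm ?_
  · split_ifs
    · exact le_rfl
    · simp
  · have h1 : ∀ᵐ w ∂(box x₀ x₁ y₀ y₁), w.1 ≠ z.1 :=
      Measure.quasiMeasurePreserving_fst.ae (p := fun t => t ≠ z.1) (Measure.ae_ne _ _)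
    have h2 : ∀ᵐ w ∂(box x₀ x₁ y₀ y₁), w.2 ≠ z.2 :=
      Measure.quasiMeasurePreserving_snd.ae (p := fun t => t ≠ z.2) (Measure.ae_ne _ _)
    have key : ∀ a b : ℝ, a ≠ b → ∀ᶠ b' in nhds b, (a ≤ b' ↔ a ≤ b) := by
      intro a b hab
      rcases lt_or_gt_of_ne hab with hlt | hlt
      · filter_upwards [lt_mem_nhds hlt] with b' hb'
        exact ⟨fun _ => hlt.le, fun _ => le_of_lt hb'⟩
      · filter_upwards [gt_mem_nhds hlt] with b' hb'
        exact ⟨fun h => absurd hb' (not_lt.2 h), fun h => absurd hlt (not_lt.2 h)⟩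
    filter_upwards [h1, h2] with w hw1 hw2
    have e1 := continuousAt_fst.eventually (key _ _ hw1)
    have e2 := continuousAt_snd.eventually (key _ _ hw2)
    refine continuousAt_const.congr (f := fun _ => if w.1 ≤ z.1 ∧ w.2 ≤ z.2 then h w else 0) ?_
    filter_upwards [e1, e2] with z' h1 h2
    simp only [h1, h2]

theorem integrable_primY (hh : Integrable h (box x₀ x₁ y₀ y₁)) (hm : StronglyMeasurable h) :
    Integrable (primY y₀ y₁ h) (box x₀ x₁ y₀ y₁) :=
  (integrable_primX hh.swap (hm.comp_measurable measurable_swap)).swap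

theorem integrable_primX_slice (hh : Integrable h (box x₀ x₁ y₀ y₁)) (hm : StronglyMeasurable h)
    (x : ℝ) : Integrable (fun y => primX x₀ x₁ h (x, y)) (ivl y₀ y₁) := by
  refine Integrable.mono' (g := fun y => ∫ t, ‖h (t, y)‖ ∂(ivl x₀ x₁))
    hh.norm.integral_prod_right
    ((stronglyMeasurable_primX hm).comp_measurable measurable_prodMk_left).aestronglyMeasurable ?_
  filter_upwards [hh.prod_left_ae] with y hy
  refine (norm_integral_le_integral_norm _).trans (integral_mono_of_nonneg
    (ae_of_all _ fun _ => norm_nonneg _) hy.norm (ae_of_all _ fun t => ?_))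
  simp only
  split_ifs
  · exact le_rfl
  · simp

theorem integrable_primY_slice (hh : Integrable h (box x₀ x₁ y₀ y₁)) (hm : StronglyMeasurable h)
    (y : ℝ) : Integrable (fun x => primY y₀ y₁ h (x, y)) (ivl x₀ x₁) :=
  integrable_primX_slice hh.swap (hm.comp_measurable measurable_swap) y

theorem acd_primY (hy : y₀ ≤ y₁) {g : ℝ × ℝ → ℝ} {x : ℝ}
    (hg : Integrable (fun t => g (x, t)) (ivl y₀ y₁)) :
    ACD y₀ y₁ (fun y => primY y₀ y₁ g (x, y)) (fun y => g (x, y)) :=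
  acd_primX (g := fun w => g w.swap) hy hg

/-- `F` is a continuous function on the closed rectangle with partial derivatives `Fx`, `Fy` and
mixed derivative `h`, in the sense of absolutely continuous slices. -/
structure MixRep (x₀ x₁ y₀ y₁ : ℝ) (F Fx Fy h : ℝ × ℝ → ℝ) : Prop where
  cont : ContinuousOn F (Icc x₀ x₁ ×ˢ Icc y₀ y₁)
  acd_x : ∀ y ∈ Icc y₀ y₁, ACD x₀ x₁ (fun x => F (x, y)) (fun x => Fx (x, y))
  acd_y : ∀ x ∈ Icc x₀ x₁, ACD y₀ y₁ (fun y => F (x, y)) (fun y => Fy (x, y))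
  acd_xy : ∀ᵐ x ∂(ivl x₀ x₁), ACD y₀ y₁ (fun y => Fx (x, y)) (fun y => h (x, y))
  acd_yx : ∀ᵐ y ∂(ivl y₀ y₁), ACD x₀ x₁ (fun x => Fy (x, y)) (fun x => h (x, y))
  integrable_x : Integrable Fx (box x₀ x₁ y₀ y₁)
  integrable_y : Integrable Fy (box x₀ x₁ y₀ y₁)
  integrable_xy : Integrable h (box x₀ x₁ y₀ y₁)

/-- A null set of the rectangle meets almost every horizontal line in a null set. On such a line the
two primitives agree at every `x`, not only almost everywhere. -/
theorem primX_congr {g g' : ℝ × ℝ → ℝ} (h : g =ᵐ[box x₀ x₁ y₀ y₁] g') :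
    ∀ᵐ y ∂(ivl y₀ y₁), ∀ x, primX x₀ x₁ g (x, y) = primX x₀ x₁ g' (x, y) := by
  have h' : ∀ᵐ z ∂(box y₀ y₁ x₀ x₁), g z.swap = g' z.swap := by
    refine ae_box_swap (x₀ := y₀) (y₀ := x₀) ?_
    filter_upwards [h] with z hz using by simpa using hz
  filter_upwards [Measure.ae_ae_of_ae_prod h'] with y hy x
  refine integral_congr_ae ?_
  filter_upwards [hy] with t ht
  simp only [Prod.swap] at ht
  simp only [ht]

/-- Integrating in `x` and then in `y` gives `f = c(y) + P(x) + prim2 h`, where `P` is the primitive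
of some `p`; the other order gives `f = d(x) + Q(y) + prim2 h`. Comparison at one good `x` forces `c
- Q` to be constant. So `f` is a constant plus two absolutely continuous functions of one variable
plus a continuous double primitive, and every part of `MixRep` can be read off. -/
theorem exists_mixRep {f fx fy : ℝ × ℝ → ℝ} (hx : x₀ < x₁) (hy : y₀ < y₁)
    (hf : Integrable f (box x₀ x₁ y₀ y₁)) (hfx : Integrable fx (box x₀ x₁ y₀ y₁))
    (hfy : Integrable fy (box x₀ x₁ y₀ y₁)) (hh : Integrable h (box x₀ x₁ y₀ y₁))
    (mx : StronglyMeasurable fx) (my : StronglyMeasurable fy) (mh : StronglyMeasurable h)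
    (wx : WeakX x₀ x₁ y₀ y₁ f fx) (wy : WeakY x₀ x₁ y₀ y₁ f fy)
    (wxy : WeakY x₀ x₁ y₀ y₁ fx h) (wyx : WeakX x₀ x₁ y₀ y₁ fy h) :
    ∃ F Fx Fy, MixRep x₀ x₁ y₀ y₁ F Fx Fy h ∧ f =ᵐ[box x₀ x₁ y₀ y₁] F ∧
      fx =ᵐ[box x₀ x₁ y₀ y₁] Fx ∧ fy =ᵐ[box x₀ x₁ y₀ y₁] Fy := by
  obtain ⟨c, hc, hfc⟩ := wx.exists_slice hx hf hfx mx
  obtain ⟨d, hd, hfd⟩ := wy.exists_slice hy hf hfy my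
  obtain ⟨p, hp, hfp⟩ := wxy.exists_slice hy hfx hh mh
  obtain ⟨q, hq, hfq⟩ := wyx.exists_slice hx hfy hh mh
  have hPY := integrable_primY hh mh
  have hPX := integrable_primX hh mh
  have e1 : f =ᵐ[box x₀ x₁ y₀ y₁] fun z => c z.2 + (prim1 x₀ x₁ p z.1 + prim2 x₀ x₁ y₀ y₁ h z) := by
    have h1 := (Measure.quasiMeasurePreserving_snd (μ := ivl x₀ x₁)).ae (primX_congr hfp)
    filter_upwards [hfc, h1] with z hz1 hz2
    rw [hz1]
    have := hz2 z.1
    rw [Prod.mk.eta] at this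
    rw [this, prim2_eq_x hh, prim1, primX, primX]
    rw [← integral_add]
    · congr 2; ext t; split_ifs <;> simp
    · exact (hp.indicator (s := Iic z.1) measurableSet_Iic).congr (ae_of_all _ fun t => by simp [indicator])
    · exact ((integrable_primY_slice hh mh z.2).indicator (s := Iic z.1) measurableSet_Iic).congr
        (ae_of_all _ fun t => by simp [indicator])
  have e2 : f =ᵐ[box x₀ x₁ y₀ y₁] fun z => d z.1 + (prim1 y₀ y₁ q z.2 + prim2 x₀ x₁ y₀ y₁ h z) := by
    have hfq' : (fun z : ℝ × ℝ => fy z.swap) =ᵐ[box y₀ y₁ x₀ x₁]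
        fun z => q z.1 + primX x₀ x₁ h z.swap := by
      refine ae_box_swap (x₀ := y₀) (y₀ := x₀) ?_
      filter_upwards [hfq] with z hz using by simpa using hz
    have h1 := (Measure.quasiMeasurePreserving_fst (ν := ivl y₀ y₁)).ae (primX_congr hfq')
    filter_upwards [hfd, h1] with z hz1 hz2
    rw [hz1]
    have := hz2 z.2
    rw [primY, show z.swap = (z.2, z.1) from rfl, this, prim2_eq_y hh, prim1, primX, primY, primX,
      ← integral_add]
    · congr 2; ext t; by_cases ht : t ≤ z.2 <;> simp [ht]
    · exact (hq.indicator (s := Iic z.2) measurableSet_Iic).congr (ae_of_all _ fun t => by simp [indicator])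
    · exact ((integrable_primX_slice hh mh z.1).indicator (s := Iic z.2) measurableSet_Iic).congr
        (ae_of_all _ fun t => by simp [indicator])
  obtain ⟨k, hk⟩ : ∃ k, ∀ᵐ y ∂(ivl y₀ y₁), c y = k + prim1 y₀ y₁ q y := by
    have e3 : ∀ᵐ z ∂(box x₀ x₁ y₀ y₁), c z.2 - prim1 y₀ y₁ q z.2 = d z.1 - prim1 x₀ x₁ p z.1 := by
      filter_upwards [e1, e2] with z h1 h2
      rw [h1] at h2
      linarith
    have e4 := Measure.ae_ae_of_ae_prod e3
    have hne : NeZero (ivl x₀ x₁) := ⟨by simp [ivl, Measure.restrict_eq_zero, hx]⟩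
    obtain ⟨x, hx'⟩ := e4.exists
    exact ⟨d x - prim1 x₀ x₁ p x, by filter_upwards [hx'] with y hy'; linarith⟩
  refine ⟨fun z => k + prim1 x₀ x₁ p z.1 + prim1 y₀ y₁ q z.2 + prim2 x₀ x₁ y₀ y₁ h z,
    fun z => p z.1 + primY y₀ y₁ h z, fun z => q z.2 + primX x₀ x₁ h z,
    ⟨?_, ?_, ?_, ?_, ?_, (hp.comp_fst _).add hPY, (hq.comp_snd _).add hPX, hh⟩, ?_, hfp, hfq⟩
  · have c1 := (acd_prim1 hx.le hp).ac.continuousOn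
    have c2 := (acd_prim1 hy.le hq).ac.continuousOn
    rw [uIcc_of_le hx.le] at c1
    rw [uIcc_of_le hy.le] at c2
    refine ((continuousOn_const.add (c1.comp continuousOn_fst fun z hz => hz.1)).add
      (c2.comp continuousOn_snd fun z hz => hz.2)).add (continuous_prim2 hh).continuousOn
  · intro y hy'
    have a1 := ((ACD.const x₀ x₁ k).add (acd_prim1 hx.le hp)).add
      (ACD.const x₀ x₁ (prim1 y₀ y₁ q y))
    have a2 := a1.add (acd_primX (y := y) hx.le (integrable_primY_slice hh mh y))
    simp only [prim2_eq_x hh]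
    simpa using a2
  · intro x hx'
    have a1 := (ACD.const y₀ y₁ (k + prim1 x₀ x₁ p x)).add (acd_prim1 hy.le hq)
    have a2 := a1.add (acd_primY (x := x) hy.le (integrable_primX_slice hh mh x))
    simp only [prim2_eq_y hh]
    simpa using a2
  · filter_upwards [hh.prod_right_ae] with x hx'
    simpa using (ACD.const y₀ y₁ (p x)).add (acd_primY hy.le hx')
  · filter_upwards [hh.prod_left_ae] with y hy'
    simpa using (ACD.const x₀ x₁ (q y)).add (acd_primX hx.le hy')
  · have := (Measure.quasiMeasurePreserving_snd (μ := ivl x₀ x₁)).ae hk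
    filter_upwards [e1, this] with z h1 h2
    rw [h1, h2]; ring

/-- The one-dimensional bound of a value by a mean plus the variation is applied in `x`, and then in
`y` to both resulting integrals. This is where the mixed derivative enters. -/
theorem MixRep.abs_le {F Fx Fy : ℝ × ℝ → ℝ} (hx : x₀ < x₁) (hy : y₀ < y₁)
    (H : MixRep x₀ x₁ y₀ y₁ F Fx Fy h) {z : ℝ × ℝ} (hz : z ∈ Icc x₀ x₁ ×ˢ Icc y₀ y₁) :
    |F z| ≤ (x₁ - x₀)⁻¹ * ((y₁ - y₀)⁻¹ * (∫ w, |F w| ∂(box x₀ x₁ y₀ y₁)) +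
        ∫ w, |Fy w| ∂(box x₀ x₁ y₀ y₁)) +
      ((y₁ - y₀)⁻¹ * (∫ w, |Fx w| ∂(box x₀ x₁ y₀ y₁)) + ∫ w, |h w| ∂(box x₀ x₁ y₀ y₁)) := by
  obtain ⟨x, y⟩ := z
  have hFi : Integrable F (box x₀ x₁ y₀ y₁) := by
    have h1 := H.cont.integrableOn_compact (μ := volume) (isCompact_Icc.prod isCompact_Icc)
    rw [box, Measure.prod_restrict]
    exact h1.mono_set (prod_mono Ioo_subset_Icc_self Ioo_subset_Icc_self)
  have lx : 0 ≤ (x₁ - x₀)⁻¹ := inv_nonneg.2 (sub_pos.2 hx).le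
  have b1 := (H.acd_x y hz.2).abs_le_average hx hz.1
  have i1 : Integrable (fun t => (y₁ - y₀)⁻¹ * (∫ s, |F (t, s)| ∂(ivl y₀ y₁)) +
      ∫ s, |Fy (t, s)| ∂(ivl y₀ y₁)) (ivl x₀ x₁) :=
    (hFi.abs.integral_prod_left.const_mul _).add H.integrable_y.abs.integral_prod_left
  have i2 : Integrable (fun t => (y₁ - y₀)⁻¹ * (∫ s, |Fx (t, s)| ∂(ivl y₀ y₁)) +
      ∫ s, |h (t, s)| ∂(ivl y₀ y₁)) (ivl x₀ x₁) :=
    (H.integrable_x.abs.integral_prod_left.const_mul _).add H.integrable_xy.abs.integral_prod_left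
  have b2 : ∫ t, |F (t, y)| ∂(ivl x₀ x₁) ≤ (y₁ - y₀)⁻¹ * (∫ w, |F w| ∂(box x₀ x₁ y₀ y₁)) +
      ∫ w, |Fy w| ∂(box x₀ x₁ y₀ y₁) := by
    refine (integral_mono_of_nonneg (ae_of_all _ fun _ => abs_nonneg _) i1
      (ae_ivl_of_forall fun t ht =>
        (H.acd_y t (Ioo_subset_Icc_self ht)).abs_le_average hy hz.2)).trans (le_of_eq ?_)
    rw [integral_add (hFi.abs.integral_prod_left.const_mul _)
      H.integrable_y.abs.integral_prod_left, integral_const_mul, integral_prod _ hFi.abs,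
      integral_prod _ H.integrable_y.abs]
  have b3 : ∫ t, |Fx (t, y)| ∂(ivl x₀ x₁) ≤ (y₁ - y₀)⁻¹ * (∫ w, |Fx w| ∂(box x₀ x₁ y₀ y₁)) +
      ∫ w, |h w| ∂(box x₀ x₁ y₀ y₁) := by
    refine (integral_mono_of_nonneg (ae_of_all _ fun _ => abs_nonneg _) i2 (by
      filter_upwards [H.acd_xy] with t ht using ht.abs_le_average hy hz.2)).trans (le_of_eq ?_)
    rw [integral_add (H.integrable_x.abs.integral_prod_left.const_mul _)
      H.integrable_xy.abs.integral_prod_left, integral_const_mul, integral_prod _ H.integrable_x.abs,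
      integral_prod _ H.integrable_xy.abs]
  have := mul_le_mul_of_nonneg_left b2 lx
  linarith

end EIT


namespace EIT

/-! ### The Sobolev space on a rectangle -/

/-- The weak derivative of order `(i, j)`, zero when `i + j > 3`. -/
noncomputable def der {Ω : Set (ℝ × ℝ)} (u : H3 Ω) (i j : ℕ) : L2 Ω :=
  if h : i + j ≤ 3 then u.1 ⟨(⟨i, by omega⟩, ⟨j, by omega⟩), h⟩ else 0

section General

variable {Ω : Set (ℝ × ℝ)}

theorem der_of_le (u : H3 Ω) {i j : ℕ} (h : i + j ≤ 3) :
    der u i j = u.1 ⟨(⟨i, by omega⟩, ⟨j, by omega⟩), h⟩ := dif_pos h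

theorem dx_eq_der (u : H3 Ω) : dx u = der u 1 0 := rfl
theorem dy_eq_der (u : H3 Ω) : dy u = der u 0 1 := rfl
theorem dxx_eq_der (u : H3 Ω) : dxx u = der u 2 0 := rfl
theorem dyy_eq_der (u : H3 Ω) : dyy u = der u 0 2 := rfl

theorem norm_der_le (u : H3 Ω) (i j : ℕ) : ‖der u i j‖ ≤ ‖u‖ := by
  by_cases h : i + j ≤ 3
  · rw [der_of_le u h]
    exact PiLp.norm_apply_le u.1 _
  · rw [der, dif_neg h, norm_zero]; exact norm_nonneg _

theorem der_add (u v : H3 Ω) (i j : ℕ) : der (u + v) i j = der u i j + der v i j := by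
  by_cases h : i + j ≤ 3
  · simp only [der_of_le _ h]; rfl
  · simp [der, h]

theorem der_smul (c : ℝ) (u : H3 Ω) (i j : ℕ) : der (c • u) i j = c • der u i j := by
  by_cases h : i + j ≤ 3
  · simp only [der_of_le _ h]; rfl
  · simp [der, h]

/-- The weak derivative of order `(i, j)` as a bounded linear map. -/
noncomputable def derL (Ω : Set (ℝ × ℝ)) (i j : ℕ) : H3 Ω →L[ℝ] L2 Ω :=
  LinearMap.mkContinuous
    { toFun := fun u => der u i j
      map_add' := fun u v => der_add u v i j
      map_smul' := fun c u => der_smul c u i j } 1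
    (fun u => by simpa using norm_der_le u i j)

theorem der_sub (u v : H3 Ω) (i j : ℕ) : der (u - v) i j = der u i j - der v i j :=
  map_sub (derL Ω i j) u v

theorem integral_der_mul_pd (u : H3 Ω) {i j : ℕ} (h : i + j ≤ 3) {η : ℝ × ℝ → ℝ}
    (hη : IsTest Ω η) :
    ∫ z in Ω, der u 0 0 z * pd i j η z = (-1) ^ (i + j) * ∫ z in Ω, der u i j z * η z := by
  have := u.2 ⟨(⟨i, by omega⟩, ⟨j, by omega⟩), h⟩ η hη
  rw [der_of_le u h]
  exact this

theorem continuous_integral_mul {g : ℝ × ℝ → ℝ} (hg : MemLp g 2 (volume.restrict Ω)) :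
    Continuous fun f : L2 Ω => ∫ z in Ω, f z * g z := by
  have : (fun f : L2 Ω => ∫ z in Ω, f z * g z) = fun f => inner ℝ (hg.toLp g) f := by
    ext f
    rw [L2.inner_def]
    refine integral_congr_ae ?_
    filter_upwards [hg.coeFn_toLp] with z hz
    simp [hz]
  rw [this]
  exact continuous_const.inner continuous_id

/-- Each identity defining weak derivatives is a closed condition on the family of `L²` functions,
so `H³` is a closed subspace of a finite product of copies of `L²`. -/
instance : CompleteSpace (H3 Ω) := by
  have hcl : IsClosed ((Sobolev 3 Ω : Submodule ℝ _) : Set (PiLp 2 fun _ : MultiIndex 3 => L2 Ω)) := by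
    have : ((Sobolev 3 Ω : Submodule ℝ _) : Set (PiLp 2 fun _ : MultiIndex 3 => L2 Ω)) =
        ⋂ (α : MultiIndex 3) (η : ℝ × ℝ → ℝ) (_ : IsTest Ω η),
          {u | ∫ z in Ω, u ⟨(0, 0), by simp⟩ z * pd α.1.1 α.1.2 η z =
            (-1) ^ ((α.1.1 : ℕ) + (α.1.2 : ℕ)) * ∫ z in Ω, u α z * η z} := by
      ext u; simp only [mem_iInter]; rfl
    rw [this]
    refine isClosed_iInter fun α => isClosed_iInter fun η => isClosed_iInter fun hη =>
      isClosed_eq ?_ ?_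
    · have h := contDiff_pd hη.1 hη.2.1 α.1.1 α.1.2
      exact (continuous_integral_mul (h.1.continuous.memLp_of_hasCompactSupport h.2)).comp
        (PiLp.continuous_apply 2 _ _)
    · exact continuous_const.mul ((continuous_integral_mul
        (hη.1.continuous.memLp_of_hasCompactSupport hη.2.1)).comp (PiLp.continuous_apply 2 _ _))
  exact hcl.completeSpace_coe

end General

/-! ### The rectangle: slices of weak derivatives, sup bounds and closed boundary conditions -/

section Rect

variable {a b c₁ c₂ : ℝ}

theorem rect_eq_prod (a b c₁ c₂ : ℝ) :
    rect a b c₁ c₂ = Ioo (a - c₁) (a + c₁) ×ˢ Ioo (b - c₂) (b + c₂) := by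
  ext z
  simp only [rect, mem_prod, mem_Ioo, abs_lt, mem_ofPred_eq]
  constructor
  · rintro ⟨⟨h1, h2⟩, h3, h4⟩; exact ⟨⟨by linarith, by linarith⟩, by linarith, by linarith⟩
  · rintro ⟨⟨h1, h2⟩, h3, h4⟩; exact ⟨⟨by linarith, by linarith⟩, by linarith, by linarith⟩

/-- Lebesgue measure on the rectangle. -/
noncomputable abbrev rectBox (a b c₁ c₂ : ℝ) : Measure (ℝ × ℝ) :=
  box (a - c₁) (a + c₁) (b - c₂) (b + c₂)

theorem restrict_rect (a b c₁ c₂ : ℝ) :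
    volume.restrict (rect a b c₁ c₂) = rectBox a b c₁ c₂ := by
  rw [rect_eq_prod, rectBox, box, ivl, ivl, Measure.prod_restrict]; rfl

theorem isOpen_rect : IsOpen (rect a b c₁ c₂) := by
  rw [rect_eq_prod]; exact isOpen_Ioo.prod isOpen_Ioo

theorem closure_rect (h₁ : 0 < c₁) (h₂ : 0 < c₂) : closure (rect a b c₁ c₂) =
    Icc (a - c₁) (a + c₁) ×ˢ Icc (b - c₂) (b + c₂) := by
  rw [rect_eq_prod, closure_prod_eq, closure_Ioo (by linarith), closure_Ioo (by linarith)]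

instance : IsFiniteMeasure (volume.restrict (rect a b c₁ c₂)) := by
  rw [restrict_rect]; infer_instance

theorem hasFDerivAt_tensor {p q : ℝ → ℝ} {p' q' : ℝ} {z : ℝ × ℝ} (hp : HasDerivAt p p' z.1)
    (hq : HasDerivAt q q' z.2) :
    HasFDerivAt (fun w : ℝ × ℝ => p w.1 * q w.2)
      (p z.1 • (q' • ContinuousLinearMap.snd ℝ ℝ ℝ) + q z.2 • (p' • ContinuousLinearMap.fst ℝ ℝ ℝ))
      z := by
  have h1 : HasFDerivAt (fun w : ℝ × ℝ => p w.1) (p' • ContinuousLinearMap.fst ℝ ℝ ℝ) z :=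
    hp.comp_hasFDerivAt z (hasFDerivAt_fst (𝕜 := ℝ) (p := z))
  have h2 : HasFDerivAt (fun w : ℝ × ℝ => q w.2) (q' • ContinuousLinearMap.snd ℝ ℝ ℝ) z :=
    hq.comp_hasFDerivAt z (hasFDerivAt_snd (𝕜 := ℝ) (p := z))
  exact h1.mul h2

theorem pdx_tensor {p q : ℝ → ℝ} (hp : Differentiable ℝ p) (hq : Differentiable ℝ q) :
    pdx (fun w => p w.1 * q w.2) = fun w => deriv p w.1 * q w.2 := by
  ext z
  rw [pdx, (hasFDerivAt_tensor (hp z.1).hasDerivAt (hq z.2).hasDerivAt).fderiv]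
  simp [mul_comm]

theorem pdy_tensor {p q : ℝ → ℝ} (hp : Differentiable ℝ p) (hq : Differentiable ℝ q) :
    pdy (fun w => p w.1 * q w.2) = fun w => p w.1 * deriv q w.2 := by
  ext z
  rw [pdy, (hasFDerivAt_tensor (hp z.1).hasDerivAt (hq z.2).hasDerivAt).fderiv]
  simp

theorem IsTest1.differentiable {s t : ℝ} {p : ℝ → ℝ} (hp : IsTest1 s t p) : Differentiable ℝ p :=
  hp.smooth.differentiable (by simp)

theorem pd_tensor {s t s' t' : ℝ} {p q : ℝ → ℝ} (hp : IsTest1 s t p) (hq : IsTest1 s' t' q)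
    (i j : ℕ) : pd i j (fun w => p w.1 * q w.2) =
      fun w => iteratedDeriv i p w.1 * iteratedDeriv j q w.2 := by
  have hy : pdy^[j] (fun w : ℝ × ℝ => p w.1 * q w.2) = fun w => p w.1 * iteratedDeriv j q w.2 := by
    induction j with
    | zero => simp
    | succ j ih =>
      rw [Function.iterate_succ_apply', ih, pdy_tensor hp.differentiable
        (hq.iteratedDeriv j).differentiable, iteratedDeriv_succ]
  rw [pd, hy]
  induction i with
  | zero => simp
  | succ i ih =>
    rw [Function.iterate_succ_apply', ih, pdx_tensor (hp.iteratedDeriv i).differentiable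
      (hq.iteratedDeriv j).differentiable, iteratedDeriv_succ]

theorem isTest_tensor {p q : ℝ → ℝ} (hp : IsTest1 (a - c₁) (a + c₁) p)
    (hq : IsTest1 (b - c₂) (b + c₂) q) : IsTest (rect a b c₁ c₂) fun w => p w.1 * q w.2 := by
  have hs : tsupport (fun w : ℝ × ℝ => p w.1 * q w.2) ⊆ tsupport p ×ˢ tsupport q := by
    refine closure_minimal (fun w hw => ?_) ((isClosed_tsupport p).prod (isClosed_tsupport q))
    have hw' : p w.1 * q w.2 ≠ 0 := hw
    exact ⟨subset_tsupport p (left_ne_zero_of_mul hw'), subset_tsupport q (right_ne_zero_of_mul hw')⟩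
  refine ⟨(hp.smooth.comp contDiff_fst).mul (hq.smooth.comp contDiff_snd),
    (hp.compact.prod hq.compact).of_isClosed_subset (isClosed_tsupport _) hs, ?_⟩
  rw [rect_eq_prod]
  exact hs.trans (prod_mono hp.supp hq.supp)

theorem setIntegral_rect (φ : ℝ × ℝ → ℝ) :
    ∫ z in rect a b c₁ c₂, φ z = ∫ z, φ z ∂(rectBox a b c₁ c₂) := by rw [restrict_rect]

theorem ae_rect {P : ℝ × ℝ → Prop} :
    (∀ᵐ z ∂(volume.restrict (rect a b c₁ c₂)), P z) ↔ ∀ᵐ z ∂(rectBox a b c₁ c₂), P z := by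
  rw [restrict_rect]

theorem memLp_rectBox (f : L2 (rect a b c₁ c₂)) : MemLp f 2 (rectBox a b c₁ c₂) := by
  have : ∀ g : ℝ × ℝ → ℝ, MemLp g 2 (volume.restrict (rect a b c₁ c₂)) →
      MemLp g 2 (rectBox a b c₁ c₂) := fun g hg => by rwa [restrict_rect] at hg
  exact this _ (Lp.memLp f)

theorem integrable_rectBox (f : L2 (rect a b c₁ c₂)) : Integrable f (rectBox a b c₁ c₂) :=
  (memLp_rectBox f).integrable (by norm_num)

theorem weak_aux (u : H3 (rect a b c₁ c₂)) {i j : ℕ} (h : i + j ≤ 3) {p q : ℝ → ℝ}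
    (hp : IsTest1 (a - c₁) (a + c₁) p) (hq : IsTest1 (b - c₂) (b + c₂) q) :
    ∫ z, der u 0 0 z * (iteratedDeriv i p z.1 * iteratedDeriv j q z.2) ∂(rectBox a b c₁ c₂) =
      (-1) ^ (i + j) * ∫ z, der u i j z * (p z.1 * q z.2) ∂(rectBox a b c₁ c₂) := by
  have := integral_der_mul_pd u h (isTest_tensor hp hq)
  rwa [pd_tensor hp hq, setIntegral_rect, setIntegral_rect] at this

/-- All weak derivatives are defined relative to the function itself. Testing the one of order `(i,
j)` with `p'` and the one of order `(i+1, j)` with `p` gives the same left side, which relates them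
to each other. -/
theorem weakX_der (u : H3 (rect a b c₁ c₂)) {i j : ℕ} (h : i + j ≤ 2) :
    WeakX (a - c₁) (a + c₁) (b - c₂) (b + c₂) (der u i j) (der u (i + 1) j) := by
  intro p q hp hq
  have h1 := weak_aux u (i := i) (j := j) (by omega) hp.deriv hq
  have h2 := weak_aux u (i := i + 1) (j := j) (by omega) hp hq
  rw [← iteratedDeriv_succ', h2, show i + 1 + j = (i + j) + 1 by ring, pow_succ] at h1
  have h3 : ((-1 : ℝ) ^ (i + j)) ≠ 0 := by positivity
  apply mul_left_cancel₀ h3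
  rw [← h1]; ring

theorem weakY_der (u : H3 (rect a b c₁ c₂)) {i j : ℕ} (h : i + j ≤ 2) :
    WeakY (a - c₁) (a + c₁) (b - c₂) (b + c₂) (der u i j) (der u i (j + 1)) := by
  intro p q hp hq
  have h1 := weak_aux u (i := i) (j := j) (by omega) hp hq.deriv
  have h2 := weak_aux u (i := i) (j := j + 1) (by omega) hp hq
  rw [← iteratedDeriv_succ', h2, show i + (j + 1) = (i + j) + 1 by ring, pow_succ] at h1
  have h3 : ((-1 : ℝ) ^ (i + j)) ≠ 0 := by positivity
  apply mul_left_cancel₀ h3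
  rw [← h1]; ring

/-- The mixed derivative of a derivative of order `i + j` has order `i + j + 2`, which is available
in `H³` exactly when `i + j ≤ 1`. -/
theorem exists_mixRep_der (h₁ : 0 < c₁) (h₂ : 0 < c₂) (u : H3 (rect a b c₁ c₂)) {i j : ℕ}
    (h : i + j ≤ 1) : ∃ F Fx Fy,
      MixRep (a - c₁) (a + c₁) (b - c₂) (b + c₂) F Fx Fy (der u (i + 1) (j + 1)) ∧
      der u i j =ᵐ[rectBox a b c₁ c₂] F ∧ der u (i + 1) j =ᵐ[rectBox a b c₁ c₂] Fx ∧
      der u i (j + 1) =ᵐ[rectBox a b c₁ c₂] Fy :=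
  exists_mixRep (by linarith) (by linarith) (integrable_rectBox _) (integrable_rectBox _)
    (integrable_rectBox _) (integrable_rectBox _) (Lp.stronglyMeasurable _)
    (Lp.stronglyMeasurable _) (Lp.stronglyMeasurable _) (weakX_der u (by omega))
    (weakY_der u (by omega)) (weakY_der u (by omega)) (weakX_der u (by omega))

theorem integral_abs_le (f : L2 (rect a b c₁ c₂)) :
    ∫ z, |f z| ∂(rectBox a b c₁ c₂) ≤ √((rectBox a b c₁ c₂).real univ) * ‖f‖ := by
  rw [← setIntegral_rect, ← restrict_rect]
  have hm : MemLp (fun _ : ℝ × ℝ => (1 : ℝ)) 2 (volume.restrict (rect a b c₁ c₂)) := memLp_const 1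
  have h := integral_mul_le_Lp_mul_Lq_of_nonneg (μ := volume.restrict (rect a b c₁ c₂))
    (Real.HolderConjugate.two_two) (f := fun _ => 1) (g := fun z => |f z|)
    (ae_of_all _ fun _ => zero_le_one) (ae_of_all _ fun _ => abs_nonneg _)
    (by simpa using hm) (by simpa using! (Lp.memLp f).abs)
  have hn : ‖f‖ ^ 2 = ∫ z in rect a b c₁ c₂, f z ^ 2 := by
    rw [← real_inner_self_eq_norm_sq, L2.inner_def]
    refine integral_congr_ae (ae_of_all _ fun z => ?_)
    simp [sq]
  simp only [one_mul, Real.rpow_two, sq_abs, one_pow, ← hn, ← Real.sqrt_eq_rpow] at h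
  rw [Real.sqrt_sq (norm_nonneg _)] at h
  simpa using h

/-- The embedding of `H³` into `W^{1,∞}`. -/
theorem exists_sup_bound (h₁ : 0 < c₁) (h₂ : 0 < c₂) : ∃ C, 0 ≤ C ∧
    ∀ (u : H3 (rect a b c₁ c₂)) (i j : ℕ), i + j ≤ 1 →
      ∀ᵐ z ∂(volume.restrict (rect a b c₁ c₂)), |der u i j z| ≤ C * ‖u‖ := by
  set κ := √((rectBox a b c₁ c₂).real univ)
  set l := (a + c₁ - (a - c₁))⁻¹
  set l' := (b + c₂ - (b - c₂))⁻¹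
  have hl : 0 ≤ l := inv_nonneg.2 (by linarith)
  have hl' : 0 ≤ l' := inv_nonneg.2 (by linarith)
  have hκ : 0 ≤ κ := Real.sqrt_nonneg _
  -- The constant of `MixRep.abs_le`, with each of the four `L¹` norms replaced by `κ‖u‖`, where `κ`
  -- is the root of the area.
  refine ⟨l * (l' * κ + κ) + (l' * κ + κ), by positivity, fun u i j h => ?_⟩
  obtain ⟨F, Fx, Fy, H, e, ex, ey⟩ := exists_mixRep_der h₁ h₂ u h
  have hb : ∀ i j, ∫ z, |der u i j z| ∂(rectBox a b c₁ c₂) ≤ κ * ‖u‖ := fun i j =>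
    (integral_abs_le _).trans (mul_le_mul_of_nonneg_left (norm_der_le u i j) hκ)
  have b0 := hb i j
  have b1 := hb (i + 1) j
  have b2 := hb i (j + 1)
  have b3 := hb (i + 1) (j + 1)
  rw [integral_congr_ae (e.mono fun z hz => by simp only [hz] :
    _ =ᵐ[rectBox a b c₁ c₂] fun z => |F z|)] at b0
  rw [integral_congr_ae (ex.mono fun z hz => by simp only [hz] :
    _ =ᵐ[rectBox a b c₁ c₂] fun z => |Fx z|)] at b1
  rw [integral_congr_ae (ey.mono fun z hz => by simp only [hz] :
    _ =ᵐ[rectBox a b c₁ c₂] fun z => |Fy z|)] at b2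
  have hmem : ∀ᵐ z ∂(volume.restrict (rect a b c₁ c₂)), z ∈ rect a b c₁ c₂ :=
    ae_restrict_mem isOpen_rect.measurableSet
  filter_upwards [ae_rect.2 e, hmem] with z hz hzm
  rw [hz]
  have hzc := subset_closure hzm
  rw [closure_rect h₁ h₂] at hzc
  refine (H.abs_le (by linarith) (by linarith) hzc).trans ?_
  calc _ ≤ l * (l' * (κ * ‖u‖) + κ * ‖u‖) + (l' * (κ * ‖u‖) + κ * ‖u‖) := by gcongr
    _ = _ := by ring

/-- The function `max |V| K` is continuous and almost everywhere equal to `K`, hence equal to `K` on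
the open set and then on its closure. -/
theorem abs_le_of_ae {V : ℝ × ℝ → ℝ} {K : ℝ} {Ω : Set (ℝ × ℝ)} (hΩ : IsOpen Ω)
    (hV : ContinuousOn V (closure Ω)) (h : ∀ᵐ z ∂(volume.restrict Ω), |V z| ≤ K) :
    ∀ z ∈ closure Ω, |V z| ≤ K := by
  have h1 : (fun z => max |V z| K) =ᵐ[volume.restrict Ω] fun _ => K := by
    filter_upwards [h] with z hz using max_eq_right hz
  have hc : ContinuousOn (fun z => max |V z| K) (closure Ω) := hV.abs.sup continuousOn_const
  have h2 := Measure.eqOn_open_of_ae_eq h1 hΩ (hc.mono subset_closure) continuousOn_const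
  have h3 := h2.of_subset_closure hc continuousOn_const subset_closure le_rfl
  intro z hz
  have h4 : max |V z| K = K := h3 hz
  exact h4 ▸ le_max_left _ _

theorem eqOn_of_ae {V W : ℝ × ℝ → ℝ} {Ω : Set (ℝ × ℝ)} (hΩ : IsOpen Ω)
    (hV : ContinuousOn V (closure Ω)) (hW : ContinuousOn W (closure Ω))
    (h : V =ᵐ[volume.restrict Ω] W) : EqOn V W (closure Ω) :=
  (Measure.eqOn_open_of_ae_eq h hΩ (hV.mono subset_closure)
    (hW.mono subset_closure)).of_subset_closure hV hW subset_closure le_rfl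

theorem exists_continuous_rep (h₁ : 0 < c₁) (h₂ : 0 < c₂) (u : H3 (rect a b c₁ c₂)) {i j : ℕ}
    (h : i + j ≤ 1) : ∃ F, ContinuousOn F (closure (rect a b c₁ c₂)) ∧
      der u i j =ᵐ[volume.restrict (rect a b c₁ c₂)] F := by
  obtain ⟨F, Fx, Fy, H, e, -, -⟩ := exists_mixRep_der h₁ h₂ u h
  exact ⟨F, by rw [closure_rect h₁ h₂]; exact H.cont, ae_rect.2 e⟩

/-- Convergence in `H³` is uniform convergence of the continuous representatives up to the boundary,
so zero boundary values survive limits. Closedness of `H₀³` gives the projection-type facts used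
later: completeness, the Riesz gradient and the existence of minimizers. -/
theorem closed_trace (h₁ : 0 < c₁) (h₂ : 0 < c₂) {i j : ℕ} (h : i + j ≤ 1) {S : Set (ℝ × ℝ)}
    (hS : S ⊆ closure (rect a b c₁ c₂)) :
    IsClosed {u : H3 (rect a b c₁ c₂) | ∃ U : ℝ × ℝ → ℝ,
      ContinuousOn U (closure (rect a b c₁ c₂)) ∧
      der u i j =ᵐ[volume.restrict (rect a b c₁ c₂)] U ∧ ∀ z ∈ S, U z = 0} := by
  obtain ⟨C, hC0, hC⟩ := exists_sup_bound (a := a) (b := b) h₁ h₂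
  refine isClosed_of_closure_subset fun u hu => ?_
  obtain ⟨F, hF, hFe⟩ := exists_continuous_rep h₁ h₂ u h
  refine ⟨F, hF, hFe, fun z hz => ?_⟩
  refine abs_eq_zero.1 (le_antisymm (le_of_forall_pos_le_add fun δ hδ => ?_) (abs_nonneg _))
  obtain ⟨v, ⟨V, hV, hVe, hV0⟩, hd⟩ := Metric.mem_closure_iff.1 hu (δ / (C + 1)) (by positivity)
  have hle : ∀ᵐ w ∂(volume.restrict (rect a b c₁ c₂)), |F w - V w| ≤ δ := by
    have h4 := Lp.coeFn_sub (der u i j) (der v i j)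
    rw [← der_sub] at h4
    filter_upwards [hC (u - v) i j h, hFe, hVe, h4] with w h1 h2 h3 h4
    rw [h4, Pi.sub_apply, h2, h3] at h1
    rw [dist_eq_norm] at hd
    refine h1.trans ?_
    calc C * ‖u - v‖ ≤ (C + 1) * (δ / (C + 1)) := by gcongr; linarith
      _ = δ := by field_simp
  have := abs_le_of_ae isOpen_rect (hF.sub hV) hle z (hS hz)
  rw [Pi.sub_apply, hV0 z hz, sub_zero] at this
  linarith

theorem isClosed_H3₀ (h₁ : 0 < c₁) (h₂ : 0 < c₂) :
    IsClosed (H3₀ (rect a b c₁ c₂) (rightSide a b c₁ c₂) : Set (H3 (rect a b c₁ c₂))) := by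
  refine IsClosed.inter (closed_trace h₁ h₂ (i := 0) (j := 0) (by norm_num) ?_)
    (closed_trace h₁ h₂ (i := 1) (j := 0) (by norm_num) ?_)
  · exact frontier_subset_closure
  · rintro z ⟨hz1, hz2⟩
    rw [closure_rect h₁ h₂]
    exact ⟨⟨by linarith, hz1.le⟩, Ioo_subset_Icc_self hz2⟩

theorem isClosed_Pair₀ (h₁ : 0 < c₁) (h₂ : 0 < c₂) :
    IsClosed (Pair₀ (rect a b c₁ c₂) (rightSide a b c₁ c₂) : Set (Pair (rect a b c₁ c₂))) :=
  ((isClosed_H3₀ h₁ h₂).preimage (continuous_fst.comp (WithLp.prod_continuous_ofLp 2 _ _))).inter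
    ((isClosed_H3₀ h₁ h₂).preimage (continuous_snd.comp (WithLp.prod_continuous_ofLp 2 _ _)))

end Rect

end EIT


namespace EIT

/-! ### The Carleman estimate -/

variable {x₀ x₁ y₀ y₁ : ℝ}

/-- This and the two versions below replace the divergence theorem: an integrand that is the `x`- or
`y`-derivative of `Ψ` on almost every line contributes only the boundary values of `Ψ`. -/
theorem integral_nonneg_of_slices_x {ψ : ℝ × ℝ → ℝ} (hx : x₀ ≤ x₁)
    (hψ : Integrable ψ (box x₀ x₁ y₀ y₁))
    (h : ∀ᵐ y ∂(ivl y₀ y₁), ∃ Ψ, ACD x₀ x₁ Ψ (fun x => ψ (x, y)) ∧ Ψ x₀ ≤ Ψ x₁) :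
    0 ≤ ∫ z, ψ z ∂(box x₀ x₁ y₀ y₁) := by
  rw [integral_prod_symm _ hψ]
  refine integral_nonneg_of_ae ?_
  filter_upwards [h] with y ⟨Ψ, hΨ, hle⟩
  rw [hΨ.integral_eq hx]
  simpa using hle

theorem integral_eq_zero_of_slices_x {ψ : ℝ × ℝ → ℝ} (hx : x₀ ≤ x₁)
    (hψ : Integrable ψ (box x₀ x₁ y₀ y₁))
    (h : ∀ᵐ y ∂(ivl y₀ y₁), ∃ Ψ, ACD x₀ x₁ Ψ (fun x => ψ (x, y)) ∧ Ψ x₀ = Ψ x₁) :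
    ∫ z, ψ z ∂(box x₀ x₁ y₀ y₁) = 0 := by
  rw [integral_prod_symm _ hψ]
  refine integral_eq_zero_of_ae ?_
  filter_upwards [h] with y ⟨Ψ, hΨ, hle⟩
  rw [hΨ.integral_eq hx, hle, sub_self]; rfl

theorem integral_eq_zero_of_slices_y {ψ : ℝ × ℝ → ℝ} (hy : y₀ ≤ y₁)
    (hψ : Integrable ψ (box x₀ x₁ y₀ y₁))
    (h : ∀ᵐ x ∂(ivl x₀ x₁), ∃ Ψ, ACD y₀ y₁ Ψ (fun y => ψ (x, y)) ∧ Ψ y₀ = Ψ y₁) :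
    ∫ z, ψ z ∂(box x₀ x₁ y₀ y₁) = 0 := by
  rw [integral_prod _ hψ]
  refine integral_eq_zero_of_ae ?_
  filter_upwards [h] with x ⟨Ψ, hΨ, hle⟩
  rw [hΨ.integral_eq hy, hle, sub_self]; rfl

theorem ae_box_mem : ∀ᵐ z ∂(box x₀ x₁ y₀ y₁), z.1 ∈ Ioo x₀ x₁ ∧ z.2 ∈ Ioo y₀ y₁ := by
  rw [box, Measure.prod_restrict]
  exact ae_restrict_mem (measurableSet_Ioo.prod measurableSet_Ioo)

theorem memLp_weight_mul {c : ℝ → ℝ} (hc : Continuous c) {f : ℝ × ℝ → ℝ}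
    (hf : MemLp f 2 (box x₀ x₁ y₀ y₁)) :
    MemLp (fun z => c z.1 * f z) 2 (box x₀ x₁ y₀ y₁) := by
  obtain ⟨B, hB⟩ := (isCompact_Icc (a := x₀) (b := x₁)).exists_bound_of_continuousOn hc.continuousOn
  refine MemLp.of_le_mul (c := B) hf
    ((hc.comp continuous_fst).aestronglyMeasurable.mul hf.aestronglyMeasurable) ?_
  filter_upwards [ae_box_mem] with z hz
  rw [norm_mul]
  exact mul_le_mul_of_nonneg_right (hB _ (Ioo_subset_Icc_self hz.1)) (norm_nonneg _)

theorem integrable_mul2 {f g : ℝ × ℝ → ℝ} (hf : MemLp f 2 (box x₀ x₁ y₀ y₁))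
    (hg : MemLp g 2 (box x₀ x₁ y₀ y₁)) : Integrable (fun z => f z * g z) (box x₀ x₁ y₀ y₁) :=
  MemLp.integrable_mul (p := 2) (q := 2) hf hg

theorem integrable_weight_mul2 {c : ℝ → ℝ} (hc : Continuous c) {f g : ℝ × ℝ → ℝ}
    (hf : MemLp f 2 (box x₀ x₁ y₀ y₁)) (hg : MemLp g 2 (box x₀ x₁ y₀ y₁)) :
    Integrable (fun z => c z.1 * f z * g z) (box x₀ x₁ y₀ y₁) :=
  integrable_mul2 (memLp_weight_mul hc hf) hg

/-- A function on the rectangle with its derivatives, vanishing on the boundary together with the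
normal derivative on the right side, in terms of absolutely continuous slices. -/
structure ZeroSlices (x₀ x₁ y₀ y₁ : ℝ) (H Hx Hy Hxx Hxy Hyy Hxxy : ℝ × ℝ → ℝ) : Prop where
  memH : MemLp H 2 (box x₀ x₁ y₀ y₁)
  memX : MemLp Hx 2 (box x₀ x₁ y₀ y₁)
  memY : MemLp Hy 2 (box x₀ x₁ y₀ y₁)
  memXX : MemLp Hxx 2 (box x₀ x₁ y₀ y₁)
  memXY : MemLp Hxy 2 (box x₀ x₁ y₀ y₁)
  memYY : MemLp Hyy 2 (box x₀ x₁ y₀ y₁)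
  memXXY : MemLp Hxxy 2 (box x₀ x₁ y₀ y₁)
  bdd : ∃ B, ∀ᵐ z ∂(box x₀ x₁ y₀ y₁), |Hx z| ≤ B ∧ |Hy z| ≤ B
  ax : ∀ᵐ y ∂(ivl y₀ y₁), ACD x₀ x₁ (fun x => H (x, y)) (fun x => Hx (x, y)) ∧
    H (x₀, y) = 0 ∧ H (x₁, y) = 0
  axx : ∀ᵐ y ∂(ivl y₀ y₁), ACD x₀ x₁ (fun x => Hx (x, y)) (fun x => Hxx (x, y)) ∧ Hx (x₁, y) = 0
  ayx : ∀ᵐ y ∂(ivl y₀ y₁), ACD x₀ x₁ (fun x => Hy (x, y)) (fun x => Hxy (x, y)) ∧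
    Hy (x₀, y) = 0 ∧ Hy (x₁, y) = 0
  axyx : ∀ᵐ y ∂(ivl y₀ y₁), ACD x₀ x₁ (fun x => Hxy (x, y)) (fun x => Hxxy (x, y))
  ay : ∀ᵐ x ∂(ivl x₀ x₁), ACD y₀ y₁ (fun y => H (x, y)) (fun y => Hy (x, y)) ∧
    H (x, y₀) = 0 ∧ H (x, y₁) = 0
  ayy : ∀ᵐ x ∂(ivl x₀ x₁), ACD y₀ y₁ (fun y => Hy (x, y)) (fun y => Hyy (x, y))
  axy : ∀ᵐ x ∂(ivl x₀ x₁), ACD y₀ y₁ (fun y => Hx (x, y)) (fun y => Hxy (x, y)) ∧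
    Hx (x, y₀) = 0 ∧ Hx (x, y₁) = 0
  axxy : ∀ᵐ x ∂(ivl x₀ x₁), ACD y₀ y₁ (fun y => Hxx (x, y)) (fun y => Hxxy (x, y)) ∧
    Hxx (x, y₀) = 0 ∧ Hxx (x, y₁) = 0

theorem acd_id (s t : ℝ) : ACD s t (fun x => x) (fun _ => 1) :=
  ACD.of_contDiff contDiff_id fun x => hasDerivAt_id x

theorem acd_weight (s t lam : ℝ) :
    ACD s t (fun x => Real.exp (lam * x ^ 2)) (fun x => 2 * lam * x * Real.exp (lam * x ^ 2)) := by
  refine ACD.of_contDiff (by fun_prop) fun x => ?_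
  have h1 : HasDerivAt (fun x : ℝ => lam * x ^ 2) (lam * (2 * x)) x := by
    simpa using (hasDerivAt_pow 2 x).const_mul lam
  convert h1.exp using 1
  ring

namespace ZeroSlices

variable {H Hx Hy Hxx Hxy Hyy Hxxy : ℝ × ℝ → ℝ}

/-- Conjugation with the weight: for `v = eH` one has `eΔH = (Δv + 4λ²x²v) + (-4λx v_x - 2λv)`. The
cross term of the square of this sum is, up to divergences, `8λv_x² + 32λ³x²v²`. It contains no
`v_y²`, which is recovered separately by testing the equation with `v`. -/
theorem carleman_first (h : ZeroSlices x₀ x₁ y₀ y₁ H Hx Hy Hxx Hxy Hyy Hxxy) (hx0 : 0 < x₀)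
    (hx : x₀ < x₁) (hy : y₀ < y₁) {lam : ℝ} (hl : 1 ≤ lam) {A : ℝ}
    (hA : A = ∫ z, (Hxx z + Hyy z) ^ 2 * Real.exp (lam * z.1 ^ 2) ^ 2 ∂(box x₀ x₁ y₀ y₁)) :
    lam * ∫ z, (Hx z ^ 2 + Hy z ^ 2) * Real.exp (lam * z.1 ^ 2) ^ 2 ∂(box x₀ x₁ y₀ y₁) ≤
      (2 + (x₀ ^ 2)⁻¹) * A := by
  set e : ℝ → ℝ := fun x => Real.exp (lam * x ^ 2) with he
  have hec : Continuous e := by fun_prop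
  set M := box x₀ x₁ y₀ y₁
  set v : ℝ × ℝ → ℝ := fun z => e z.1 * H z with hv
  set vx : ℝ × ℝ → ℝ := fun z => e z.1 * (Hx z + 2 * lam * z.1 * H z) with hvx
  set vxx : ℝ × ℝ → ℝ := fun z => e z.1 * (Hxx z + 4 * lam * z.1 * Hx z +
    (2 * lam + 4 * lam ^ 2 * z.1 ^ 2) * H z) with hvxx
  set vy : ℝ × ℝ → ℝ := fun z => e z.1 * Hy z with hvy
  set vyy : ℝ × ℝ → ℝ := fun z => e z.1 * Hyy z with hvyy
  set vxy : ℝ × ℝ → ℝ := fun z => e z.1 * (Hxy z + 2 * lam * z.1 * Hy z) with hvxy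
  have mv : MemLp v 2 M := memLp_weight_mul hec h.memH
  have mvx : MemLp vx 2 M := memLp_weight_mul hec
    (h.memX.add (memLp_weight_mul (c := fun x => 2 * lam * x) (by fun_prop) h.memH))
  have mvxx : MemLp vxx 2 M := memLp_weight_mul hec
    ((h.memXX.add (memLp_weight_mul (c := fun x => 4 * lam * x) (by fun_prop) h.memX)).add
      (memLp_weight_mul (c := fun x => 2 * lam + 4 * lam ^ 2 * x ^ 2) (by fun_prop) h.memH))
  have mvy : MemLp vy 2 M := memLp_weight_mul hec h.memY
  have mvyy : MemLp vyy 2 M := memLp_weight_mul hec h.memYY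
  have mvxy : MemLp vxy 2 M := memLp_weight_mul hec
    (h.memXY.add (memLp_weight_mul (c := fun x => 2 * lam * x) (by fun_prop) h.memY))
  have ix : ∀ {c : ℝ → ℝ}, Continuous c → ∀ {f g : ℝ × ℝ → ℝ}, MemLp f 2 M → MemLp g 2 M →
      Integrable (fun z => c z.1 * f z * g z) M := fun hc _ _ hf hg => integrable_weight_mul2 hc hf hg
  -- absolutely continuous slices
  have sv : ∀ᵐ y ∂(ivl y₀ y₁), ACD x₀ x₁ (fun x => v (x, y)) (fun x => vx (x, y)) ∧
      v (x₀, y) = 0 ∧ v (x₁, y) = 0 := by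
    filter_upwards [h.ax] with y ⟨h1, h2, h3⟩
    refine ⟨((acd_weight x₀ x₁ lam).mul h1).congr_deriv (ae_of_all _ fun x => ?_), ?_, ?_⟩
    · simp only [hvx, he]; ring
    · simp [hv, h2]
    · simp [hv, h3]
  have svx : ∀ᵐ y ∂(ivl y₀ y₁), ACD x₀ x₁ (fun x => vx (x, y)) (fun x => vxx (x, y)) ∧
      vx (x₁, y) = 0 := by
    filter_upwards [h.ax, h.axx] with y ⟨h1, h2, h3⟩ ⟨h4, h5⟩
    refine ⟨((acd_weight x₀ x₁ lam).mul (h4.add (((ACD.const x₀ x₁ (2 * lam)).mul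
      (acd_id x₀ x₁)).mul h1))).congr_deriv (ae_of_all _ fun x => ?_), ?_⟩
    · simp only [hvxx, he]; ring
    · simp [hvx, h3, h5]
  have svy : ∀ᵐ y ∂(ivl y₀ y₁), ACD x₀ x₁ (fun x => vy (x, y)) (fun x => vxy (x, y)) ∧
      vy (x₀, y) = 0 ∧ vy (x₁, y) = 0 := by
    filter_upwards [h.ayx] with y ⟨h1, h2, h3⟩
    refine ⟨((acd_weight x₀ x₁ lam).mul h1).congr_deriv (ae_of_all _ fun x => ?_), ?_, ?_⟩
    · simp only [hvxy, he]; ring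
    · simp [hvy, h2]
    · simp [hvy, h3]
  have tv : ∀ᵐ x ∂(ivl x₀ x₁), ACD y₀ y₁ (fun y => v (x, y)) (fun y => vy (x, y)) ∧
      v (x, y₀) = 0 ∧ v (x, y₁) = 0 := by
    filter_upwards [h.ay] with x ⟨h1, h2, h3⟩
    refine ⟨((ACD.const y₀ y₁ (e x)).mul h1).congr_deriv (ae_of_all _ fun y => ?_), ?_, ?_⟩
    · simp only [hvy]; ring
    · simp [hv, h2]
    · simp [hv, h3]
  have tvx : ∀ᵐ x ∂(ivl x₀ x₁), ACD y₀ y₁ (fun y => vx (x, y)) (fun y => vxy (x, y)) ∧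
      vx (x, y₀) = 0 ∧ vx (x, y₁) = 0 := by
    filter_upwards [h.ay, h.axy] with x ⟨h1, h2, h3⟩ ⟨h4, h5, h6⟩
    refine ⟨((ACD.const y₀ y₁ (e x)).mul (h4.add ((ACD.const y₀ y₁ (2 * lam * x)).mul h1))).congr_deriv
      (ae_of_all _ fun y => ?_), ?_, ?_⟩
    · simp only [hvxy]; ring
    · simp [hvx, h2, h5]
    · simp [hvx, h3, h6]
  have tvy : ∀ᵐ x ∂(ivl x₀ x₁), ACD y₀ y₁ (fun y => vy (x, y)) (fun y => vyy (x, y)) := by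
    filter_upwards [h.ayy] with x h1
    refine ((ACD.const y₀ y₁ (e x)).mul h1).congr_deriv (ae_of_all _ fun y => ?_)
    simp only [hvyy]; ring
  -- the divergence terms
  set ψ1 : ℝ × ℝ → ℝ := fun z => -4 * lam * vx z * vx z + (-4 * lam * z.1) * vx z * vxx z +
    (-2 * lam) * v z * vxx z + (-24 * lam ^ 3 * z.1 ^ 2) * v z * v z +
    (-16 * lam ^ 3 * z.1 ^ 3) * v z * vx z + (2 * lam) * vy z * vy z +
    (4 * lam * z.1) * vy z * vxy z with hψ1
  set ψ2 : ℝ × ℝ → ℝ := fun z => (-4 * lam * z.1) * vxy z * vy z + (-4 * lam * z.1) * vx z * vyy z +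
    (-2 * lam) * vy z * vy z + (-2 * lam) * v z * vyy z with hψ2
  set χ1 : ℝ × ℝ → ℝ := fun z => 1 * vx z * vx z + 1 * v z * vxx z + (-2 * lam) * v z * v z +
    (-4 * lam * z.1) * v z * vx z with hχ1
  set χ2 : ℝ × ℝ → ℝ := fun z => 1 * vy z * vy z + 1 * v z * vyy z with hχ2
  have i1 : Integrable ψ1 M :=
    ((((((ix (c := fun _ => -4 * lam) (by fun_prop) mvx mvx).add
      (ix (c := fun x => -4 * lam * x) (by fun_prop) mvx mvxx)).add
      (ix (c := fun _ => -2 * lam) (by fun_prop) mv mvxx)).add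
      (ix (c := fun x => -24 * lam ^ 3 * x ^ 2) (by fun_prop) mv mv)).add
      (ix (c := fun x => -16 * lam ^ 3 * x ^ 3) (by fun_prop) mv mvx)).add
      (ix (c := fun _ => 2 * lam) (by fun_prop) mvy mvy)).add
      (ix (c := fun x => 4 * lam * x) (by fun_prop) mvy mvxy)
  have i2 : Integrable ψ2 M :=
    (((ix (c := fun x => -4 * lam * x) (by fun_prop) mvxy mvy).add
      (ix (c := fun x => -4 * lam * x) (by fun_prop) mvx mvyy)).add
      (ix (c := fun _ => -2 * lam) (by fun_prop) mvy mvy)).add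
      (ix (c := fun _ => -2 * lam) (by fun_prop) mv mvyy)
  have i3 : Integrable χ1 M :=
    (((ix (c := fun _ => 1) (by fun_prop) mvx mvx).add
      (ix (c := fun _ => 1) (by fun_prop) mv mvxx)).add
      (ix (c := fun _ => -2 * lam) (by fun_prop) mv mv)).add
      (ix (c := fun x => -4 * lam * x) (by fun_prop) mv mvx)
  have i4 : Integrable χ2 M :=
    (ix (c := fun _ => 1) (by fun_prop) mvy mvy).add (ix (c := fun _ => 1) (by fun_prop) mv mvyy)
  -- `ψ1` is the `x`-derivative of `-2λx v_x² - 2λ v v_x - 8λ³x³v² + 2λx v_y²`. On the vertical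
  -- sides everything vanishes except `-2λx₀v_x²` on the left, where the normal derivative is not
  -- prescribed; `x₀ > 0` gives this term the right sign.
  have n1 : 0 ≤ ∫ z, ψ1 z ∂M := by
    refine integral_nonneg_of_slices_x hx.le i1 ?_
    filter_upwards [sv, svx, svy] with y ⟨a1, a2, a3⟩ ⟨b1, b2⟩ ⟨d1, d2, d3⟩
    have ai := acd_id x₀ x₁
    refine ⟨_, ((((((ACD.const x₀ x₁ (-2 * lam)).mul ai).mul (b1.mul b1)).add
      ((ACD.const x₀ x₁ (-2 * lam)).mul (a1.mul b1))).add
      (((ACD.const x₀ x₁ (-8 * lam ^ 3)).mul (ai.mul (ai.mul ai))).mul (a1.mul a1))).add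
      (((ACD.const x₀ x₁ (2 * lam)).mul ai).mul (d1.mul d1))).congr_deriv
        (ae_of_all _ fun x => ?_), ?_⟩
    · simp only [hψ1]; ring
    · simp only [a2, a3, b2, d2, d3]
      have : 0 ≤ 2 * lam * x₀ * vx (x₀, y) ^ 2 := by positivity
      nlinarith
  -- `ψ2` is the `y`-derivative of `-4λx v_x v_y - 2λ v v_y`, and both `v` and `v_x` vanish on the
  -- horizontal sides.
  have n2 : ∫ z, ψ2 z ∂M = 0 := by
    refine integral_eq_zero_of_slices_y hy.le i2 ?_
    filter_upwards [tv, tvx, tvy] with x ⟨a1, a2, a3⟩ ⟨b1, b2, b3⟩ d1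
    refine ⟨_, (((ACD.const y₀ y₁ (-4 * lam * x)).mul (b1.mul d1)).add
      ((ACD.const y₀ y₁ (-2 * lam)).mul (a1.mul d1))).congr_deriv (ae_of_all _ fun y => ?_), ?_⟩
    · simp only [hψ2]; ring
    · simp only [a2, a3, b2, b3]; ring
  have n3 : ∫ z, χ1 z ∂M = 0 := by
    refine integral_eq_zero_of_slices_x hx.le i3 ?_
    filter_upwards [sv, svx] with y ⟨a1, a2, a3⟩ ⟨b1, b2⟩
    refine ⟨_, ((a1.mul b1).add (((ACD.const x₀ x₁ (-2 * lam)).mul (acd_id x₀ x₁)).mul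
      (a1.mul a1))).congr_deriv (ae_of_all _ fun x => ?_), ?_⟩
    · simp only [hχ1]; ring
    · simp only [a2, a3]; ring
  have n4 : ∫ z, χ2 z ∂M = 0 := by
    refine integral_eq_zero_of_slices_y hy.le i4 ?_
    filter_upwards [tv, tvy] with x ⟨a1, a2, a3⟩ d1
    refine ⟨_, (a1.mul d1).congr_deriv (ae_of_all _ fun y => ?_), ?_⟩
    · simp only [hχ2]; ring
    · simp only [a2, a3]; ring
  -- conclusion
  have mL : MemLp (fun z => e z.1 * (Hxx z + Hyy z)) 2 M :=
    memLp_weight_mul hec (h.memXX.add h.memYY)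
  have iA : Integrable (fun z => (Hxx z + Hyy z) ^ 2 * e z.1 ^ 2) M :=
    (integrable_mul2 mL mL).congr (ae_of_all _ fun z => by simp only; ring)
  have ivv : Integrable (fun z => z.1 ^ 2 * v z * v z) M := ix (c := fun x => x ^ 2) (by fun_prop) mv mv
  have ivx : Integrable (fun z => vx z * vx z) M := integrable_mul2 mvx mvx
  have ivy : Integrable (fun z => vy z * vy z) M := integrable_mul2 mvy mvy
  -- The two squares of the decomposition are dropped and only the cross term is kept.
  have k1 : 8 * lam * (∫ z, vx z * vx z ∂M) + 32 * lam ^ 3 * (∫ z, z.1 ^ 2 * v z * v z ∂M) ≤ A := by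
    have : ∫ z, (2 * (ψ1 z + ψ2 z) + (8 * lam * (vx z * vx z) +
        32 * lam ^ 3 * (z.1 ^ 2 * v z * v z))) ∂M ≤ A := by
      rw [hA]
      refine integral_mono (((i1.add i2).const_mul 2).add ((ivx.const_mul _).add
        (ivv.const_mul _))) iA fun z => ?_
      have e1 : (Hxx z + Hyy z) * e z.1 = (vxx z + vyy z + 4 * lam ^ 2 * z.1 ^ 2 * v z) +
          (-4 * lam * z.1 * vx z - 2 * lam * v z) := by
        simp only [hv, hvx, hvxx, hvyy]; ring
      have e2 : (Hxx z + Hyy z) ^ 2 * e z.1 ^ 2 = ((vxx z + vyy z + 4 * lam ^ 2 * z.1 ^ 2 * v z) +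
          (-4 * lam * z.1 * vx z - 2 * lam * v z)) ^ 2 := by rw [← e1]; ring
      simp only
      rw [e2]
      have s1 := sq_nonneg (vxx z + vyy z + 4 * lam ^ 2 * z.1 ^ 2 * v z)
      have s2 := sq_nonneg (-4 * lam * z.1 * vx z - 2 * lam * v z)
      simp only [hψ1, hψ2]
      linarith
    rw [integral_add ((i1.fun_add i2).const_mul 2) ((ivx.const_mul _).fun_add (ivv.const_mul _)),
      integral_const_mul, integral_add i1 i2, integral_add (ivx.const_mul _) (ivv.const_mul _),
      integral_const_mul, integral_const_mul, n2] at this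
    linarith
  have hv0 : 0 ≤ ∫ z, z.1 ^ 2 * v z * v z ∂M :=
    integral_nonneg fun z => by have := sq_nonneg (z.1 * v z); simp only [Pi.zero_apply]; linarith
  have hvx0 : 0 ≤ ∫ z, vx z * vx z ∂M := integral_nonneg fun z => mul_self_nonneg _
  have hl0 : 0 < lam := by linarith
  -- The integral of `χ1 + χ2 = v·eΔH - 4λ²x²v² + |∇v|²` is zero, which expresses `∫v_y²`. The
  -- product `λv·eΔH` is split by Young's inequality, and `λ ≥ 1`, `x ≥ x₀` turn `λ²v²` into at most
  -- `x₀⁻²λ³x²v²`, which `k1` controls.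
  have k2 : lam * ∫ z, vy z * vy z ∂M ≤ (4 * lam ^ 3 + (x₀ ^ 2)⁻¹ / 2 * lam ^ 3) *
      (∫ z, z.1 ^ 2 * v z * v z ∂M) + A / 2 := by
    have : ∫ z, lam * (vy z * vy z) - lam * (χ1 z + χ2 z) ∂M ≤
        ∫ z, ((4 * lam ^ 3 + (x₀ ^ 2)⁻¹ / 2 * lam ^ 3) * (z.1 ^ 2 * v z * v z) +
          (1 / 2) * ((Hxx z + Hyy z) ^ 2 * e z.1 ^ 2)) ∂M := by
      refine integral_mono_ae ((ivy.const_mul _).sub ((i3.add i4).const_mul _))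
        ((ivv.const_mul _).add (iA.const_mul _)) ?_
      filter_upwards [ae_box_mem] with z hz
      have e1 : lam * (vy z * vy z) - lam * (χ1 z + χ2 z) = 4 * lam ^ 3 * (z.1 ^ 2 * v z * v z) -
          lam * (vx z * vx z) - lam * v z * ((Hxx z + Hyy z) * e z.1) := by
        simp only [hχ1, hχ2, hv, hvx, hvxx, hvyy, hvy]; ring
      rw [e1]
      have s1 := sq_nonneg (lam * v z + (Hxx z + Hyy z) * e z.1)
      have s2 : lam ^ 2 * v z ^ 2 ≤ (x₀ ^ 2)⁻¹ * lam ^ 3 * (z.1 ^ 2 * v z * v z) := by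
        have t1 : 1 ≤ (x₀ ^ 2)⁻¹ * z.1 ^ 2 := by
          rw [inv_mul_eq_div, one_le_div (by positivity)]
          exact pow_le_pow_left₀ hx0.le hz.1.1.le 2
        have t2 : lam ^ 2 ≤ lam ^ 3 := pow_le_pow_right₀ hl (by norm_num)
        calc lam ^ 2 * v z ^ 2 = lam ^ 2 * v z ^ 2 * 1 := by ring
          _ ≤ lam ^ 3 * v z ^ 2 * ((x₀ ^ 2)⁻¹ * z.1 ^ 2) := by gcongr
          _ = _ := by ring
      have s3 : 0 ≤ lam * (vx z * vx z) := mul_nonneg hl0.le (mul_self_nonneg _)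
      nlinarith
    rw [integral_sub (ivy.const_mul _) ((i3.fun_add i4).const_mul _), integral_const_mul,
      integral_const_mul, integral_add i3 i4, n3, n4, integral_add (ivv.const_mul _)
      (iA.const_mul _), integral_const_mul, integral_const_mul] at this
    rw [hA]
    linarith
  -- Return from `v` to `H` through `eH_x = v_x - 2λxv` and `eH_y = v_y`.
  have k3 : ∫ z, (Hx z ^ 2 + Hy z ^ 2) * e z.1 ^ 2 ∂M ≤ 2 * (∫ z, vx z * vx z ∂M) +
      8 * lam ^ 2 * (∫ z, z.1 ^ 2 * v z * v z ∂M) + ∫ z, vy z * vy z ∂M := by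
    rw [← integral_const_mul, ← integral_const_mul, ← integral_add (ivx.const_mul _)
      (ivv.const_mul _), ← integral_add ((ivx.const_mul _).fun_add (ivv.const_mul _)) ivy]
    refine integral_mono_of_nonneg (ae_of_all _ fun z => by simp only [Pi.zero_apply]; positivity)
      (((ivx.const_mul _).add (ivv.const_mul _)).add ivy) (ae_of_all _ fun z => ?_)
    have e1 : Hx z * e z.1 = vx z - 2 * lam * z.1 * v z := by simp only [hv, hvx]; ring
    have e2 : (Hx z ^ 2 + Hy z ^ 2) * e z.1 ^ 2 = (vx z - 2 * lam * z.1 * v z) ^ 2 + vy z * vy z := by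
      rw [← e1]; simp only [hvy]; ring
    simp only
    rw [e2]
    have := sq_nonneg (vx z + 2 * lam * z.1 * v z)
    linarith
  have k4 := mul_le_mul_of_nonneg_left k3 hl0.le
  have hA0 : 0 ≤ A := by rw [hA]; exact integral_nonneg fun z => by simp only [Pi.zero_apply]; positivity
  set X := ∫ z, vx z * vx z ∂M
  set W := ∫ z, z.1 ^ 2 * v z * v z ∂M
  have hlX : 0 ≤ lam * X := mul_nonneg hl0.le hvx0
  have hlW : 0 ≤ lam ^ 3 * W := mul_nonneg (by positivity) hv0
  have hW : lam ^ 3 * W ≤ A / 32 := by linarith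
  have hX : lam * X ≤ A / 8 := by linarith
  have hi : 0 ≤ (x₀ ^ 2)⁻¹ := by positivity
  have h5 := mul_le_mul_of_nonneg_left hW hi
  nlinarith [mul_nonneg hi hA0]

/-- Two integrations by parts through `H_xxy H_y` turn `∫e²H_xx H_yy` into `∫e²H_xy²` plus a term
with the derivative of the weight. The boundary terms vanish because `H_xx = 0` on the horizontal
and `H_y = 0` on the vertical sides. The weight term costs the factor `λ²` in front of the gradient,
so with `carleman_first` the second derivatives are bounded by a multiple of `λA`. -/
theorem carleman_second (h : ZeroSlices x₀ x₁ y₀ y₁ H Hx Hy Hxx Hxy Hyy Hxxy) (hx0 : 0 < x₀)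
    (hx : x₀ < x₁) (hy : y₀ < y₁) {lam : ℝ} {A : ℝ}
    (hA : A = ∫ z, (Hxx z + Hyy z) ^ 2 * Real.exp (lam * z.1 ^ 2) ^ 2 ∂(box x₀ x₁ y₀ y₁)) :
    ∫ z, (Hxy z ^ 2 + Hyy z ^ 2) * Real.exp (lam * z.1 ^ 2) ^ 2 ∂(box x₀ x₁ y₀ y₁) ≤
      A + 16 * lam ^ 2 * x₁ ^ 2 *
        ∫ z, (Hx z ^ 2 + Hy z ^ 2) * Real.exp (lam * z.1 ^ 2) ^ 2 ∂(box x₀ x₁ y₀ y₁) := by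
  set e : ℝ → ℝ := fun x => Real.exp (lam * x ^ 2) with he
  have hec : Continuous e := by fun_prop
  set M := box x₀ x₁ y₀ y₁
  have ix : ∀ {c : ℝ → ℝ}, Continuous c → ∀ {f g : ℝ × ℝ → ℝ}, MemLp f 2 M → MemLp g 2 M →
      Integrable (fun z => c z.1 * f z * g z) M := fun hc _ _ hf hg => integrable_weight_mul2 hc hf hg
  set ψ1 : ℝ × ℝ → ℝ := fun z => e z.1 ^ 2 * Hxxy z * Hy z + e z.1 ^ 2 * Hxx z * Hyy z with hψ1
  set ψ2 : ℝ × ℝ → ℝ := fun z => e z.1 ^ 2 * Hxxy z * Hy z + e z.1 ^ 2 * Hxy z * Hxy z +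
    (4 * lam * z.1 * e z.1 ^ 2) * Hxy z * Hy z with hψ2
  have i1 : Integrable ψ1 M := (ix (c := fun x => e x ^ 2) (by fun_prop) h.memXXY h.memY).add
    (ix (c := fun x => e x ^ 2) (by fun_prop) h.memXX h.memYY)
  have i2 : Integrable ψ2 M := ((ix (c := fun x => e x ^ 2) (by fun_prop) h.memXXY h.memY).add
    (ix (c := fun x => e x ^ 2) (by fun_prop) h.memXY h.memXY)).add
    (ix (c := fun x => 4 * lam * x * e x ^ 2) (by fun_prop) h.memXY h.memY)
  have n1 : ∫ z, ψ1 z ∂M = 0 := by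
    refine integral_eq_zero_of_slices_y hy.le i1 ?_
    filter_upwards [h.axxy, h.ayy] with x ⟨a1, a2, a3⟩ b1
    refine ⟨_, ((ACD.const y₀ y₁ (e x ^ 2)).mul (a1.mul b1)).congr_deriv
      (ae_of_all _ fun y => ?_), ?_⟩
    · simp only [hψ1]; ring
    · simp only [a2, a3]; ring
  have n2 : ∫ z, ψ2 z ∂M = 0 := by
    refine integral_eq_zero_of_slices_x hx.le i2 ?_
    filter_upwards [h.axyx, h.ayx] with y a1 ⟨b1, b2, b3⟩
    have ae := acd_weight x₀ x₁ lam
    refine ⟨_, ((ae.mul ae).mul (a1.mul b1)).congr_deriv (ae_of_all _ fun x => ?_), ?_⟩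
    · simp only [hψ2, he]; ring
    · simp only [b2, b3]; ring
  have mL : MemLp (fun z => e z.1 * (Hxx z + Hyy z)) 2 M :=
    memLp_weight_mul hec (h.memXX.add h.memYY)
  have iA : Integrable (fun z => (Hxx z + Hyy z) ^ 2 * e z.1 ^ 2) M :=
    (integrable_mul2 mL mL).congr (ae_of_all _ fun z => by simp only; ring)
  have iG : Integrable (fun z => (Hx z ^ 2 + Hy z ^ 2) * e z.1 ^ 2) M :=
    ((ix (c := fun x => e x ^ 2) (by fun_prop) h.memX h.memX).add
      (ix (c := fun x => e x ^ 2) (by fun_prop) h.memY h.memY)).congr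
      (ae_of_all _ fun z => by simp only [Pi.add_apply]; ring)
  have key : ∫ z, (Hxy z ^ 2 + Hyy z ^ 2) * e z.1 ^ 2 ∂M ≤ ∫ z, (((Hxx z + Hyy z) ^ 2 * e z.1 ^ 2 +
      16 * lam ^ 2 * x₁ ^ 2 * ((Hx z ^ 2 + Hy z ^ 2) * e z.1 ^ 2)) + (2 * ψ2 z + -2 * ψ1 z)) ∂M := by
    refine integral_mono_of_nonneg (ae_of_all _ fun z => by simp only [Pi.zero_apply]; positivity)
      ((iA.add (iG.const_mul _)).add ((i2.const_mul 2).add (i1.const_mul (-2)))) ?_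
    filter_upwards [ae_box_mem] with z hz
    have e0 := sq_nonneg (e z.1)
    have hz1 : z.1 ^ 2 ≤ x₁ ^ 2 := pow_le_pow_left₀ (hx0.le.trans hz.1.1.le) hz.1.2.le 2
    have q : Hxy z ^ 2 + Hyy z ^ 2 ≤ (Hxx z + Hyy z) ^ 2 + 16 * lam ^ 2 * x₁ ^ 2 *
        (Hx z ^ 2 + Hy z ^ 2) + 2 * (Hxy z ^ 2 + 4 * lam * z.1 * Hxy z * Hy z) -
        2 * (Hxx z * Hyy z) := by
      have t1 : lam ^ 2 * z.1 ^ 2 * Hy z ^ 2 ≤ lam ^ 2 * x₁ ^ 2 * Hy z ^ 2 := by gcongr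
      have t2 : 0 ≤ lam ^ 2 * x₁ ^ 2 * Hx z ^ 2 := by positivity
      have t3 := sq_nonneg (Hxy z + 4 * lam * z.1 * Hy z)
      have t4 := sq_nonneg (Hxx z)
      nlinarith
    have := mul_le_mul_of_nonneg_right q e0
    simp only [hψ1, hψ2]
    linarith
  rw [integral_add (iA.fun_add (iG.const_mul _)) ((i2.const_mul 2).fun_add (i1.const_mul (-2))),
    integral_add iA (iG.const_mul _), integral_add (i2.const_mul 2) (i1.const_mul (-2)),
    integral_const_mul, integral_const_mul, integral_const_mul, n1, n2] at key
  rw [hA]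
  linarith

end ZeroSlices

end EIT


/-! ### Ladyzhenskaya's inequality and quadratic terms with a coefficient in `H¹` -/

namespace EIT

variable {x₀ x₁ y₀ y₁ : ℝ}

theorem ACD.sq_le {s t : ℝ} {f f' : ℝ → ℝ} (hst : s < t) (hf : ACD s t f f') {x : ℝ}
    (hx : x ∈ Icc s t) : f x ^ 2 ≤ (t - s)⁻¹ * (∫ r, f r ^ 2 ∂(ivl s t)) +
      ∫ r, 2 * |f r * f' r| ∂(ivl s t) := by
  have h := (hf.mul hf).le_average hst hx
  have e1 : ∀ r, f r * f r = f r ^ 2 := fun r => by ring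
  have e2 : ∀ r, |f' r * f r + f r * f' r| = 2 * |f r * f' r| := fun r => by
    rw [show f' r * f r + f r * f' r = 2 * (f r * f' r) by ring, abs_mul, abs_two]
  simpa only [e1, e2] using h

/-- Ladyzhenskaya's inequality on a rectangle. -/
theorem integral_sq_mul_sq_le {F D' g g' : ℝ × ℝ → ℝ} (hx : x₀ < x₁) (hy : y₀ < y₁)
    (hF : MemLp F 2 (box x₀ x₁ y₀ y₁)) (hD : MemLp D' 2 (box x₀ x₁ y₀ y₁))
    (hg : MemLp g 2 (box x₀ x₁ y₀ y₁)) (hg' : MemLp g' 2 (box x₀ x₁ y₀ y₁)) {B : ℝ}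
    (hb : ∀ᵐ z ∂(box x₀ x₁ y₀ y₁), |g z| ≤ B)
    (aF : ∀ᵐ y ∂(ivl y₀ y₁), ACD x₀ x₁ (fun x => F (x, y)) (fun x => D' (x, y)))
    (ag : ∀ᵐ x ∂(ivl x₀ x₁), ACD y₀ y₁ (fun y => g (x, y)) (fun y => g' (x, y))) :
    ∫ z, F z ^ 2 * g z ^ 2 ∂(box x₀ x₁ y₀ y₁) ≤
      ((x₁ - x₀)⁻¹ * (∫ z, F z ^ 2 ∂(box x₀ x₁ y₀ y₁)) +
        ∫ z, 2 * |F z * D' z| ∂(box x₀ x₁ y₀ y₁)) *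
      ((y₁ - y₀)⁻¹ * (∫ z, g z ^ 2 ∂(box x₀ x₁ y₀ y₁)) +
        ∫ z, 2 * |g z * g' z| ∂(box x₀ x₁ y₀ y₁)) := by
  have iF2 : Integrable (fun z => F z ^ 2) (box x₀ x₁ y₀ y₁) := hF.integrable_sq
  have ig2 : Integrable (fun z => g z ^ 2) (box x₀ x₁ y₀ y₁) := hg.integrable_sq
  have iFD : Integrable (fun z => 2 * |F z * D' z|) (box x₀ x₁ y₀ y₁) :=
    (integrable_mul2 hF hD).abs.const_mul 2
  have igg : Integrable (fun z => 2 * |g z * g' z|) (box x₀ x₁ y₀ y₁) :=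
    (integrable_mul2 hg hg').abs.const_mul 2
  have iFg : Integrable (fun z => F z ^ 2 * g z ^ 2) (box x₀ x₁ y₀ y₁) := by
    refine iF2.mul_bdd (c := B ^ 2) ig2.aestronglyMeasurable ?_
    filter_upwards [hb] with z hz
    rw [norm_pow]
    exact pow_le_pow_left₀ (norm_nonneg _) hz 2
  -- `m(y)` dominates `F(x, y)²` for all `x`, and `n(x)` dominates `g(x, y)²` for all `y`. The
  -- double integral of the product is then at most the product of two single integrals, and only
  -- one partial derivative of each factor is needed.
  set m : ℝ → ℝ := fun y => (x₁ - x₀)⁻¹ * (∫ x, F (x, y) ^ 2 ∂(ivl x₀ x₁)) +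
    ∫ x, 2 * |F (x, y) * D' (x, y)| ∂(ivl x₀ x₁) with hm
  set n : ℝ → ℝ := fun x => (y₁ - y₀)⁻¹ * (∫ y, g (x, y) ^ 2 ∂(ivl y₀ y₁)) +
    ∫ y, 2 * |g (x, y) * g' (x, y)| ∂(ivl y₀ y₁) with hn
  have lx : 0 ≤ (x₁ - x₀)⁻¹ := inv_nonneg.2 (sub_pos.2 hx).le
  have hm0 : ∀ y, 0 ≤ m y := fun y => add_nonneg (mul_nonneg lx
    (integral_nonneg fun _ => sq_nonneg _)) (integral_nonneg fun _ => by positivity)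
  have im : Integrable m (ivl y₀ y₁) :=
    (iF2.integral_prod_right.const_mul _).add iFD.integral_prod_right
  have inn : Integrable n (ivl x₀ x₁) :=
    (ig2.integral_prod_left.const_mul _).add igg.integral_prod_left
  have em : ∫ y, m y ∂(ivl y₀ y₁) = (x₁ - x₀)⁻¹ * (∫ z, F z ^ 2 ∂(box x₀ x₁ y₀ y₁)) +
        ∫ z, 2 * |F z * D' z| ∂(box x₀ x₁ y₀ y₁) := by
    rw [integral_add (iF2.integral_prod_right.const_mul _) iFD.integral_prod_right,
      integral_const_mul, integral_prod_symm _ iF2, integral_prod_symm _ iFD]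
  have en : ∫ x, n x ∂(ivl x₀ x₁) = (y₁ - y₀)⁻¹ * (∫ z, g z ^ 2 ∂(box x₀ x₁ y₀ y₁)) +
        ∫ z, 2 * |g z * g' z| ∂(box x₀ x₁ y₀ y₁) := by
    rw [integral_add (ig2.integral_prod_left.const_mul _) igg.integral_prod_left,
      integral_const_mul, integral_prod _ ig2, integral_prod _ igg]
  rw [← em, ← en, integral_prod_symm _ iFg, ← integral_mul_const]
  refine integral_mono_of_nonneg (ae_of_all _ fun y => integral_nonneg fun x => by positivity)
    (im.mul_const _) ?_
  filter_upwards [aF, ig2.prod_left_ae, ae_ivl_of_forall fun y hy => hy] with y hyF hyg hyI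
  have s1 : ∫ x, F (x, y) ^ 2 * g (x, y) ^ 2 ∂(ivl x₀ x₁) ≤ m y * ∫ x, g (x, y) ^ 2 ∂(ivl x₀ x₁) := by
    rw [← integral_const_mul]
    refine integral_mono_of_nonneg (ae_of_all _ fun x => by simp only [Pi.zero_apply]; positivity)
      (hyg.const_mul _) (ae_ivl_of_forall fun x hx' => ?_)
    exact mul_le_mul_of_nonneg_right (hyF.sq_le hx (Ioo_subset_Icc_self hx')) (sq_nonneg _)
  refine s1.trans (mul_le_mul_of_nonneg_left ?_ (hm0 y))
  refine integral_mono_of_nonneg (ae_of_all _ fun x => sq_nonneg _) inn ?_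
  filter_upwards [ag] with x hxg using hxg.sq_le hy (Ioo_subset_Icc_self hyI)

theorem integral_two_mul_abs_le {f g : ℝ × ℝ → ℝ} (hf : MemLp f 2 (box x₀ x₁ y₀ y₁))
    (hg : MemLp g 2 (box x₀ x₁ y₀ y₁)) {lam : ℝ} (hl : 0 < lam) :
    ∫ z, 2 * |f z * g z| ∂(box x₀ x₁ y₀ y₁) ≤ lam * (∫ z, f z ^ 2 ∂(box x₀ x₁ y₀ y₁)) +
      lam⁻¹ * ∫ z, g z ^ 2 ∂(box x₀ x₁ y₀ y₁) := by
  rw [← integral_const_mul, ← integral_const_mul,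
    ← integral_add (hf.integrable_sq.const_mul _) (hg.integrable_sq.const_mul _)]
  refine integral_mono ((integrable_mul2 hf hg).abs.const_mul 2)
    ((hf.integrable_sq.const_mul _).add (hg.integrable_sq.const_mul _)) fun z => ?_
  simp only
  have h0 : (0 : ℝ) ≤ lam⁻¹ * (lam * |f z| - |g z|) ^ 2 := by positivity
  have h1 : lam⁻¹ * (lam * |f z| - |g z|) ^ 2 =
      lam * |f z| ^ 2 + lam⁻¹ * |g z| ^ 2 - 2 * (|f z| * |g z|) := by
    field_simp; ring
  rw [h1, sq_abs, sq_abs, ← abs_mul] at h0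
  linarith

/-- The integral of `|F| g²` is small compared with a weighted `H¹` norm of `g`. -/
theorem integral_abs_mul_sq_le {F D' g g' : ℝ × ℝ → ℝ} (hx : x₀ < x₁) (hy : y₀ < y₁)
    (hF : MemLp F 2 (box x₀ x₁ y₀ y₁)) (hD : MemLp D' 2 (box x₀ x₁ y₀ y₁))
    (hg : MemLp g 2 (box x₀ x₁ y₀ y₁)) (hg' : MemLp g' 2 (box x₀ x₁ y₀ y₁)) {B : ℝ}
    (hb : ∀ᵐ z ∂(box x₀ x₁ y₀ y₁), |g z| ≤ B)
    (aF : ∀ᵐ y ∂(ivl y₀ y₁), ACD x₀ x₁ (fun x => F (x, y)) (fun x => D' (x, y)))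
    (ag : ∀ᵐ x ∂(ivl x₀ x₁), ACD y₀ y₁ (fun y => g (x, y)) (fun y => g' (x, y)))
    {lam A N : ℝ} (hl : 1 ≤ lam) (_hA : 0 ≤ A)
    (hN : (∫ z, F z ^ 2 ∂(box x₀ x₁ y₀ y₁)) + ∫ z, D' z ^ 2 ∂(box x₀ x₁ y₀ y₁) ≤ N)
    (h1 : lam * ∫ z, g z ^ 2 ∂(box x₀ x₁ y₀ y₁) ≤ A)
    (h2 : ∫ z, g' z ^ 2 ∂(box x₀ x₁ y₀ y₁) ≤ lam * A) :
    ∫ z, |F z| * g z ^ 2 ∂(box x₀ x₁ y₀ y₁) ≤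
      (1 + (((x₁ - x₀)⁻¹ + 1) * N) * ((y₁ - y₀)⁻¹ + 2)) * A / √lam := by
  have hl0 : 0 < lam := by linarith
  have lx : 0 ≤ (x₁ - x₀)⁻¹ := inv_nonneg.2 (sub_pos.2 hx).le
  have ly : 0 ≤ (y₁ - y₀)⁻¹ := inv_nonneg.2 (sub_pos.2 hy).le
  have hL := integral_sq_mul_sq_le hx hy hF hD hg hg' hb aF ag
  have a1 := integral_two_mul_abs_le hF hD one_pos
  have a2 := integral_two_mul_abs_le hg hg' hl0
  have iF2 : Integrable (fun z => F z ^ 2) (box x₀ x₁ y₀ y₁) := hF.integrable_sq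
  have ig2 : Integrable (fun z => g z ^ 2) (box x₀ x₁ y₀ y₁) := hg.integrable_sq
  have iFg : Integrable (fun z => F z ^ 2 * g z ^ 2) (box x₀ x₁ y₀ y₁) := by
    refine iF2.mul_bdd (c := B ^ 2) ig2.aestronglyMeasurable ?_
    filter_upwards [hb] with z hz
    rw [norm_pow]
    exact pow_le_pow_left₀ (norm_nonneg _) hz 2
  have p1 : 0 ≤ ∫ z, F z ^ 2 ∂(box x₀ x₁ y₀ y₁) := integral_nonneg fun _ => sq_nonneg _
  have p2 : 0 ≤ ∫ z, D' z ^ 2 ∂(box x₀ x₁ y₀ y₁) := integral_nonneg fun _ => sq_nonneg _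
  have p3 : 0 ≤ ∫ z, g z ^ 2 ∂(box x₀ x₁ y₀ y₁) := integral_nonneg fun _ => sq_nonneg _
  have p4 : 0 ≤ ∫ z, 2 * |F z * D' z| ∂(box x₀ x₁ y₀ y₁) := integral_nonneg fun _ => by positivity
  have p5 : 0 ≤ ∫ z, 2 * |g z * g' z| ∂(box x₀ x₁ y₀ y₁) := integral_nonneg fun _ => by positivity
  set I1 := ∫ z, F z ^ 2 ∂(box x₀ x₁ y₀ y₁)
  set I2 := ∫ z, D' z ^ 2 ∂(box x₀ x₁ y₀ y₁)
  set I3 := ∫ z, g z ^ 2 ∂(box x₀ x₁ y₀ y₁)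
  set I4 := ∫ z, g' z ^ 2 ∂(box x₀ x₁ y₀ y₁)
  have hg3 : I3 ≤ A := by nlinarith
  have h2' : lam⁻¹ * I4 ≤ A := by
    rw [inv_mul_le_iff₀ hl0]; exact h2
  have q1 : (x₁ - x₀)⁻¹ * I1 + ∫ z, 2 * |F z * D' z| ∂(box x₀ x₁ y₀ y₁) ≤ ((x₁ - x₀)⁻¹ + 1) * N := by
    have : (x₁ - x₀)⁻¹ * I1 ≤ (x₁ - x₀)⁻¹ * N := mul_le_mul_of_nonneg_left (by linarith) lx
    simp only [inv_one, one_mul] at a1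
    linarith
  -- Young's inequality with parameter `λ` balances the two hypotheses: `λ∫g²` and `λ⁻¹∫g'²` are
  -- both at most `A`, so no power of `λ` is lost.
  have q2 : (y₁ - y₀)⁻¹ * I3 + ∫ z, 2 * |g z * g' z| ∂(box x₀ x₁ y₀ y₁) ≤ ((y₁ - y₀)⁻¹ + 2) * A := by
    have : (y₁ - y₀)⁻¹ * I3 ≤ (y₁ - y₀)⁻¹ * A := mul_le_mul_of_nonneg_left hg3 ly
    linarith
  have q3 : ∫ z, F z ^ 2 * g z ^ 2 ∂(box x₀ x₁ y₀ y₁) ≤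
      ((x₁ - x₀)⁻¹ + 1) * N * (((y₁ - y₀)⁻¹ + 2) * A) := by
    refine hL.trans (mul_le_mul q1 q2 (by positivity) ?_)
    exact mul_nonneg (by linarith) (by linarith)
  have hs : 0 < √lam := Real.sqrt_pos.2 hl0
  have hss : √lam * √lam = lam := Real.mul_self_sqrt hl0.le
  -- Pointwise `√λ|F| ≤ F² + λ`; this is the source of the gain `1/√λ`.
  have q4 : √lam * ∫ z, |F z| * g z ^ 2 ∂(box x₀ x₁ y₀ y₁) ≤
      (∫ z, F z ^ 2 * g z ^ 2 ∂(box x₀ x₁ y₀ y₁)) + lam * I3 := by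
    rw [← integral_const_mul, ← integral_const_mul, ← integral_add iFg (ig2.const_mul _)]
    refine integral_mono_of_nonneg (ae_of_all _ fun z => by simp only [Pi.zero_apply]; positivity)
      (iFg.add (ig2.const_mul _)) (ae_of_all _ fun z => ?_)
    simp only
    have t := sq_nonneg (|F z| - √lam)
    have t' : √lam * |F z| ≤ F z ^ 2 + lam := by
      have := sq_abs (F z)
      nlinarith [abs_nonneg (F z)]
    have := mul_le_mul_of_nonneg_right t' (sq_nonneg (g z))
    linarith
  rw [le_div_iff₀ hs]
  linarith

/-- The Carleman estimate, with the bound of quadratic terms whose coefficient is merely in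
`H¹`. -/
theorem exists_carleman (hx0 : 0 < x₀) (hx : x₀ < x₁) (hy : y₀ < y₁) : ∃ C, 0 < C ∧
    ∀ lam : ℝ, 1 ≤ lam → ∀ H Hx Hy Hxx Hxy Hyy Hxxy : ℝ × ℝ → ℝ,
      ZeroSlices x₀ x₁ y₀ y₁ H Hx Hy Hxx Hxy Hyy Hxxy → ∀ A : ℝ,
      A = ∫ z, (Hxx z + Hyy z) ^ 2 * Real.exp (lam * z.1 ^ 2) ^ 2 ∂(box x₀ x₁ y₀ y₁) →
      (∫ z, (Hx z ^ 2 + Hy z ^ 2) * Real.exp (lam * z.1 ^ 2) ^ 2 ∂(box x₀ x₁ y₀ y₁) ≤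
        C * A / √lam) ∧
      ∀ (F D' : ℝ × ℝ → ℝ) (N : ℝ), MemLp F 2 (box x₀ x₁ y₀ y₁) →
        MemLp D' 2 (box x₀ x₁ y₀ y₁) →
        (∀ᵐ y ∂(ivl y₀ y₁), ACD x₀ x₁ (fun x => F (x, y)) (fun x => D' (x, y))) →
        (∫ z, F z ^ 2 ∂(box x₀ x₁ y₀ y₁)) + ∫ z, D' z ^ 2 ∂(box x₀ x₁ y₀ y₁) ≤ N →
        ∫ z, |F z| * ((Hx z ^ 2 + Hy z ^ 2) * Real.exp (lam * z.1 ^ 2) ^ 2) ∂(box x₀ x₁ y₀ y₁) ≤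
          C * (1 + N) * A / √lam := by
  set κ := 2 + (x₀ ^ 2)⁻¹
  -- `κ` is the constant of the first-order estimate. Inserting that estimate in the second-order
  -- one gives `(1 + 16x₁²κ)λA`, so `τ` serves for both.
  set τ := max κ (1 + 16 * x₁ ^ 2 * κ)
  set Λ := ((x₁ - x₀)⁻¹ + 1) * ((y₁ - y₀)⁻¹ + 2)
  have hκ : 0 < κ := by positivity
  have hτ : κ ≤ τ := le_max_left _ _
  have hτ0 : 0 < τ := hκ.trans_le hτ
  have lx : 0 < (x₁ - x₀)⁻¹ := inv_pos.2 (sub_pos.2 hx)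
  have ly : 0 < (y₁ - y₀)⁻¹ := inv_pos.2 (sub_pos.2 hy)
  have hΛ : 0 < Λ := by positivity
  refine ⟨2 * (1 + Λ) * τ, by positivity, fun lam hl H Hx Hy Hxx Hxy Hyy Hxxy h A hA => ?_⟩
  have hl0 : 0 < lam := by linarith
  have hs : 0 < √lam := Real.sqrt_pos.2 hl0
  have hsl : √lam ≤ lam := by
    rw [Real.sqrt_le_left hl0.le]; nlinarith
  have hA0 : 0 ≤ A := by rw [hA]; exact integral_nonneg fun z => by simp only [Pi.zero_apply]; positivity
  have c1 := h.carleman_first hx0 hx hy hl hA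
  have c2 := h.carleman_second hx0 hx hy hA
  set e : ℝ → ℝ := fun x => Real.exp (lam * x ^ 2) with he
  have hec : Continuous e := by fun_prop
  set M := box x₀ x₁ y₀ y₁ with hM
  set gx : ℝ × ℝ → ℝ := fun z => e z.1 * Hx z with hgx
  set gy : ℝ × ℝ → ℝ := fun z => e z.1 * Hy z with hgy
  set gxy : ℝ × ℝ → ℝ := fun z => e z.1 * Hxy z with hgxy
  set gyy : ℝ × ℝ → ℝ := fun z => e z.1 * Hyy z with hgyy
  have mx : MemLp gx 2 M := memLp_weight_mul hec h.memX
  have my : MemLp gy 2 M := memLp_weight_mul hec h.memY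
  have mxy : MemLp gxy 2 M := memLp_weight_mul hec h.memXY
  have myy : MemLp gyy 2 M := memLp_weight_mul hec h.memYY
  have i1 : Integrable (fun z => gx z ^ 2) M := mx.integrable_sq
  have i2 : Integrable (fun z => gy z ^ 2) M := my.integrable_sq
  have i3 : Integrable (fun z => gxy z ^ 2) M := mxy.integrable_sq
  have i4 : Integrable (fun z => gyy z ^ 2) M := myy.integrable_sq
  have e1 : ∀ z : ℝ × ℝ, (Hx z ^ 2 + Hy z ^ 2) * e z.1 ^ 2 = gx z ^ 2 + gy z ^ 2 := fun z => by
    simp only [hgx, hgy]; ring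
  have e2 : ∀ z : ℝ × ℝ, (Hxy z ^ 2 + Hyy z ^ 2) * e z.1 ^ 2 = gxy z ^ 2 + gyy z ^ 2 := fun z => by
    simp only [hgxy, hgyy]; ring
  change lam * ∫ z, (Hx z ^ 2 + Hy z ^ 2) * e z.1 ^ 2 ∂M ≤ κ * A at c1
  change ∫ z, (Hxy z ^ 2 + Hyy z ^ 2) * e z.1 ^ 2 ∂M ≤
    A + 16 * lam ^ 2 * x₁ ^ 2 * ∫ z, (Hx z ^ 2 + Hy z ^ 2) * e z.1 ^ 2 ∂M at c2
  change (∫ z, (Hx z ^ 2 + Hy z ^ 2) * e z.1 ^ 2 ∂M ≤ _) ∧ ∀ (F D' : ℝ × ℝ → ℝ) (N : ℝ), _ → _ → _ →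
    _ → ∫ z, |F z| * ((Hx z ^ 2 + Hy z ^ 2) * e z.1 ^ 2) ∂M ≤ _
  simp only [e1, e2] at c1 c2 ⊢
  have hκA : κ * A ≤ τ * A := mul_le_mul_of_nonneg_right hτ hA0
  have c3 : (∫ z, gxy z ^ 2 ∂M) + ∫ z, gyy z ^ 2 ∂M ≤ lam * (τ * A) := by
    rw [← integral_add i3 i4]
    refine c2.trans ?_
    have t1 : 16 * lam ^ 2 * x₁ ^ 2 * ∫ z, (gx z ^ 2 + gy z ^ 2) ∂M =
        16 * lam * x₁ ^ 2 * (lam * ∫ z, (gx z ^ 2 + gy z ^ 2) ∂M) := by ring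
    have t2 : 16 * lam * x₁ ^ 2 * (lam * ∫ z, (gx z ^ 2 + gy z ^ 2) ∂M) ≤
        16 * lam * x₁ ^ 2 * (κ * A) := mul_le_mul_of_nonneg_left c1 (by positivity)
    have t3 : A ≤ lam * A := le_mul_of_one_le_left hA0 hl
    have t4 : lam * ((1 + 16 * x₁ ^ 2 * κ) * A) ≤ lam * (τ * A) :=
      mul_le_mul_of_nonneg_left (mul_le_mul_of_nonneg_right (le_max_right _ _) hA0) hl0.le
    rw [t1]
    linarith
  rw [integral_add i1 i2] at c1 ⊢
  have p1 : 0 ≤ ∫ z, gx z ^ 2 ∂M := integral_nonneg fun _ => sq_nonneg _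
  have p2 : 0 ≤ ∫ z, gy z ^ 2 ∂M := integral_nonneg fun _ => sq_nonneg _
  have p3 : 0 ≤ ∫ z, gxy z ^ 2 ∂M := integral_nonneg fun _ => sq_nonneg _
  have p4 : 0 ≤ ∫ z, gyy z ^ 2 ∂M := integral_nonneg fun _ => sq_nonneg _
  have hτA : 0 ≤ τ * A := by positivity
  constructor
  · rw [le_div_iff₀ hs]
    calc ((∫ z, gx z ^ 2 ∂M) + ∫ z, gy z ^ 2 ∂M) * √lam
        ≤ ((∫ z, gx z ^ 2 ∂M) + ∫ z, gy z ^ 2 ∂M) * lam := by gcongr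
      _ ≤ τ * A := by linarith
      _ ≤ 2 * (1 + Λ) * τ * A := by nlinarith [mul_nonneg hΛ.le hτA]
  · intro F D' N hF hD aF hN
    obtain ⟨B, hB⟩ := h.bdd
    obtain ⟨E, hE⟩ := (isCompact_Icc (a := x₀) (b := x₁)).exists_bound_of_continuousOn
      hec.continuousOn
    have bx : ∀ᵐ z ∂M, |gx z| ≤ E * B := by
      filter_upwards [hB, ae_box_mem] with z hz hz'
      simp only [hgx, abs_mul]
      have := hE z.1 (Ioo_subset_Icc_self hz'.1)
      exact mul_le_mul this hz.1 (abs_nonneg _) ((norm_nonneg _).trans this)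
    have by' : ∀ᵐ z ∂M, |gy z| ≤ E * B := by
      filter_upwards [hB, ae_box_mem] with z hz hz'
      simp only [hgy, abs_mul]
      have := hE z.1 (Ioo_subset_Icc_self hz'.1)
      exact mul_le_mul this hz.2 (abs_nonneg _) ((norm_nonneg _).trans this)
    have ax : ∀ᵐ x ∂(ivl x₀ x₁), ACD y₀ y₁ (fun y => gx (x, y)) (fun y => gxy (x, y)) := by
      filter_upwards [h.axy] with x hx'
      exact ((ACD.const y₀ y₁ (e x)).mul hx'.1).congr_deriv (ae_of_all _ fun y => by
        simp only [hgxy]; ring)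
    have ay : ∀ᵐ x ∂(ivl x₀ x₁), ACD y₀ y₁ (fun y => gy (x, y)) (fun y => gyy (x, y)) := by
      filter_upwards [h.ayy] with x hx'
      exact ((ACD.const y₀ y₁ (e x)).mul hx').congr_deriv (ae_of_all _ fun y => by
        simp only [hgyy]; ring)
    have r1 := integral_abs_mul_sq_le hx hy hF hD mx mxy bx aF ax hl hτA hN
      (by nlinarith) (by linarith)
    have r2 := integral_abs_mul_sq_le hx hy hF hD my myy by' aF ay hl hτA hN
      (by nlinarith) (by linarith)
    have iFx : Integrable (fun z => |F z| * gx z ^ 2) M := by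
      refine (hF.integrable (by norm_num)).abs.mul_bdd (c := (E * B) ^ 2) i1.aestronglyMeasurable ?_
      filter_upwards [bx] with z hz
      rw [norm_pow]
      exact pow_le_pow_left₀ (norm_nonneg _) hz 2
    have iFy : Integrable (fun z => |F z| * gy z ^ 2) M := by
      refine (hF.integrable (by norm_num)).abs.mul_bdd (c := (E * B) ^ 2) i2.aestronglyMeasurable ?_
      filter_upwards [by'] with z hz
      rw [norm_pow]
      exact pow_le_pow_left₀ (norm_nonneg _) hz 2
    simp only [mul_add]
    rw [integral_add iFx iFy]
    refine (add_le_add r1 r2).trans ?_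
    rw [← add_div]
    refine div_le_div_of_nonneg_right ?_ hs.le
    have hN0 : 0 ≤ N := le_trans (add_nonneg (integral_nonneg fun _ => sq_nonneg _)
      (integral_nonneg fun _ => sq_nonneg _)) hN
    have e3 : (1 + ((x₁ - x₀)⁻¹ + 1) * N * ((y₁ - y₀)⁻¹ + 2)) * (τ * A) +
        (1 + ((x₁ - x₀)⁻¹ + 1) * N * ((y₁ - y₀)⁻¹ + 2)) * (τ * A) = 2 * (1 + Λ * N) * (τ * A) := by
      simp only [Λ]; ring
    rw [e3]
    have : (1 + Λ * N) ≤ (1 + Λ) * (1 + N) := by nlinarith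
    calc 2 * (1 + Λ * N) * (τ * A) ≤ 2 * ((1 + Λ) * (1 + N)) * (τ * A) := by gcongr
      _ = 2 * (1 + Λ) * τ * (1 + N) * A := by ring
      _ = _ := by ring

end EIT


/-! ### Boundary values of derivatives and the Carleman estimate on `H₀³` -/

namespace EIT

variable {x₀ x₁ y₀ y₁ a b c₁ c₂ : ℝ}

theorem ae_slices_x {f g : ℝ × ℝ → ℝ} (h : f =ᵐ[box x₀ x₁ y₀ y₁] g) :
    ∀ᵐ y ∂(ivl y₀ y₁), (fun x => f (x, y)) =ᵐ[ivl x₀ x₁] fun x => g (x, y) := by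
  have h' : ∀ᵐ z ∂(box y₀ y₁ x₀ x₁), f z.swap = g z.swap := by
    refine ae_box_swap (x₀ := y₀) (y₀ := x₀) ?_
    filter_upwards [h] with z hz using by simpa using hz
  exact Measure.ae_ae_of_ae_prod h'

theorem ae_slices_y {f g : ℝ × ℝ → ℝ} (h : f =ᵐ[box x₀ x₁ y₀ y₁] g) :
    ∀ᵐ x ∂(ivl x₀ x₁), (fun y => f (x, y)) =ᵐ[ivl y₀ y₁] fun y => g (x, y) :=
  Measure.ae_ae_of_ae_prod h

theorem ACD.continuousOn {s t : ℝ} {f f' : ℝ → ℝ} (hst : s ≤ t) (hf : ACD s t f f') :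
    ContinuousOn f (Icc s t) := by
  have := hf.ac.continuousOn
  rwa [uIcc_of_le hst] at this

theorem eqOn_Icc_of_ae_ivl {s t : ℝ} {f g : ℝ → ℝ} (hst : s < t) (hf : ContinuousOn f (Icc s t))
    (hg : ContinuousOn g (Icc s t)) (h : f =ᵐ[ivl s t] g) : EqOn f g (Icc s t) := by
  have h1 := Measure.eqOn_open_of_ae_eq h isOpen_Ioo (hf.mono Ioo_subset_Icc_self)
    (hg.mono Ioo_subset_Icc_self)
  exact h1.of_subset_closure hf hg Ioo_subset_Icc_self (by rw [closure_Ioo hst.ne])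

/-- The conditions on `u` and `u_x` must be passed on to tangential derivatives: `u_x` and `u_xx`
vanish on the horizontal sides, `u_y` on the vertical ones. The three `MixRep` structures produce
different representatives of the same derivative, which have to be matched on individual lines. -/
theorem exists_zeroSlices (h₁ : 0 < c₁) (h₂ : 0 < c₂) {u : H3 (rect a b c₁ c₂)}
    (hu : u ∈ H3₀ (rect a b c₁ c₂) (rightSide a b c₁ c₂)) :
    ∃ H Hx Hy Hxx Hxy Hyy Hxxy,
      ZeroSlices (a - c₁) (a + c₁) (b - c₂) (b + c₂) H Hx Hy Hxx Hxy Hyy Hxxy ∧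
      der u 1 0 =ᵐ[rectBox a b c₁ c₂] Hx ∧ der u 0 1 =ᵐ[rectBox a b c₁ c₂] Hy ∧
      der u 2 0 =ᵐ[rectBox a b c₁ c₂] Hxx ∧ der u 0 2 =ᵐ[rectBox a b c₁ c₂] Hyy := by
  obtain ⟨F0, G1, G2, M0, e00, e10, e01⟩ := exists_mixRep_der h₁ h₂ u (i := 0) (j := 0) (by norm_num)
  obtain ⟨F1, A, B, M1, e10', e20, e11⟩ := exists_mixRep_der h₁ h₂ u (i := 1) (j := 0) (by norm_num)
  obtain ⟨F2, C, E, M2, e01', e11', e02⟩ := exists_mixRep_der h₁ h₂ u (i := 0) (j := 1) (by norm_num)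
  obtain ⟨⟨U, hU, hUe, hU0⟩, ⟨V, hV, hVe, hV0⟩⟩ := hu
  simp only [zero_add, Nat.reduceAdd] at e10 e01 e20 e11 e11' e02 M0 M1 M2
  have hcl := closure_rect (a := a) (b := b) h₁ h₂
  have hF0 : EqOn F0 U (closure (rect a b c₁ c₂)) := by
    refine eqOn_of_ae isOpen_rect (by rw [hcl]; exact M0.cont) hU ?_
    filter_upwards [hUe, ae_rect.2 e00] with z h1 h2
    rw [← h2, ← h1]; rfl
  have hF1 : EqOn F1 V (closure (rect a b c₁ c₂)) := by
    refine eqOn_of_ae isOpen_rect (by rw [hcl]; exact M1.cont) hV ?_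
    filter_upwards [hVe, ae_rect.2 e10'] with z h1 h2
    rw [← h2, ← h1]; rfl
  set x₀ := a - c₁ with hx₀
  set x₁ := a + c₁ with hx₁
  set y₀ := b - c₂ with hy₀
  set y₁ := b + c₂ with hy₁
  have hx : x₀ < x₁ := by linarith
  have hy : y₀ < y₁ := by linarith
  have hz : ∀ z ∈ Icc x₀ x₁ ×ˢ Icc y₀ y₁, z ∉ Ioo x₀ x₁ ×ˢ Ioo y₀ y₁ → F0 z = 0 := by
    intro z hz hz'
    rw [← hcl] at hz
    rw [hF0 hz]
    refine hU0 z ?_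
    rw [isOpen_rect.frontier_eq, rect_eq_prod]
    exact ⟨by rwa [← rect_eq_prod], hz'⟩
  have zx0 : ∀ y ∈ Icc y₀ y₁, F0 (x₀, y) = 0 := fun y hy' =>
    hz _ ⟨left_mem_Icc.2 hx.le, hy'⟩ fun h => lt_irrefl _ h.1.1
  have zx1 : ∀ y ∈ Icc y₀ y₁, F0 (x₁, y) = 0 := fun y hy' =>
    hz _ ⟨right_mem_Icc.2 hx.le, hy'⟩ fun h => lt_irrefl _ h.1.2
  have zy0 : ∀ x ∈ Icc x₀ x₁, F0 (x, y₀) = 0 := fun x hx' =>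
    hz _ ⟨hx', left_mem_Icc.2 hy.le⟩ fun h => lt_irrefl _ h.2.1
  have zy1 : ∀ x ∈ Icc x₀ x₁, F0 (x, y₁) = 0 := fun x hx' =>
    hz _ ⟨hx', right_mem_Icc.2 hy.le⟩ fun h => lt_irrefl _ h.2.2
  have hGF1 : G1 =ᵐ[box x₀ x₁ y₀ y₁] F1 := e10.symm.trans e10'
  have hGF2 : G2 =ᵐ[box x₀ x₁ y₀ y₁] F2 := e01.symm.trans e01'
  have hBC : C =ᵐ[box x₀ x₁ y₀ y₁] B := e11'.symm.trans e11
  -- the first derivatives on the sides where the function vanishes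
  have hx_side : ∀ s ∈ Icc y₀ y₁, (∀ x ∈ Icc x₀ x₁, F0 (x, s) = 0) →
      ∀ x ∈ Icc x₀ x₁, F1 (x, s) = 0 := by
    intro s hs h0
    have h1 := (M0.acd_x s hs).deriv_ae_eq_zero fun x hx' => h0 x (Ioo_subset_Icc_self hx')
    have h2 : (fun x => F1 (x, s)) =ᵐ[ivl x₀ x₁] fun _ => 0 := by
      -- `G1` and `F1` agree only almost everywhere in the rectangle, and the side is a null set. On
      -- almost every vertical line both are continuous and agree almost everywhere, hence also at
      -- height `s`.
      filter_upwards [h1, M0.acd_xy, ae_slices_y hGF1, ae_ivl_of_forall fun x hx => hx]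
        with x k1 k2 k3 k4
      have := eqOn_Icc_of_ae_ivl hy (k2.continuousOn hy.le)
        ((M1.acd_y x (Ioo_subset_Icc_self k4)).continuousOn hy.le) k3 hs
      simp only at this
      rw [← this, k1]; rfl
    exact eqOn_Icc_of_ae_ivl hx ((M1.acd_x s hs).continuousOn hx.le) continuousOn_const h2
  have hy_side : ∀ s ∈ Icc x₀ x₁, (∀ y ∈ Icc y₀ y₁, F0 (s, y) = 0) →
      ∀ᵐ y ∂(ivl y₀ y₁), F2 (s, y) = 0 := by
    intro s hs h0
    have h1 := (M0.acd_y s hs).deriv_ae_eq_zero fun y hy' => h0 y (Ioo_subset_Icc_self hy')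
    filter_upwards [h1, M0.acd_yx, ae_slices_x hGF2, ae_ivl_of_forall fun x hx => hx]
      with y k1 k2 k3 k4
    have := eqOn_Icc_of_ae_ivl hx (k2.continuousOn hx.le)
      ((M2.acd_x y (Ioo_subset_Icc_self k4)).continuousOn hx.le) k3 hs
    simp only at this
    rw [← this, k1]; rfl
  have my0 := left_mem_Icc.2 hy.le
  have my1 := right_mem_Icc.2 hy.le
  have mx0 := left_mem_Icc.2 hx.le
  have mx1 := right_mem_Icc.2 hx.le
  have s10 := hx_side y₀ my0 zy0
  have s11 := hx_side y₁ my1 zy1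
  have s20 := hy_side x₀ mx0 zx0
  have s21 := hy_side x₁ mx1 zx1
  -- Since `u_x` vanishes along the horizontal sides, so does its tangential derivative `u_xx`;
  -- `carleman_second` needs this.
  have t0 := (M1.acd_x y₀ my0).deriv_ae_eq_zero fun x hx' => s10 x (Ioo_subset_Icc_self hx')
  have t1 := (M1.acd_x y₁ my1).deriv_ae_eq_zero fun x hx' => s11 x (Ioo_subset_Icc_self hx')
  obtain ⟨B1, hB1⟩ := (isCompact_Icc.prod isCompact_Icc).exists_bound_of_continuousOn M1.cont
  obtain ⟨B2, hB2⟩ := (isCompact_Icc.prod isCompact_Icc).exists_bound_of_continuousOn M2.cont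
  refine ⟨F0, F1, F2, A, B, E, der u 2 1, ⟨(memLp_rectBox _).ae_eq e00, (memLp_rectBox _).ae_eq e10',
    (memLp_rectBox _).ae_eq e01', (memLp_rectBox _).ae_eq e20, (memLp_rectBox _).ae_eq e11,
    (memLp_rectBox _).ae_eq e02, memLp_rectBox _, ⟨max B1 B2, ?_⟩, ?_, ?_, ?_, ?_, ?_, ?_, ?_, ?_⟩,
    e10', e01', e20, e02⟩
  · filter_upwards [ae_box_mem] with z hz
    have hz' : z ∈ Icc x₀ x₁ ×ˢ Icc y₀ y₁ := ⟨Ioo_subset_Icc_self hz.1, Ioo_subset_Icc_self hz.2⟩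
    exact ⟨(hB1 z hz').trans (le_max_left _ _), (hB2 z hz').trans (le_max_right _ _)⟩
  · filter_upwards [ae_slices_x hGF1, ae_ivl_of_forall fun x hx => hx] with y k1 k2
    have k3 := Ioo_subset_Icc_self k2
    exact ⟨(M0.acd_x y k3).congr_deriv k1, zx0 y k3, zx1 y k3⟩
  · filter_upwards [ae_ivl_of_forall fun x hx => hx] with y k2
    have k3 := Ioo_subset_Icc_self k2
    refine ⟨M1.acd_x y k3, ?_⟩
    rw [hF1 (by rw [hcl]; exact ⟨mx1, k3⟩)]
    exact hV0 _ ⟨rfl, k2⟩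
  · filter_upwards [ae_slices_x hBC, s20, s21, ae_ivl_of_forall fun x hx => hx] with y k1 k2 k3 k4
    exact ⟨(M2.acd_x y (Ioo_subset_Icc_self k4)).congr_deriv k1, k2, k3⟩
  · exact M1.acd_yx
  · filter_upwards [ae_slices_y hGF2, ae_ivl_of_forall fun x hx => hx] with x k1 k2
    have k3 := Ioo_subset_Icc_self k2
    exact ⟨(M0.acd_y x k3).congr_deriv k1, zy0 x k3, zy1 x k3⟩
  · filter_upwards [ae_ivl_of_forall fun x hx => hx] with x k2
    exact M2.acd_y x (Ioo_subset_Icc_self k2)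
  · filter_upwards [ae_ivl_of_forall fun x hx => hx] with x k2
    have k3 := Ioo_subset_Icc_self k2
    exact ⟨M1.acd_y x k3, s10 x k3, s11 x k3⟩
  · filter_upwards [M1.acd_xy, t0, t1] with x k1 k2 k3
    exact ⟨k1, k2, k3⟩

theorem norm_sq_eq_integral {Ω : Set (ℝ × ℝ)} (f : L2 Ω) : ‖f‖ ^ 2 = ∫ z in Ω, f z ^ 2 := by
  rw [← real_inner_self_eq_norm_sq, L2.inner_def]
  exact integral_congr_ae (ae_of_all _ fun z => by simp [sq])

/-- The Carleman estimate for `u ∈ H₀³`: the weighted norm of the gradient is controlled by the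
Laplacian, also after multiplication with the Laplacian of some `v ∈ H³`. -/
theorem exists_carleman_H3₀ (ha : 0 < a - c₁) (h₁ : 0 < c₁) (h₂ : 0 < c₂) : ∃ C, 0 < C ∧
    ∀ lam : ℝ, 1 ≤ lam → ∀ u ∈ H3₀ (rect a b c₁ c₂) (rightSide a b c₁ c₂),
      (∫ z in rect a b c₁ c₂, (dx u z ^ 2 + dy u z ^ 2) * Real.exp (lam * z.1 ^ 2) ^ 2 ≤
        C * (∫ z in rect a b c₁ c₂, (dxx u z + dyy u z) ^ 2 * Real.exp (lam * z.1 ^ 2) ^ 2) / √lam) ∧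
      ∀ v : H3 (rect a b c₁ c₂),
        ∫ z in rect a b c₁ c₂, |dxx v z + dyy v z| *
            ((dx u z ^ 2 + dy u z ^ 2) * Real.exp (lam * z.1 ^ 2) ^ 2) ≤
          C * (1 + ‖v‖ ^ 2) *
            (∫ z in rect a b c₁ c₂, (dxx u z + dyy u z) ^ 2 * Real.exp (lam * z.1 ^ 2) ^ 2) / √lam := by
  have hx : a - c₁ < a + c₁ := by linarith
  have hy : b - c₂ < b + c₂ := by linarith
  obtain ⟨C, hC, key⟩ := exists_carleman ha hx hy
  -- The factor `8` pays for `‖v_xx + v_yy‖² + ‖v_xxx + v_xyy‖² ≤ 8‖v‖²`.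
  refine ⟨8 * C, by positivity, fun lam hl u hu => ?_⟩
  obtain ⟨H, Hx, Hy, Hxx, Hxy, Hyy, Hxxy, hZ, ex, ey, exx, eyy⟩ := exists_zeroSlices h₁ h₂ hu
  have hA : ∫ z in rect a b c₁ c₂, (dxx u z + dyy u z) ^ 2 * Real.exp (lam * z.1 ^ 2) ^ 2 =
      ∫ z, (Hxx z + Hyy z) ^ 2 * Real.exp (lam * z.1 ^ 2) ^ 2 ∂(rectBox a b c₁ c₂) := by
    rw [setIntegral_rect]
    refine integral_congr_ae ?_
    filter_upwards [exx, eyy] with z k1 k2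
    rw [dxx_eq_der, dyy_eq_der, k1, k2]
  obtain ⟨K1, K2⟩ := key lam hl H Hx Hy Hxx Hxy Hyy Hxxy hZ _ hA
  have hA0 : 0 ≤ ∫ z in rect a b c₁ c₂, (dxx u z + dyy u z) ^ 2 * Real.exp (lam * z.1 ^ 2) ^ 2 :=
    integral_nonneg fun z => by simp only [Pi.zero_apply]; positivity
  set A := ∫ z in rect a b c₁ c₂, (dxx u z + dyy u z) ^ 2 * Real.exp (lam * z.1 ^ 2) ^ 2
  constructor
  · rw [setIntegral_rect]
    have : ∫ z, (dx u z ^ 2 + dy u z ^ 2) * Real.exp (lam * z.1 ^ 2) ^ 2 ∂(rectBox a b c₁ c₂) =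
        ∫ z, (Hx z ^ 2 + Hy z ^ 2) * Real.exp (lam * z.1 ^ 2) ^ 2 ∂(rectBox a b c₁ c₂) := by
      refine integral_congr_ae ?_
      filter_upwards [ex, ey] with z k1 k2
      rw [dx_eq_der, dy_eq_der, k1, k2]
    rw [this]
    refine K1.trans (div_le_div_of_nonneg_right ?_ (Real.sqrt_nonneg _))
    nlinarith [mul_nonneg hC.le hA0]
  · intro v
    obtain ⟨F1, hF1, aF1⟩ := (weakX_der v (i := 2) (j := 0) (by norm_num)).exists_acd hx
      (integrable_rectBox _) (integrable_rectBox _) (Lp.stronglyMeasurable _)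
    obtain ⟨F2, hF2, aF2⟩ := (weakX_der v (i := 0) (j := 2) (by norm_num)).exists_acd hx
      (integrable_rectBox _) (integrable_rectBox _) (Lp.stronglyMeasurable _)
    have hsq : ∀ f g : L2 (rect a b c₁ c₂), ‖f‖ ≤ ‖v‖ → ‖g‖ ≤ ‖v‖ →
        ∫ z, (f z + g z) ^ 2 ∂(rectBox a b c₁ c₂) ≤ 4 * ‖v‖ ^ 2 := by
      intro f g hf hg
      have h1 := norm_sq_eq_integral (f + g)
      rw [setIntegral_rect] at h1
      have h2 : ∫ z, (f z + g z) ^ 2 ∂(rectBox a b c₁ c₂) = ‖f + g‖ ^ 2 := by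
        rw [h1]
        refine integral_congr_ae ?_
        filter_upwards [ae_rect.1 (Lp.coeFn_add f g)] with z hz
        rw [hz]; rfl
      rw [h2]
      have h3 := norm_add_le f g
      nlinarith [norm_nonneg (f + g), norm_nonneg v]
    have m1 : MemLp (fun z => F1 z + F2 z) 2 (rectBox a b c₁ c₂) :=
      ((memLp_rectBox _).ae_eq hF1).add ((memLp_rectBox _).ae_eq hF2)
    have m2 : MemLp (fun z => der v 3 0 z + der v 1 2 z) 2 (rectBox a b c₁ c₂) :=
      (memLp_rectBox _).add (memLp_rectBox _)
    have a3 : ∀ᵐ y ∂(ivl (b - c₂) (b + c₂)), ACD (a - c₁) (a + c₁) (fun x => F1 (x, y) + F2 (x, y))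
        (fun x => der v 3 0 (x, y) + der v 1 2 (x, y)) := by
      filter_upwards [aF1, aF2] with y k1 k2 using k1.add k2
    have hN : (∫ z, (F1 z + F2 z) ^ 2 ∂(rectBox a b c₁ c₂)) +
        ∫ z, (der v 3 0 z + der v 1 2 z) ^ 2 ∂(rectBox a b c₁ c₂) ≤ 8 * ‖v‖ ^ 2 := by
      have h1 : ∫ z, (F1 z + F2 z) ^ 2 ∂(rectBox a b c₁ c₂) =
          ∫ z, (der v 2 0 z + der v 0 2 z) ^ 2 ∂(rectBox a b c₁ c₂) := by
        refine integral_congr_ae ?_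
        filter_upwards [hF1, hF2] with z k1 k2
        rw [k1, k2]
      rw [h1]
      have := hsq _ _ (norm_der_le v 2 0) (norm_der_le v 0 2)
      have := hsq _ _ (norm_der_le v 3 0) (norm_der_le v 1 2)
      linarith
    have K3 := K2 _ _ _ m1 m2 a3 hN
    rw [setIntegral_rect]
    have : ∫ z, |dxx v z + dyy v z| *
            ((dx u z ^ 2 + dy u z ^ 2) * Real.exp (lam * z.1 ^ 2) ^ 2) ∂(rectBox a b c₁ c₂) =
        ∫ z, |F1 z + F2 z| * ((Hx z ^ 2 + Hy z ^ 2) * Real.exp (lam * z.1 ^ 2) ^ 2)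
          ∂(rectBox a b c₁ c₂) := by
      refine integral_congr_ae ?_
      filter_upwards [ex, ey, hF1, hF2] with z k1 k2 k3 k4
      rw [dx_eq_der, dy_eq_der, dxx_eq_der, dyy_eq_der, k1, k2, k3, k4]
    rw [this]
    refine K3.trans (div_le_div_of_nonneg_right ?_ (Real.sqrt_nonneg _))
    refine mul_le_mul_of_nonneg_right ?_ hA0
    nlinarith

end EIT


namespace EIT

/-! ### Strongly convex functionals on a ball of a Hilbert space -/

variable {H : Type*} [NormedAddCommGroup H] [InnerProductSpace ℝ H]

/-- `J` is nonnegative with derivative `dJ`, Lipschitz on bounded sets, and is strongly convex on the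
ball of radius `3 R` along the subspace `V`. -/
structure ConvexOnBall (V : Submodule ℝ H) (J : H → ℝ) (dJ : H → H →L[ℝ] ℝ) (R α : ℝ) : Prop where
  nonneg : ∀ x, 0 ≤ J x
  hasFDerivAt : ∀ x, HasFDerivAt J (dJ x) x
  lip : ∀ ρ, ∃ L, 0 ≤ L ∧ ∀ x y, ‖x‖ ≤ ρ → ‖y‖ ≤ ρ → ‖dJ x - dJ y‖ ≤ L * ‖x - y‖
  pos : 0 < α
  radius_pos : 0 < R
  convex : ∀ x y, ‖x‖ ≤ 3 * R → ‖y‖ ≤ 3 * R → y - x ∈ V →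
    J x + dJ x (y - x) + α * ‖y - x‖ ^ 2 ≤ J y

namespace ConvexOnBall

variable {V : Submodule ℝ H} {J : H → ℝ} {dJ : H → H →L[ℝ] ℝ} {R α : ℝ}

theorem continuous (h : ConvexOnBall V J dJ R α) : Continuous J :=
  continuous_iff_continuousAt.2 fun x => (h.hasFDerivAt x).continuousAt

/-- The convexity inequality is used at the midpoint towards both ends; the linear terms cancel, and
half the distance, squared, gives `α/4`. -/
theorem midpoint_le (h : ConvexOnBall V J dJ R α) {x y : H} (hx : ‖x‖ ≤ 3 * R)
    (hy : ‖y‖ ≤ 3 * R) (hxy : y - x ∈ V) :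
    J ((1 / 2 : ℝ) • (x + y)) + α / 4 * ‖y - x‖ ^ 2 ≤ (J x + J y) / 2 := by
  set c := (1 / 2 : ℝ) • (x + y) with hc
  have e1 : x - c = (-(1 / 2) : ℝ) • (y - x) := by rw [hc]; module
  have e2 : y - c = (1 / 2 : ℝ) • (y - x) := by rw [hc]; module
  have hcn : ‖c‖ ≤ 3 * R := by
    rw [hc, norm_smul]
    have := norm_add_le x y
    norm_num
    linarith
  have k1 := h.convex c x hcn hx (by rw [e1]; exact V.smul_mem _ hxy)
  have k2 := h.convex c y hcn hy (by rw [e2]; exact V.smul_mem _ hxy)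
  rw [e1, map_smul, norm_smul, smul_eq_mul] at k1
  rw [e2, map_smul, norm_smul, smul_eq_mul] at k2
  norm_num at k1 k2
  nlinarith

/-- `m` minimizes `J` over the points `p + h` with `h ∈ V`, `‖h‖ ≤ 2 R`. -/
def IsMin (V : Submodule ℝ H) (J : H → ℝ) (R : ℝ) (p m : H) : Prop :=
  m - p ∈ V ∧ ‖m - p‖ ≤ 2 * R ∧ ∀ q, q - p ∈ V → ‖q - p‖ ≤ 2 * R → J m ≤ J q

theorem norm_le_of_sub {E : Type*} [NormedAddCommGroup E] {p q : E} (hp : ‖p‖ ≤ R) (hq : ‖q - p‖ ≤ 2 * R) : ‖q‖ ≤ 3 * R := by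
  have := norm_add_le (q - p) p
  rw [sub_add_cancel] at this
  linarith

theorem midpoint_mem {p q q' : H} (h1 : q - p ∈ V) (h2 : q' - p ∈ V) (n1 : ‖q - p‖ ≤ 2 * R)
    (n2 : ‖q' - p‖ ≤ 2 * R) : (1 / 2 : ℝ) • (q + q') - p ∈ V ∧
      ‖(1 / 2 : ℝ) • (q + q') - p‖ ≤ 2 * R := by
  have e : (1 / 2 : ℝ) • (q + q') - p = (1 / 2 : ℝ) • ((q - p) + (q' - p)) := by module
  rw [e]
  refine ⟨V.smul_mem _ (V.add_mem h1 h2), ?_⟩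
  rw [norm_smul]
  have := norm_add_le (q - p) (q' - p)
  norm_num
  linarith

/-- The midpoint of `m` and `q` is admissible, so its value is at least `J m`. This quadratic growth
holds even if the minimizer lies on the sphere bounding the constraint, where the gradient need not
vanish. -/
theorem isMin_gap (h : ConvexOnBall V J dJ R α) {p m q : H} (hp : ‖p‖ ≤ R)
    (hm : IsMin V J R p m) (hq : q - p ∈ V) (hqn : ‖q - p‖ ≤ 2 * R) :
    J m + α / 2 * ‖q - m‖ ^ 2 ≤ J q := by
  have hmem := midpoint_mem hm.1 hq hm.2.1 hqn
  have h1 := hm.2.2 _ hmem.1 hmem.2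
  have h2 := h.midpoint_le (norm_le_of_sub hp hm.2.1) (norm_le_of_sub hp hqn)
    (by have := V.sub_mem hq hm.1; rwa [sub_sub_sub_cancel_right] at this)
  linarith

theorem isMin_unique (h : ConvexOnBall V J dJ R α) {p m m' : H} (hp : ‖p‖ ≤ R)
    (hm : IsMin V J R p m) (hm' : IsMin V J R p m') : m = m' := by
  have h1 := h.isMin_gap hp hm hm'.1 hm'.2.1
  have h2 := hm'.2.2 m hm.1 hm.2.1
  have h3 := h.pos
  have : ‖m' - m‖ ^ 2 ≤ 0 := by
    by_contra hc
    have := mul_pos (half_pos h3) (not_le.1 hc)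
    linarith
  have h0 : ‖m' - m‖ = 0 := by
    have := sq_nonneg ‖m' - m‖
    exact pow_eq_zero_iff (two_ne_zero) |>.1 (le_antisymm ‹_› this)
  exact (sub_eq_zero.1 (norm_eq_zero.1 h0)).symm

/-- No weak compactness is needed: by `midpoint_le` two nearly minimal admissible points are close,
so a minimizing sequence is Cauchy, and the constraint set is closed. -/
theorem exists_isMin [CompleteSpace H] (h : ConvexOnBall V J dJ R α)
    (hV : IsClosed (V : Set H)) {p : H} (hp : ‖p‖ ≤ R) : ∃ m, IsMin V J R p m := by
  set S : Set H := {q | q - p ∈ V ∧ ‖q - p‖ ≤ 2 * R} with hS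
  have hR := h.radius_pos
  have hpS : p ∈ S := ⟨by simp, by simp; linarith⟩
  have hScl : IsClosed S := (hV.preimage (continuous_id.sub continuous_const)).inter
    (isClosed_le (continuous_id.sub continuous_const).norm continuous_const)
  set I := sInf (J '' S) with hI
  have hbdd : BddBelow (J '' S) := ⟨0, by rintro _ ⟨q, -, rfl⟩; exact h.nonneg q⟩
  have hne : (J '' S).Nonempty := ⟨_, p, hpS, rfl⟩
  have hle : ∀ q ∈ S, I ≤ J q := fun q hq => csInf_le hbdd ⟨q, hq, rfl⟩
  have hex : ∀ n : ℕ, ∃ q ∈ S, J q < I + 1 / ((n : ℝ) + 1) := by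
    intro n
    obtain ⟨_, ⟨q, hq, rfl⟩, hlt⟩ := exists_lt_of_csInf_lt hne
      (lt_add_of_pos_right I (by positivity : (0 : ℝ) < 1 / ((n : ℝ) + 1)))
    exact ⟨q, hq, hlt⟩
  choose q hqS hqJ using hex
  have hα := h.pos
  have hgap : ∀ n k, α / 4 * ‖q k - q n‖ ^ 2 ≤ (1 / ((n : ℝ) + 1) + 1 / ((k : ℝ) + 1)) / 2 := by
    intro n k
    have hmem := midpoint_mem (hqS n).1 (hqS k).1 (hqS n).2 (hqS k).2
    have h1 := hle _ hmem
    have h2 := h.midpoint_le (norm_le_of_sub hp (hqS n).2) (norm_le_of_sub hp (hqS k).2)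
      (by have := V.sub_mem (hqS k).1 (hqS n).1; rwa [sub_sub_sub_cancel_right] at this)
    have := hqJ n
    have := hqJ k
    linarith
  have hcau : CauchySeq q := by
    rw [Metric.cauchySeq_iff']
    intro δ hδ
    obtain ⟨N, hN⟩ := exists_nat_one_div_lt (show 0 < α / 4 * δ ^ 2 by positivity)
    refine ⟨N, fun n hn => ?_⟩
    have h1 := hgap N n
    have h2 : 1 / ((n : ℝ) + 1) ≤ 1 / ((N : ℝ) + 1) := by
      have : (N : ℝ) ≤ n := by exact_mod_cast hn
      exact one_div_le_one_div_of_le (by positivity) (by linarith)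
    have h3 : α / 4 * ‖q n - q N‖ ^ 2 < α / 4 * δ ^ 2 := by linarith
    have h4 := lt_of_mul_lt_mul_left h3 (by positivity)
    rw [dist_eq_norm]
    exact lt_of_pow_lt_pow_left₀ 2 hδ.le h4
  obtain ⟨m, hm⟩ := cauchySeq_tendsto_of_complete hcau
  have hmS : m ∈ S := hScl.mem_of_tendsto hm (Filter.Eventually.of_forall hqS)
  have hJm : J m ≤ I := by
    have t1 : Filter.Tendsto (fun n => J (q n)) Filter.atTop (nhds (J m)) :=
      (h.continuous.tendsto m).comp hm
    have t2 : Filter.Tendsto (fun n : ℕ => I + 1 / ((n : ℝ) + 1)) Filter.atTop (nhds (I + 0)) :=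
      tendsto_const_nhds.add tendsto_one_div_add_atTop_nhds_zero_nat
    rw [add_zero] at t2
    exact le_of_tendsto_of_tendsto' t1 t2 fun n => (hqJ n).le
  exact ⟨m, hmS.1, hmS.2, fun q' h1 h2 => hJm.trans (hle q' ⟨h1, h2⟩)⟩

theorem exists_lipschitz (h : ConvexOnBall V J dJ R α) : ∃ K, 0 ≤ K ∧ ∀ x y, ‖x‖ ≤ 3 * R →
    ‖y‖ ≤ 3 * R → |J x - J y| ≤ K * ‖x - y‖ := by
  obtain ⟨L, hL0, hL⟩ := h.lip (3 * R)
  have hR := h.radius_pos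
  refine ⟨‖dJ 0‖ + L * (3 * R), by positivity, fun x y hx hy => ?_⟩
  refine (convex_closedBall (0 : H) (3 * R)).norm_image_sub_le_of_norm_hasFDerivWithin_le
    (f := J) (f' := dJ) (fun z _ => (h.hasFDerivAt z).hasFDerivWithinAt) (fun z hz => ?_)
    (by simpa using hy) (by simpa using hx)
  have hz' : ‖z‖ ≤ 3 * R := by simpa using hz
  have h1 := hL z 0 hz' (by simpa using by positivity)
  rw [sub_zero] at h1
  have h2 := norm_add_le (dJ z - dJ 0) (dJ 0)
  rw [sub_add_cancel] at h2
  have h3 := mul_le_mul_of_nonneg_left hz' hL0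
  linarith

/-- The minimizer depends continuously on the centre. -/
theorem continuousOn_of_isMin (h : ConvexOnBall V J dJ R α) {T : H → H}
    (hT : ∀ p, ‖p‖ ≤ R → IsMin V J R p (T p)) : ContinuousOn T (Metric.closedBall 0 R) := by
  obtain ⟨K, hK0, hK⟩ := h.exists_lipschitz
  have hα := h.pos
  -- Translating the minimizer for one centre by the difference of the centres gives a competitor
  -- for the other. Quadratic growth against the Lipschitz bound of `J` makes the displacement `T p
  -- - p` Hölder continuous with exponent one half.
  have est : ∀ p p', ‖p‖ ≤ R → ‖p'‖ ≤ R →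
      α / 2 * ‖(T p' - p') - (T p - p)‖ ^ 2 ≤ 2 * (K * ‖p' - p‖) := by
    intro p p' hp hp'
    have hm := hT p hp
    have hm' := hT p' hp'
    have g1 : p + (T p' - p') - p = T p' - p' := by abel
    have g2 : p' + (T p - p) - p' = T p - p := by abel
    have h1 := h.isMin_gap (q := p + (T p' - p')) hp hm (by rw [g1]; exact hm'.1)
      (by rw [g1]; exact hm'.2.1)
    have h2 := hm'.2.2 (p' + (T p - p)) (by rw [g2]; exact hm.1) (by rw [g2]; exact hm.2.1)
    have h3 := hK (p + (T p' - p')) (T p') (norm_le_of_sub hp (by rw [g1]; exact hm'.2.1))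
      (norm_le_of_sub hp' hm'.2.1)
    have h4 := hK (p' + (T p - p)) (T p) (norm_le_of_sub hp' (by rw [g2]; exact hm.2.1))
      (norm_le_of_sub hp hm.2.1)
    have e1 : p + (T p' - p') - T p' = -(p' - p) := by abel
    have e2 : p' + (T p - p) - T p = p' - p := by abel
    have e3 : p + (T p' - p') - T p = (T p' - p') - (T p - p) := by abel
    rw [e1, norm_neg] at h3
    rw [e2] at h4
    rw [e3] at h1
    have := le_abs_self (J (p + (T p' - p')) - J (T p'))
    have := le_abs_self (J (p' + (T p - p)) - J (T p))
    linarith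
  intro p hp
  have hp' : ‖p‖ ≤ R := by simpa using hp
  have h1 : ContinuousWithinAt (fun p => T p - p) (Metric.closedBall 0 R) p := by
    rw [Metric.continuousWithinAt_iff]
    intro δ hδ
    refine ⟨α / 4 * δ ^ 2 / (K + 1), by positivity, fun {q} hq hd => ?_⟩
    have hq' : ‖q‖ ≤ R := by simpa using hq
    have h1 := est p q hp' hq'
    rw [dist_eq_norm] at hd ⊢
    have h2 : K * ‖q - p‖ ≤ (K + 1) * ‖q - p‖ :=
      mul_le_mul_of_nonneg_right (by linarith) (norm_nonneg _)
    have h3 : (K + 1) * ‖q - p‖ < α / 4 * δ ^ 2 := by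
      rw [lt_div_iff₀ (by positivity)] at hd; linarith
    have h4 : α / 2 * ‖(T q - q) - (T p - p)‖ ^ 2 < α / 2 * δ ^ 2 := by linarith
    exact lt_of_pow_lt_pow_left₀ 2 hδ.le (lt_of_mul_lt_mul_left h4 (by positivity))
  have := h1.add continuousWithinAt_id
  refine this.congr (fun q _ => ?_) ?_ <;> simp

/-- The gradient of `J` along `V`. -/
noncomputable def grad (V : Submodule ℝ H) [CompleteSpace V] (dJ : H → H →L[ℝ] ℝ) (x : H) : V :=
  (InnerProductSpace.toDual ℝ V).symm ((dJ x).comp V.subtypeL)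

theorem inner_grad [CompleteSpace V] (x : H) (v : V) :
    inner ℝ (grad V dJ x : H) (v : H) = dJ x v := by
  have : inner ℝ (grad V dJ x) v = dJ x v := by
    rw [grad, InnerProductSpace.toDual_symm_apply]; rfl
  exact this

theorem norm_grad_sub_le [CompleteSpace V] (x y : H) :
    ‖grad V dJ x - grad V dJ y‖ ≤ ‖dJ x - dJ y‖ := by
  rw [grad, grad, ← map_sub, LinearIsometryEquiv.norm_map, ← ContinuousLinearMap.sub_comp]
  refine (ContinuousLinearMap.opNorm_comp_le _ _).trans ?_
  exact mul_le_of_le_one_right (norm_nonneg _) (Submodule.norm_subtypeL_le V)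

theorem continuous_grad [CompleteSpace V] (h : ConvexOnBall V J dJ R α) :
    Continuous (grad V dJ) := by
  rw [continuous_iff_continuousAt]
  intro x
  obtain ⟨L, hL0, hL⟩ := h.lip (‖x‖ + 1)
  rw [Metric.continuousAt_iff]
  intro δ hδ
  refine ⟨min 1 (δ / (L + 1)), by positivity, fun {y} hy => ?_⟩
  rw [dist_eq_norm] at hy ⊢
  have hy1 : ‖y‖ ≤ ‖x‖ + 1 := by
    have := norm_add_le (y - x) x
    rw [sub_add_cancel] at this
    have := hy.trans_le (min_le_left _ _)
    linarith
  have h1 := (norm_grad_sub_le (V := V) y x).trans (hL y x hy1 (by linarith))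
  have h2 := hy.trans_le (min_le_right _ _)
  rw [lt_div_iff₀ (by positivity)] at h2
  nlinarith [norm_nonneg (y - x)]

theorem exists_norm_grad_le [CompleteSpace V] (h : ConvexOnBall V J dJ R α) (ρ : ℝ) :
    ∃ K, ∀ x, ‖x‖ ≤ ρ → ‖grad V dJ x‖ ≤ K := by
  obtain ⟨L, hL0, hL⟩ := h.lip (max ρ 0)
  refine ⟨L * max ρ 0 + ‖grad V dJ 0‖, fun x hx => ?_⟩
  have hx' := hx.trans (le_max_left ρ 0)
  have h1 := (norm_grad_sub_le (V := V) x 0).trans (hL x 0 hx' (by simp))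
  have h2 := norm_add_le (grad V dJ x - grad V dJ 0) (grad V dJ 0)
  rw [sub_add_cancel] at h2
  rw [sub_zero] at h1
  have := mul_le_mul_of_nonneg_left hx' hL0
  linarith

/-- Uniqueness of the Fréchet derivative and of its Riesz representative: the gradient exists at
every point, and the descent is the iteration of a map. -/
theorem isGradient_iff [CompleteSpace V] (h : ConvexOnBall V J dJ R α) (x : H) (g : V) :
    HasFDerivAt (fun v : V => J (x + (v : H))) ((innerSL ℝ (g : H)).comp V.subtypeL) 0 ↔
      g = grad V dJ x := by
  have hd : HasFDerivAt (fun v : V => J (x + (v : H))) ((dJ x).comp V.subtypeL) 0 := by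
    have h1 : HasFDerivAt (fun v : V => x + (v : H)) V.subtypeL 0 :=
      V.subtypeL.hasFDerivAt.const_add x
    have h2 : HasFDerivAt J (dJ x) (x + ((0 : V) : H)) := by simpa using h.hasFDerivAt x
    exact h2.comp (0 : V) h1
  have key : ∀ g : V, (innerSL ℝ (g : H)).comp V.subtypeL = (dJ x).comp V.subtypeL ↔
      g = grad V dJ x := by
    intro g
    constructor
    · intro he
      refine ext_inner_right ℝ fun v => ?_
      have h1 := congrArg (fun T : V →L[ℝ] ℝ => T v) he
      have h2 := inner_grad (dJ := dJ) x v
      simp only [ContinuousLinearMap.comp_apply, Submodule.subtypeL_apply, innerSL_apply_apply] at h1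
      rw [Submodule.coe_inner, Submodule.coe_inner, h1, h2]
    · rintro rfl
      ext v
      simp only [ContinuousLinearMap.comp_apply, Submodule.subtypeL_apply, innerSL_apply_apply]
      exact inner_grad x v
  rw [← key]
  exact ⟨fun h1 => h1.unique hd, fun h1 => h1 ▸ hd⟩

/-- If the norm constraint is not active, all small directions in `V` are admissible, and Fermat's
rule applies on `V`. -/
theorem grad_eq_zero_of_isMin [CompleteSpace V] (h : ConvexOnBall V J dJ R α) {p m : H}
    (hm : IsMin V J R p m) (hlt : ‖m - p‖ < 2 * R) : grad V dJ m = 0 := by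
  have hd := (h.isGradient_iff m (grad V dJ m)).2 rfl
  have hmin : IsLocalMin (fun v : V => J (m + (v : H))) 0 := by
    have : ∀ᶠ v : V in nhds 0, ‖v‖ < 2 * R - ‖m - p‖ := by
      have := continuous_norm.tendsto (0 : V)
      rw [norm_zero] at this
      exact this.eventually (gt_mem_nhds (by linarith))
    filter_upwards [this] with v hv
    simp only [ZeroMemClass.coe_zero, add_zero]
    have e : m + (v : H) - p = (m - p) + v := by abel
    refine hm.2.2 _ (by rw [e]; exact V.add_mem hm.1 v.2) ?_
    rw [e]
    have h1 := norm_add_le (m - p) (v : H)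
    have : ‖(v : H)‖ = ‖v‖ := rfl
    linarith
  have h0 := hmin.hasFDerivAt_eq_zero hd
  have h1 := congrArg (fun T : V →L[ℝ] ℝ => T (grad V dJ m)) h0
  simp only [ContinuousLinearMap.comp_apply, Submodule.subtypeL_apply, innerSL_apply_apply,
    zero_apply, inner_self_eq_zero] at h1
  exact_mod_cast h1

/-- One step of the gradient descent is a contraction towards the minimizer. -/
theorem norm_step_le [CompleteSpace V] (h : ConvexOnBall V J dJ R α) {L γ : ℝ} (hγ : 0 ≤ γ)
    (hL : ∀ x y, ‖x‖ ≤ 3 * R → ‖y‖ ≤ 3 * R → ‖dJ x - dJ y‖ ≤ L * ‖x - y‖)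
    (hγL : γ * L ^ 2 ≤ α) {m x : H} (hm : ‖m‖ ≤ 3 * R) (hx : ‖x‖ ≤ 3 * R) (hxm : x - m ∈ V)
    (hg : grad V dJ m = 0) :
    ‖x - γ • (grad V dJ x : H) - m‖ ^ 2 ≤ (1 - α * γ) * ‖x - m‖ ^ 2 := by
  have c1 := h.convex m x hm hx hxm
  have c2 := h.convex x m hx hm (by rw [← neg_sub]; exact V.neg_mem hxm)
  have e1 : dJ m (x - m) = 0 := by
    have := inner_grad (dJ := dJ) m ⟨x - m, hxm⟩
    rw [hg] at this
    simpa using this.symm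
  have e2 : inner ℝ (grad V dJ x : H) (x - m) = dJ x (x - m) := inner_grad x ⟨x - m, hxm⟩
  have e3 : dJ x (m - x) = -inner ℝ (grad V dJ x : H) (x - m) := by
    rw [e2, ← map_neg, neg_sub]
  rw [e1] at c1
  rw [e3, norm_sub_rev m x] at c2
  have hn : ‖(grad V dJ x : H)‖ ≤ L * ‖x - m‖ := by
    have := (norm_grad_sub_le (V := V) x m).trans (hL x m hx hm)
    rwa [hg, sub_zero] at this
  have hn2 : ‖(grad V dJ x : H)‖ ^ 2 ≤ L ^ 2 * ‖x - m‖ ^ 2 := by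
    rw [← mul_pow]; exact pow_le_pow_left₀ (norm_nonneg _) hn 2
  have e4 : x - γ • (grad V dJ x : H) - m = (x - m) - γ • (grad V dJ x : H) := by abel
  rw [e4, norm_sub_sq_real, inner_smul_right, real_inner_comm, norm_smul, mul_pow, Real.norm_eq_abs,
    sq_abs]
  have s1 : γ ^ 2 * ‖(grad V dJ x : H)‖ ^ 2 ≤ γ ^ 2 * (L ^ 2 * ‖x - m‖ ^ 2) :=
    mul_le_mul_of_nonneg_left hn2 (sq_nonneg _)
  have s2 : γ * L ^ 2 * (γ * ‖x - m‖ ^ 2) ≤ α * (γ * ‖x - m‖ ^ 2) :=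
    mul_le_mul_of_nonneg_right hγL (by positivity)
  -- Adding the convexity inequalities from `m` to `x` and from `x` to `m` gives strong monotonicity
  -- of the gradient. It contributes `-4αγ` to the squared distance, against `γ²L² ≤ αγ` from the
  -- squared step.
  have s3 : 2 * α * ‖x - m‖ ^ 2 ≤ inner ℝ (grad V dJ x : H) (x - m) := by linarith
  have s4 := mul_le_mul_of_nonneg_left s3 hγ
  have s5 : 0 ≤ α * (γ * ‖x - m‖ ^ 2) := by have := h.pos; positivity
  nlinarith

end ConvexOnBall

end EIT


namespace EIT

/-! ### Squared norms of quadratic maps -/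

section Quadratic

variable {H Y : Type*} [NormedAddCommGroup H] [InnerProductSpace ℝ H]
  [NormedAddCommGroup Y] [InnerProductSpace ℝ Y]

/-- The quadratic map `x ↦ S x + B x x`. -/
noncomputable def quadMap (S : H →L[ℝ] Y) (B : H →L[ℝ] H →L[ℝ] Y) (x : H) : Y := S x + B x x

/-- The derivative of `quadMap`. -/
noncomputable def quadDeriv (S : H →L[ℝ] Y) (B : H →L[ℝ] H →L[ℝ] Y) (x : H) : H →L[ℝ] Y :=
  S + (B x + B.flip x)

/-- The derivative of the squared norm of `quadMap`. -/
noncomputable def quadSqDeriv (S : H →L[ℝ] Y) (B : H →L[ℝ] H →L[ℝ] Y) (x : H) : H →L[ℝ] ℝ :=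
  (2 : ℝ) • (innerSL ℝ (quadMap S B x)).comp (quadDeriv S B x)

variable (S : H →L[ℝ] Y) (B : H →L[ℝ] H →L[ℝ] Y)

theorem hasFDerivAt_quadMap (x : H) : HasFDerivAt (quadMap S B) (quadDeriv S B x) x := by
  have h1 : HasFDerivAt (fun x => B x x) (B x + B.flip x) x := by
    have := (B.hasFDerivAt (x := x)).clm_apply (hasFDerivAt_id x)
    simpa using! this
  exact S.hasFDerivAt.add h1

theorem hasFDerivAt_quadSq (x : H) :
    HasFDerivAt (fun x => ‖quadMap S B x‖ ^ 2) (quadSqDeriv S B x) x := by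
  convert (hasFDerivAt_quadMap S B x).norm_sq using 1
  ext v
  simp [quadSqDeriv]

/-- Since `q(y) = q(x) + q'(x)h + B(h, h)` exactly, with `h = y - x`, the whole remainder is a
square plus a term in which `q(x)` is paired with `B(h, h)`. Only the latter can be negative. -/
theorem quadSq_sub (x y : H) :
    ‖quadMap S B y‖ ^ 2 - ‖quadMap S B x‖ ^ 2 - quadSqDeriv S B x (y - x) =
      ‖quadMap S B y - quadMap S B x‖ ^ 2 +
        2 * inner ℝ (quadMap S B x) (B (y - x) (y - x)) := by
  have e : quadMap S B y = quadMap S B x + quadDeriv S B x (y - x) + B (y - x) (y - x) := by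
    simp [quadMap, quadDeriv]
    abel
  have e1 : quadSqDeriv S B x (y - x) =
      2 * inner ℝ (quadMap S B x) (quadDeriv S B x (y - x)) := by simp [quadSqDeriv]
  rw [e1, norm_sub_sq_real, real_inner_comm (quadMap S B x) (quadMap S B y)]
  have e2 : inner ℝ (quadMap S B x) (quadMap S B y) = ‖quadMap S B x‖ ^ 2 +
      inner ℝ (quadMap S B x) (quadDeriv S B x (y - x)) +
      inner ℝ (quadMap S B x) (B (y - x) (y - x)) := by
    rw [e, inner_add_right, inner_add_right, real_inner_self_eq_norm_sq]
  rw [e2]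
  ring

theorem exists_lipschitz_quadSqDeriv (ρ : ℝ) : ∃ L, 0 ≤ L ∧ ∀ x y, ‖x‖ ≤ ρ → ‖y‖ ≤ ρ →
    ‖quadSqDeriv S B x - quadSqDeriv S B y‖ ≤ L * ‖x - y‖ := by
  rcases lt_or_ge ρ 0 with hρ | hρ
  · exact ⟨0, le_rfl, fun x _ hx _ => absurd (hx.trans_lt hρ) (not_lt.2 (norm_nonneg x))⟩
  set k := ‖S‖ + 2 * ‖B‖ * ρ with hk
  have hk0 : 0 ≤ k := by positivity
  have hd : ∀ x, ‖x‖ ≤ ρ → ‖quadDeriv S B x‖ ≤ k := by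
    intro x hx
    have h1 := norm_add_le S (B x + B.flip x)
    have h2 := norm_add_le (B x) (B.flip x)
    have h3 := B.le_opNorm x
    have h4 := B.flip.le_opNorm x
    rw [ContinuousLinearMap.opNorm_flip] at h4
    have h5 := mul_le_mul_of_nonneg_left hx (norm_nonneg B)
    rw [quadDeriv]
    linarith
  have hdd : ∀ x y, ‖quadDeriv S B x - quadDeriv S B y‖ ≤ 2 * ‖B‖ * ‖x - y‖ := by
    intro x y
    have e : quadDeriv S B x - quadDeriv S B y = B (x - y) + B.flip (x - y) := by
      simp only [quadDeriv, map_sub]; abel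
    rw [e]
    have h2 := norm_add_le (B (x - y)) (B.flip (x - y))
    have h3 := B.le_opNorm (x - y)
    have h4 := B.flip.le_opNorm (x - y)
    rw [ContinuousLinearMap.opNorm_flip] at h4
    linarith
  have hm : ∀ x y, ‖x‖ ≤ ρ → ‖y‖ ≤ ρ → ‖quadMap S B x - quadMap S B y‖ ≤ k * ‖x - y‖ :=
    fun x y hx hy => (convex_closedBall (0 : H) ρ).norm_image_sub_le_of_norm_hasFDerivWithin_le
      (f' := quadDeriv S B) (fun z _ => (hasFDerivAt_quadMap S B z).hasFDerivWithinAt)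
      (fun z hz => hd z (by simpa using hz)) (by simpa using hy) (by simpa using hx)
  have hm0 : ∀ x, ‖x‖ ≤ ρ → ‖quadMap S B x‖ ≤ k * ρ := by
    intro x hx
    have h1 := hm x 0 hx (by simpa using hρ)
    have e : quadMap S B 0 = 0 := by simp [quadMap]
    rw [e, sub_zero, sub_zero] at h1
    exact h1.trans (mul_le_mul_of_nonneg_left hx hk0)
  refine ⟨2 * (k * k + k * ρ * (2 * ‖B‖)), by positivity, fun x y hx hy => ?_⟩
  have e : quadSqDeriv S B x - quadSqDeriv S B y = (2 : ℝ) •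
      ((innerSL ℝ (quadMap S B x - quadMap S B y)).comp (quadDeriv S B x) +
        (innerSL ℝ (quadMap S B y)).comp (quadDeriv S B x - quadDeriv S B y)) := by
    ext v
    simp [quadSqDeriv]
    ring
  rw [e, norm_smul]
  have h1 := norm_add_le ((innerSL ℝ (quadMap S B x - quadMap S B y)).comp (quadDeriv S B x))
    ((innerSL ℝ (quadMap S B y)).comp (quadDeriv S B x - quadDeriv S B y))
  have h2 := ContinuousLinearMap.opNorm_comp_le (innerSL ℝ (quadMap S B x - quadMap S B y))
    (quadDeriv S B x)
  have h3 := ContinuousLinearMap.opNorm_comp_le (innerSL ℝ (quadMap S B y))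
    (quadDeriv S B x - quadDeriv S B y)
  rw [innerSL_apply_norm] at h2 h3
  have h4 : ‖quadMap S B x - quadMap S B y‖ * ‖quadDeriv S B x‖ ≤ k * ‖x - y‖ * k :=
    mul_le_mul (hm x y hx hy) (hd x hx) (norm_nonneg _) (by positivity)
  have h5 : ‖quadMap S B y‖ * ‖quadDeriv S B x - quadDeriv S B y‖ ≤
      k * ρ * (2 * ‖B‖ * ‖x - y‖) :=
    mul_le_mul (hm0 y hy) (hdd x y) (norm_nonneg _) (by positivity)
  rw [Real.norm_of_nonneg zero_le_two]
  linarith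

/-- A sum of two squared norms of quadratic maps, regularized, with its derivative. -/
theorem ConvexOnBall.of_quadratic {V : Submodule ℝ H} {S₁ S₂ : H →L[ℝ] Y}
    {B : H →L[ℝ] H →L[ℝ] Y} {J : H → ℝ} {s R α : ℝ} (hs : 0 ≤ s) (hα : 0 < α) (hR : 0 < R)
    (hJ : ∀ x, J x = s * (‖quadMap S₁ B x‖ ^ 2 + ‖quadMap S₂ B x‖ ^ 2) + α * ‖x‖ ^ 2)
    (hconv : ∀ x y, ‖x‖ ≤ 3 * R → ‖y‖ ≤ 3 * R → y - x ∈ V →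
      0 ≤ (‖quadMap S₁ B y - quadMap S₁ B x‖ ^ 2 +
        2 * inner ℝ (quadMap S₁ B x) (B (y - x) (y - x))) +
        (‖quadMap S₂ B y - quadMap S₂ B x‖ ^ 2 +
        2 * inner ℝ (quadMap S₂ B x) (B (y - x) (y - x)))) :
    ConvexOnBall V J (fun x => s • (quadSqDeriv S₁ B x + quadSqDeriv S₂ B x) +
      (2 * α) • innerSL ℝ x) R α where
  nonneg x := by rw [hJ]; positivity
  hasFDerivAt x := by
    rw [funext hJ]
    have h3 : HasFDerivAt (fun x : H => ‖x‖ ^ 2) ((2 : ℝ) • innerSL ℝ x) x := by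
      refine (hasStrictFDerivAt_norm_sq x).hasFDerivAt.congr_fderiv ?_
      ext v
      simp [two_smul]
    have := (((hasFDerivAt_quadSq S₁ B x).add (hasFDerivAt_quadSq S₂ B x)).const_mul s).add
      (h3.const_mul α)
    rw [smul_smul, mul_comm α 2] at this
    exact this
  lip ρ := by
    obtain ⟨L₁, h₁, hL₁⟩ := exists_lipschitz_quadSqDeriv S₁ B ρ
    obtain ⟨L₂, h₂, hL₂⟩ := exists_lipschitz_quadSqDeriv S₂ B ρ
    refine ⟨s * (L₁ + L₂) + 2 * α, by positivity, fun x y hx hy => ?_⟩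
    have e : s • (quadSqDeriv S₁ B x + quadSqDeriv S₂ B x) + (2 * α) • innerSL ℝ x -
        (s • (quadSqDeriv S₁ B y + quadSqDeriv S₂ B y) + (2 * α) • innerSL ℝ y) =
        s • ((quadSqDeriv S₁ B x - quadSqDeriv S₁ B y) +
          (quadSqDeriv S₂ B x - quadSqDeriv S₂ B y)) + (2 * α) • innerSL ℝ (x - y) := by
      rw [map_sub]; module
    rw [e]
    refine (norm_add_le _ _).trans ?_
    rw [norm_smul, norm_smul, innerSL_apply_norm, Real.norm_of_nonneg hs,
      Real.norm_of_nonneg (by positivity)]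
    have h3 := (norm_add_le (quadSqDeriv S₁ B x - quadSqDeriv S₁ B y)
      (quadSqDeriv S₂ B x - quadSqDeriv S₂ B y)).trans
      (add_le_add (hL₁ x y hx hy) (hL₂ x y hx hy))
    have h4 := mul_le_mul_of_nonneg_left h3 hs
    linarith
  pos := hα
  radius_pos := hR
  convex x y hx hy hxy := by
    have h1 := mul_nonneg hs (hconv x y hx hy hxy)
    rw [← quadSq_sub, ← quadSq_sub] at h1
    have h2 : ‖y‖ ^ 2 = ‖x‖ ^ 2 + 2 * inner ℝ x (y - x) + ‖y - x‖ ^ 2 := by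
      have := norm_add_sq_real x (y - x)
      rwa [add_sub_cancel] at this
    rw [hJ, hJ, h2]
    simp only [add_apply, smul_apply, smul_eq_mul,
      innerSL_apply_apply]
    linarith

end Quadratic

/-! ### The operators as bounded maps -/

section Operators

variable {a b c₁ c₂ : ℝ}

/-- First derivatives are bounded functions, so products of gradients can be formed in `L²` by
Hölder's inequality with exponents `∞` and `2`. -/
theorem exists_supMap (h₁ : 0 < c₁) (h₂ : 0 < c₂) {i j : ℕ} (hij : i + j ≤ 1) :
    ∃ T : H3 (rect a b c₁ c₂) →L[ℝ] Lp ℝ ∞ (volume.restrict (rect a b c₁ c₂)),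
      ∀ u, T u =ᵐ[volume.restrict (rect a b c₁ c₂)] der u i j := by
  obtain ⟨C, hC0, hC⟩ := exists_sup_bound (a := a) (b := b) h₁ h₂
  have hmem : ∀ u : H3 (rect a b c₁ c₂),
      MemLp (der u i j) ∞ (volume.restrict (rect a b c₁ c₂)) := fun u =>
    memLp_top_of_bound (Lp.aestronglyMeasurable _) (C * ‖u‖) (hC u i j hij)
  refine ⟨LinearMap.mkContinuous
    { toFun := fun u => (hmem u).toLp
      map_add' := fun u v => ?_
      map_smul' := fun c u => ?_ } C (fun u => ?_), fun u => ?_⟩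
  · rw [← MemLp.toLp_add]
    apply MemLp.toLp_congr
    rw [der_add]
    exact Lp.coeFn_add _ _
  · rw [RingHom.id_apply, ← MemLp.toLp_const_smul]
    apply MemLp.toLp_congr
    rw [der_smul]
    exact Lp.coeFn_smul _ _
  · refine (Lp.norm_le_of_ae_bound (C := C * ‖u‖) (by positivity) ?_).trans_eq ?_
    · filter_upwards [(hmem u).coeFn_toLp, hC u i j hij] with z h1 h2
      exact (congrArg norm h1).trans_le h2
    · simp
  · exact (hmem u).coeFn_toLp

end Operators

end EIT


/-! ### The weighted operators as quadratic maps into `L²` -/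

namespace EIT

section Operators

variable {a b c₁ c₂ : ℝ}

/-- The bilinear map `(u, v) ↦ ∇u · ∇v`. -/
theorem exists_gradMul (h₁ : 0 < c₁) (h₂ : 0 < c₂) :
    ∃ G : H3 (rect a b c₁ c₂) →L[ℝ] H3 (rect a b c₁ c₂) →L[ℝ] L2 (rect a b c₁ c₂),
      ∀ u v, G u v =ᵐ[volume.restrict (rect a b c₁ c₂)]
        fun z => dx u z * dx v z + dy u z * dy v z := by
  obtain ⟨X, hX⟩ := exists_supMap (a := a) (b := b) h₁ h₂ (i := 1) (j := 0) (by norm_num)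
  obtain ⟨Y, hY⟩ := exists_supMap (a := a) (b := b) h₁ h₂ (i := 0) (j := 1) (by norm_num)
  let m := (ContinuousLinearMap.mul ℝ ℝ).holderL (volume.restrict (rect a b c₁ c₂)) ∞ 2 2
  refine ⟨m.bilinearComp X (derL _ 1 0) + m.bilinearComp Y (derL _ 0 1), fun u v => ?_⟩
  have e : (m.bilinearComp X (derL _ 1 0) + m.bilinearComp Y (derL _ 0 1)) u v =
      (ContinuousLinearMap.mul ℝ ℝ).holder 2 (X u) (der v 1 0) +
        (ContinuousLinearMap.mul ℝ ℝ).holder 2 (Y u) (der v 0 1) := rfl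
  rw [e]
  filter_upwards [Lp.coeFn_add ((ContinuousLinearMap.mul ℝ ℝ).holder 2 (X u) (der v 1 0))
      ((ContinuousLinearMap.mul ℝ ℝ).holder 2 (Y u) (der v 0 1)),
    (ContinuousLinearMap.mul ℝ ℝ).coeFn_holder (r := 2) (X u) (der v 1 0),
    (ContinuousLinearMap.mul ℝ ℝ).coeFn_holder (r := 2) (Y u) (der v 0 1), hX u, hY u]
    with z h1 h2 h3 h4 h5
  rw [h1, Pi.add_apply, h2, h3, h4, h5]
  rfl

/-- The Laplacian from `H³` to `L²`. -/
noncomputable def lapL (Ω : Set (ℝ × ℝ)) : H3 Ω →L[ℝ] L2 Ω := derL Ω 2 0 + derL Ω 0 2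

theorem coeFn_lapL {Ω : Set (ℝ × ℝ)} (u : H3 Ω) :
    lapL Ω u =ᵐ[volume.restrict Ω] fun z => dxx u z + dyy u z :=
  Lp.coeFn_add (der u 2 0) (der u 0 2)

theorem exists_exp_le (lam : ℝ) : ∃ E, 0 ≤ E ∧ ∀ z ∈ rect a b c₁ c₂,
    Real.exp (lam * z.1 ^ 2) ≤ E := by
  refine ⟨Real.exp (|lam| * (|a| + c₁) ^ 2), (Real.exp_pos _).le, fun z hz => ?_⟩
  have h1 : |z.1| ≤ |a| + c₁ := by
    have := abs_add_le (z.1 - a) a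
    rw [sub_add_cancel] at this
    linarith [hz.1]
  refine Real.exp_le_exp.2 (mul_le_mul (le_abs_self _) ?_ (sq_nonneg _) (abs_nonneg _))
  rw [← sq_abs z.1]
  exact pow_le_pow_left₀ (abs_nonneg _) h1 2

/-- Multiplication by the Carleman weight. -/
theorem exists_weightMap (lam : ℝ) :
    ∃ W : L2 (rect a b c₁ c₂) →L[ℝ] L2 (rect a b c₁ c₂),
      ∀ f, W f =ᵐ[volume.restrict (rect a b c₁ c₂)]
        fun z => f z * Real.exp (lam * z.1 ^ 2) := by
  obtain ⟨E, hE0, hE⟩ := exists_exp_le (a := a) (b := b) (c₁ := c₁) (c₂ := c₂) lam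
  have hc : Continuous fun z : ℝ × ℝ => Real.exp (lam * z.1 ^ 2) := by fun_prop
  have hm : MemLp (fun z : ℝ × ℝ => Real.exp (lam * z.1 ^ 2)) ∞
      (volume.restrict (rect a b c₁ c₂)) := by
    refine memLp_top_of_bound hc.aestronglyMeasurable E ?_
    refine (ae_restrict_iff' isOpen_rect.measurableSet).2 (Filter.Eventually.of_forall fun z hz => ?_)
    rw [Real.norm_of_nonneg (Real.exp_pos _).le]
    exact hE z hz
  refine ⟨(ContinuousLinearMap.mul ℝ ℝ).holderL (volume.restrict (rect a b c₁ c₂)) ∞ 2 2 hm.toLp,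
    fun f => ?_⟩
  filter_upwards [(ContinuousLinearMap.mul ℝ ℝ).coeFn_holder (r := 2) hm.toLp f, hm.coeFn_toLp]
    with z h1 h2
  refine h1.trans ?_
  rw [h2, ContinuousLinearMap.mul_apply', mul_comm]

/-- The bilinear form whose diagonal is `nonlin`. -/
noncomputable def bilin {Ω : Set (ℝ × ℝ)} (ε : ℝ) (x y : Pair Ω) (z : ℝ × ℝ) : ℝ :=
  2 * (dx x.fst z * ((dx y.fst z - dx y.snd z) / ε) +
    dy x.fst z * ((dy y.fst z - dy y.snd z) / ε))

theorem ae_dx_sub {Ω : Set (ℝ × ℝ)} (u v : H3 Ω) : ∀ᵐ z ∂(volume.restrict Ω),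
    dx (u - v) z = dx u z - dx v z ∧ dy (u - v) z = dy u z - dy v z ∧
      dxx (u - v) z = dxx u z - dxx v z ∧ dyy (u - v) z = dyy u z - dyy v z := by
  filter_upwards [Lp.coeFn_sub (der u 1 0) (der v 1 0), Lp.coeFn_sub (der u 0 1) (der v 0 1),
    Lp.coeFn_sub (der u 2 0) (der v 2 0), Lp.coeFn_sub (der u 0 2) (der v 0 2)] with z h1 h2 h3 h4
  rw [← der_sub] at h1 h2 h3 h4
  exact ⟨h1, h2, h3, h4⟩

/-- The operators `L₁`, `L₂` multiplied by the Carleman weight, as quadratic maps into `L²`. -/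
theorem exists_operators (h₁ : 0 < c₁) (h₂ : 0 < c₂) (ε lam : ℝ) :
    ∃ (S : H3 (rect a b c₁ c₂) →L[ℝ] L2 (rect a b c₁ c₂))
      (B : Pair (rect a b c₁ c₂) →L[ℝ] Pair (rect a b c₁ c₂) →L[ℝ] L2 (rect a b c₁ c₂)),
      (∀ u, S u =ᵐ[volume.restrict (rect a b c₁ c₂)]
        fun z => (dxx u z + dyy u z) * Real.exp (lam * z.1 ^ 2)) ∧
      ∀ x y, B x y =ᵐ[volume.restrict (rect a b c₁ c₂)]
        fun z => bilin ε x y z * Real.exp (lam * z.1 ^ 2) := by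
  obtain ⟨G, hG⟩ := exists_gradMul (a := a) (b := b) h₁ h₂
  obtain ⟨W, hW⟩ := exists_weightMap (a := a) (b := b) (c₁ := c₁) (c₂ := c₂) lam
  let p₁ := WithLp.fstL 2 ℝ (H3 (rect a b c₁ c₂)) (H3 (rect a b c₁ c₂))
  let p₂ := WithLp.sndL 2 ℝ (H3 (rect a b c₁ c₂)) (H3 (rect a b c₁ c₂))
  refine ⟨W.comp (lapL _), (ContinuousLinearMap.compL ℝ _ _ _ W).comp
    ((2 / ε) • G.bilinearComp p₁ (p₁ - p₂)), fun u => ?_, fun x y => ?_⟩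
  · filter_upwards [hW (lapL _ u), coeFn_lapL u] with z h1 h2
    refine h1.trans ?_
    rw [h2]
  · have e : (ContinuousLinearMap.compL ℝ _ _ _ W).comp
        ((2 / ε) • G.bilinearComp p₁ (p₁ - p₂)) x y = W ((2 / ε) • G x.fst (y.fst - y.snd)) := rfl
    rw [e]
    filter_upwards [hW ((2 / ε) • G x.fst (y.fst - y.snd)), Lp.coeFn_smul (2 / ε)
      (G x.fst (y.fst - y.snd)), hG x.fst (y.fst - y.snd), ae_dx_sub y.fst y.snd]
      with z h1 h2 h3 h4
    rw [h1, h2, Pi.smul_apply, h3, h4.1, h4.2.1, smul_eq_mul, bilin]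
    ring

end Operators

end EIT


/-! ### Strong convexity of the functional -/

namespace EIT

section Convexity

variable {a b c₁ c₂ : ℝ}

/-- The pointwise lower bound for the remainder of one of the two squares. -/
theorem pointwise_lower {δ M d t x1 x2 x3 x4 y1 y2 y3 y4 : ℝ} (hδ : 0 ≤ δ)
    (hx1 : |x1| ≤ M) (hx2 : |x2| ≤ M) (hx3 : |x3| ≤ M) (hx4 : |x4| ≤ M)
    (hy1 : |y1| ≤ M) (hy2 : |y2| ≤ M) (hy3 : |y3| ≤ M) (hy4 : |y4| ≤ M) :
    1 / 2 * t ^ 2 - (192 * M ^ 2 * δ ^ 2 + 6 * δ * |d|) *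
        (((y1 - x1) ^ 2 + (y3 - x3) ^ 2) + ((y2 - x2) ^ 2 + (y4 - x4) ^ 2)) ≤
      (t + 2 * (y1 * ((y1 - y2) * δ) + y3 * ((y3 - y4) * δ)) -
        2 * (x1 * ((x1 - x2) * δ) + x3 * ((x3 - x4) * δ))) ^ 2 +
      2 * ((d + 2 * (x1 * ((x1 - x2) * δ) + x3 * ((x3 - x4) * δ))) *
        (2 * ((y1 - x1) * (((y1 - x1) - (y2 - x2)) * δ) +
          (y3 - x3) * (((y3 - x3) - (y4 - x4)) * δ)))) := by
  have hM : 0 ≤ M := (abs_nonneg _).trans hx1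
  set p1 := y1 - x1 with hp1
  set p2 := y2 - x2 with hp2
  set p3 := y3 - x3 with hp3
  set p4 := y4 - x4 with hp4
  set D := (p1 ^ 2 + p3 ^ 2) + (p2 ^ 2 + p4 ^ 2) with hD
  have hD0 : 0 ≤ D := by positivity
  set n := p1 * (p1 - p2) + p3 * (p3 - p4) with hn
  set m := x1 * (x1 - x2) + x3 * (x3 - x4) with hm
  set e := p1 * (y1 - y2) + x1 * (p1 - p2) + (p3 * (y3 - y4) + x3 * (p3 - p4)) with he
  have hnD : |n| ≤ 3 / 2 * D := by
    rw [abs_le]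
    rw [hn, hD]
    constructor <;> linarith [sq_nonneg (p1 - p2), sq_nonneg (p3 - p4), sq_nonneg (p1 + p2),
      sq_nonneg (p3 + p4), sq_nonneg p1, sq_nonneg p2, sq_nonneg p3, sq_nonneg p4]
  have hxx : ∀ s t : ℝ, |s| ≤ M → |t| ≤ M → |s - t| ≤ 2 * M := fun s t hs ht =>
    (abs_sub s t).trans (by linarith)
  have hmM : |m| ≤ 4 * M ^ 2 := by
    have k1 : |x1 * (x1 - x2)| ≤ M * (2 * M) := by
      rw [abs_mul]; exact mul_le_mul hx1 (hxx _ _ hx1 hx2) (abs_nonneg _) hM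
    have k2 : |x3 * (x3 - x4)| ≤ M * (2 * M) := by
      rw [abs_mul]; exact mul_le_mul hx3 (hxx _ _ hx3 hx4) (abs_nonneg _) hM
    have := abs_add_le (x1 * (x1 - x2)) (x3 * (x3 - x4))
    linarith
  have heM : |e| ≤ 3 * M * (|p1| + |p2| + |p3| + |p4|) := by
    have k1 : |p1 * (y1 - y2)| ≤ |p1| * (2 * M) := by
      rw [abs_mul]; exact mul_le_mul_of_nonneg_left (hxx _ _ hy1 hy2) (abs_nonneg _)
    have k2 : |x1 * (p1 - p2)| ≤ M * (|p1| + |p2|) := by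
      rw [abs_mul]; exact mul_le_mul hx1 (abs_sub _ _) (abs_nonneg _) hM
    have k3 : |p3 * (y3 - y4)| ≤ |p3| * (2 * M) := by
      rw [abs_mul]; exact mul_le_mul_of_nonneg_left (hxx _ _ hy3 hy4) (abs_nonneg _)
    have k4 : |x3 * (p3 - p4)| ≤ M * (|p3| + |p4|) := by
      rw [abs_mul]; exact mul_le_mul hx3 (abs_sub _ _) (abs_nonneg _) hM
    have := abs_add_le (p1 * (y1 - y2) + x1 * (p1 - p2)) (p3 * (y3 - y4) + x3 * (p3 - p4))
    have := abs_add_le (p1 * (y1 - y2)) (x1 * (p1 - p2))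
    have := abs_add_le (p3 * (y3 - y4)) (x3 * (p3 - p4))
    have := mul_nonneg hM (abs_nonneg p2)
    have := mul_nonneg hM (abs_nonneg p4)
    linarith
  have he2 : e ^ 2 ≤ 36 * M ^ 2 * D := by
    have h1 : e ^ 2 ≤ (3 * M * (|p1| + |p2| + |p3| + |p4|)) ^ 2 := by
      rw [← sq_abs e]; exact pow_le_pow_left₀ (abs_nonneg _) heM 2
    have h2 : (|p1| + |p2| + |p3| + |p4|) ^ 2 ≤ 4 * D := by
      rw [hD, ← sq_abs p1, ← sq_abs p2, ← sq_abs p3, ← sq_abs p4]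
      linarith [sq_nonneg (|p1| - |p2|), sq_nonneg (|p1| - |p3|), sq_nonneg (|p1| - |p4|),
        sq_nonneg (|p2| - |p3|), sq_nonneg (|p2| - |p4|), sq_nonneg (|p3| - |p4|)]
    rw [mul_pow] at h1
    linarith [mul_le_mul_of_nonneg_left h2 (sq_nonneg (3 * M))]
  have e1 : t + 2 * (y1 * ((y1 - y2) * δ) + y3 * ((y3 - y4) * δ)) -
      2 * (x1 * ((x1 - x2) * δ) + x3 * ((x3 - x4) * δ)) = t + 2 * δ * e := by
    rw [he, hp1, hp2, hp3, hp4]; ring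
  have e2 : 2 * ((d + 2 * (x1 * ((x1 - x2) * δ) + x3 * ((x3 - x4) * δ))) *
      (2 * (p1 * ((p1 - p2) * δ) + p3 * ((p3 - p4) * δ)))) =
      4 * δ * (d * n) + 8 * δ ^ 2 * (m * n) := by rw [hm, hn]; ring
  rw [e1, e2]
  have f1 : |d * n| ≤ |d| * (3 / 2 * D) := by
    rw [abs_mul]; exact mul_le_mul_of_nonneg_left hnD (abs_nonneg _)
  have f2 : |m * n| ≤ 4 * M ^ 2 * (3 / 2 * D) := by
    rw [abs_mul]; exact mul_le_mul hmM hnD (abs_nonneg _) (by positivity)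
  have g1 := mul_le_mul_of_nonneg_left ((neg_le_abs _).trans f1) (by positivity : 0 ≤ 4 * δ)
  have g2 := mul_le_mul_of_nonneg_left ((neg_le_abs _).trans f2) (by positivity : 0 ≤ 8 * δ ^ 2)
  have g3 := mul_le_mul_of_nonneg_left he2 (by positivity : 0 ≤ 4 * δ ^ 2)
  -- The square costs `4δ²e² ≤ 144M²δ²D`, and the pairing costs `8δ²|mn| ≤ 48M²δ²D` and `4δ|dn| ≤
  -- 6δ|d|D`; this explains `192` and `6`. The possibly unbounded `d`, a Laplacian, enters linearly.
  have g4 : 1 / 2 * t ^ 2 - 4 * δ ^ 2 * e ^ 2 ≤ (t + 2 * δ * e) ^ 2 := by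
    linarith [sq_nonneg (t + 4 * δ * e)]
  linarith

theorem integrable_weight (lam : ℝ) (h₁ : 0 < c₁) (h₂ : 0 < c₂) (u v : H3 (rect a b c₁ c₂)) :
    Integrable (fun z => (dx u z ^ 2 + dy u z ^ 2) * Real.exp (lam * z.1 ^ 2) ^ 2)
        (volume.restrict (rect a b c₁ c₂)) ∧
      Integrable (fun z => |dxx v z + dyy v z| *
        ((dx u z ^ 2 + dy u z ^ 2) * Real.exp (lam * z.1 ^ 2) ^ 2))
        (volume.restrict (rect a b c₁ c₂)) := by
  obtain ⟨E, hE0, hE⟩ := exists_exp_le (a := a) (b := b) (c₁ := c₁) (c₂ := c₂) lam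
  obtain ⟨C, hC0, hC⟩ := exists_sup_bound (a := a) (b := b) h₁ h₂
  have hmeas : AEStronglyMeasurable (fun z => (dx u z ^ 2 + dy u z ^ 2) *
      Real.exp (lam * z.1 ^ 2) ^ 2) (volume.restrict (rect a b c₁ c₂)) := by
    have hc : Continuous fun z : ℝ × ℝ => Real.exp (lam * z.1 ^ 2) ^ 2 := by fun_prop
    exact (((Lp.aestronglyMeasurable (dx u)).pow 2).add
      ((Lp.aestronglyMeasurable (dy u)).pow 2)).mul hc.aestronglyMeasurable
  have hbd : ∀ᵐ z ∂(volume.restrict (rect a b c₁ c₂)),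
      ‖(dx u z ^ 2 + dy u z ^ 2) * Real.exp (lam * z.1 ^ 2) ^ 2‖ ≤
        ((C * ‖u‖) ^ 2 + (C * ‖u‖) ^ 2) * E ^ 2 := by
    filter_upwards [hC u 1 0 (by norm_num), hC u 0 1 (by norm_num),
      ae_restrict_mem isOpen_rect.measurableSet] with z h1 h2 h3
    have k1 : dx u z ^ 2 ≤ (C * ‖u‖) ^ 2 := by
      rw [← sq_abs]; exact pow_le_pow_left₀ (abs_nonneg _) h1 2
    have k2 : dy u z ^ 2 ≤ (C * ‖u‖) ^ 2 := by
      rw [← sq_abs]; exact pow_le_pow_left₀ (abs_nonneg _) h2 2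
    rw [Real.norm_of_nonneg (by positivity)]
    exact mul_le_mul (add_le_add k1 k2)
      (pow_le_pow_left₀ (Real.exp_pos _).le (hE z h3) 2) (by positivity) (by positivity)
  refine ⟨Integrable.of_bound hmeas _ hbd, ?_⟩
  have hi : Integrable (fun z => |dxx v z + dyy v z|) (volume.restrict (rect a b c₁ c₂)) :=
    (((Lp.memLp (dxx v)).integrable (by norm_num)).add
      ((Lp.memLp (dyy v)).integrable (by norm_num))).abs
  exact hi.mul_bdd hmeas hbd

end Convexity

end EIT


namespace EIT

section Convexity

variable {a b c₁ c₂ : ℝ}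

/-- `pointwise_lower` multiplied by the squared weight and integrated. It is applied with `π` equal
to each of the two projections, which correspond to `L₁` and `L₂`. -/
theorem component_lower (h₁ : 0 < c₁) (h₂ : 0 < c₂) {M ε lam : ℝ} (hε : 0 < ε)
    {S : H3 (rect a b c₁ c₂) →L[ℝ] L2 (rect a b c₁ c₂)}
    {B : Pair (rect a b c₁ c₂) →L[ℝ] Pair (rect a b c₁ c₂) →L[ℝ] L2 (rect a b c₁ c₂)}
    (hS : ∀ u, S u =ᵐ[volume.restrict (rect a b c₁ c₂)]
      fun z => (dxx u z + dyy u z) * Real.exp (lam * z.1 ^ 2))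
    (hB : ∀ x y, B x y =ᵐ[volume.restrict (rect a b c₁ c₂)]
      fun z => bilin ε x y z * Real.exp (lam * z.1 ^ 2))
    (π : Pair (rect a b c₁ c₂) →L[ℝ] H3 (rect a b c₁ c₂)) {x y : Pair (rect a b c₁ c₂)}
    (hb : ∀ q ∈ ({x, y} : Set (Pair (rect a b c₁ c₂))),
      ∀ᵐ z ∂(volume.restrict (rect a b c₁ c₂)),
        (|dx q.fst z| ≤ M ∧ |dy q.fst z| ≤ M) ∧ (|dx q.snd z| ≤ M ∧ |dy q.snd z| ≤ M)) :
    1 / 2 * (∫ z in rect a b c₁ c₂, (dxx (π (y - x)) z + dyy (π (y - x)) z) ^ 2 *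
        Real.exp (lam * z.1 ^ 2) ^ 2) -
      (192 * M ^ 2 * ε⁻¹ ^ 2 * ((∫ z in rect a b c₁ c₂, (dx (y - x).fst z ^ 2 +
          dy (y - x).fst z ^ 2) * Real.exp (lam * z.1 ^ 2) ^ 2) +
        ∫ z in rect a b c₁ c₂, (dx (y - x).snd z ^ 2 +
          dy (y - x).snd z ^ 2) * Real.exp (lam * z.1 ^ 2) ^ 2) +
      6 * ε⁻¹ * ((∫ z in rect a b c₁ c₂, |dxx (π x) z + dyy (π x) z| * ((dx (y - x).fst z ^ 2 +
          dy (y - x).fst z ^ 2) * Real.exp (lam * z.1 ^ 2) ^ 2)) +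
        ∫ z in rect a b c₁ c₂, |dxx (π x) z + dyy (π x) z| * ((dx (y - x).snd z ^ 2 +
          dy (y - x).snd z ^ 2) * Real.exp (lam * z.1 ^ 2) ^ 2))) ≤
    ‖quadMap (S.comp π) B y - quadMap (S.comp π) B x‖ ^ 2 +
      2 * inner ℝ (quadMap (S.comp π) B x) (B (y - x) (y - x)) := by
  set μ := volume.restrict (rect a b c₁ c₂)
  obtain ⟨i1, j1⟩ := integrable_weight lam h₁ h₂ (y - x).fst (π x)
  obtain ⟨i2, j2⟩ := integrable_weight lam h₁ h₂ (y - x).snd (π x)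
  have hsq : Integrable (fun z => (dxx (π (y - x)) z + dyy (π (y - x)) z) ^ 2 *
      Real.exp (lam * z.1 ^ 2) ^ 2) μ := by
    refine (Lp.memLp (S (π (y - x)))).integrable_sq.congr ?_
    filter_upwards [hS (π (y - x))] with z hz
    rw [hz, mul_pow]
  have hF : Integrable (fun z => (quadMap (S.comp π) B y - quadMap (S.comp π) B x : L2 _) z ^ 2) μ :=
    (Lp.memLp _).integrable_sq
  have hI : Integrable (fun z => quadMap (S.comp π) B x z * B (y - x) (y - x) z) μ :=
    MemLp.integrable_mul (p := 2) (q := 2) (Lp.memLp _) (Lp.memLp _)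
  have hin : inner ℝ (quadMap (S.comp π) B x) (B (y - x) (y - x)) =
      ∫ z in rect a b c₁ c₂, quadMap (S.comp π) B x z * B (y - x) (y - x) z := by
    rw [L2.inner_def]
    refine integral_congr_ae (Filter.Eventually.of_forall fun z => ?_)
    simp [mul_comm]
  rw [norm_sq_eq_integral, hin, ← integral_const_mul 2, ← integral_const_mul (1 / 2 : ℝ),
    ← integral_add i1 i2, ← integral_add j1 j2, ← integral_const_mul, ← integral_const_mul,
    ← integral_add ((i1.fun_add i2).const_mul _) ((j1.fun_add j2).const_mul _),
    ← integral_sub (hsq.const_mul _)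
      (((i1.fun_add i2).const_mul _).fun_add ((j1.fun_add j2).const_mul _)),
    ← integral_add hF (hI.const_mul _)]
  refine integral_mono_ae ((hsq.const_mul _).sub
    (((i1.fun_add i2).const_mul _).fun_add ((j1.fun_add j2).const_mul _))) (hF.add (hI.const_mul _)) ?_
  have eπ : π (y - x) = π y - π x := map_sub _ _ _
  have ex : quadMap (S.comp π) B x = S (π x) + B x x := rfl
  have ey : quadMap (S.comp π) B y = S (π y) + B y y := rfl
  filter_upwards [hb x (by simp), hb y (by simp), hS (π x), hS (π y), hB x x, hB y y,
    hB (y - x) (y - x), Lp.coeFn_sub (quadMap (S.comp π) B y) (quadMap (S.comp π) B x),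
    Lp.coeFn_add (S (π x)) (B x x), Lp.coeFn_add (S (π y)) (B y y),
    ae_dx_sub (π y) (π x), ae_dx_sub y.fst x.fst, ae_dx_sub y.snd x.snd]
    with z bx byy s1 s2 b1 b2 b3 d0 q1 q2 dπ d1 d2
  have f1 : (y - x).fst = y.fst - x.fst := rfl
  have f2 : (y - x).snd = y.snd - x.snd := rfl
  rw [← eπ] at dπ
  rw [← f1] at d1
  rw [← f2] at d2
  have key := pointwise_lower (d := dxx (π x) z + dyy (π x) z)
    (t := dxx (π (y - x)) z + dyy (π (y - x)) z) (inv_nonneg.2 hε.le) bx.1.1 bx.2.1 bx.1.2 bx.2.2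
    byy.1.1 byy.2.1 byy.1.2 byy.2.2
  rw [← d1.1, ← d1.2.1, ← d2.1, ← d2.2.1] at key
  have key' := mul_le_mul_of_nonneg_right key (sq_nonneg (Real.exp (lam * z.1 ^ 2)))
  rw [d0, ex, ey, Pi.sub_apply, q1, q2, Pi.add_apply, Pi.add_apply, s1, s2, b1, b2, b3]
  simp only [bilin, div_eq_mul_inv]
  rw [dπ.2.2.1, dπ.2.2.2] at key' ⊢
  refine le_of_eq_of_le ?_ (key'.trans_eq ?_) <;> ring

/-- Strong convexity of the functional on a ball for large Carleman parameters. -/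
theorem exists_convexOnBall (ha : 0 < a - c₁) (h₁ : 0 < c₁) (h₂ : 0 < c₂) {R ε : ℝ} (hR : 0 < R)
    (hε : 0 < ε) : ∃ Λ, 1 ≤ Λ ∧ ∀ lam, Λ ≤ lam → ∀ α, 0 < α → ∃ dJ,
      ConvexOnBall (Pair₀ (rect a b c₁ c₂) (rightSide a b c₁ c₂)) (J ε lam α) dJ R α := by
  obtain ⟨C, hC, car⟩ := exists_carleman_H3₀ (b := b) ha h₁ h₂
  obtain ⟨N, hN0, hN⟩ := exists_sup_bound (a := a) (b := b) h₁ h₂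
  -- Centre in the ball of radius `R`, displacement at most `2R`: all competitors have norm at most
  -- `3R`, and `M` bounds their first derivatives.
  set M := N * (3 * R) with hM
  set Q := 2 * (192 * M ^ 2 * ε⁻¹ ^ 2 * C + 6 * ε⁻¹ * (C * (1 + (3 * R) ^ 2))) with hQ
  have hQ0 : 0 ≤ Q := by positivity
  -- `Q/√λ` bounds the total loss from both components relative to `∫|Δh|²`, so `√λ ≥ 2Q` makes it
  -- at most the available one half. The regularization is not used to absorb anything, so `Λ` does
  -- not depend on `α`.
  refine ⟨max 1 ((2 * Q) ^ 2), le_max_left _ _, fun lam hlam α hα => ?_⟩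
  have hl1 : 1 ≤ lam := (le_max_left _ _).trans hlam
  have hl0 : 0 < √lam := Real.sqrt_pos.2 (by linarith)
  have hlQ : 2 * Q ≤ √lam := Real.le_sqrt_of_sq_le ((le_max_right _ _).trans hlam)
  obtain ⟨S, B, hS, hB⟩ := exists_operators (a := a) (b := b) h₁ h₂ ε lam
  let p₁ := WithLp.fstL 2 ℝ (H3 (rect a b c₁ c₂)) (H3 (rect a b c₁ c₂))
  let p₂ := WithLp.sndL 2 ℝ (H3 (rect a b c₁ c₂)) (H3 (rect a b c₁ c₂))
  refine ⟨_, ConvexOnBall.of_quadratic (S₁ := S.comp p₁) (S₂ := S.comp p₂) (B := B)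
    (Real.sqrt_nonneg ε) hα hR (fun x => ?_) (fun x y hx hy hxy => ?_)⟩
  · have hq : ∀ π : Pair (rect a b c₁ c₂) →L[ℝ] H3 (rect a b c₁ c₂),
        (quadMap (S.comp π) B x : L2 (rect a b c₁ c₂)) =ᵐ[volume.restrict (rect a b c₁ c₂)] fun z =>
          (dxx (π x) z + dyy (π x) z + nonlin ε x z) * Real.exp (lam * z.1 ^ 2) := by
      intro π
      filter_upwards [hS (π x), hB x x, Lp.coeFn_add (S (π x)) (B x x)] with z k1 k2 k3
      have : quadMap (S.comp π) B x = S (π x) + B x x := rfl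
      rw [this, k3, Pi.add_apply, k1, k2]
      simp only [bilin, nonlin]
      ring
    have hi := (Lp.memLp (quadMap (S.comp p₁) B x)).integrable_sq
    have hi' := (Lp.memLp (quadMap (S.comp p₂) B x)).integrable_sq
    rw [J, norm_sq_eq_integral, norm_sq_eq_integral, ← integral_add hi hi']
    congr 2
    refine integral_congr_ae ?_
    filter_upwards [hq p₁, hq p₂] with z k1 k2
    have e : Real.exp (2 * lam * z.1 ^ 2) = Real.exp (lam * z.1 ^ 2) ^ 2 := by
      rw [← Real.exp_nat_mul]; congr 1; push_cast; ring
    rw [k1, k2, e, mul_pow, mul_pow, ← add_mul]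
    rfl
  · have hcomp : ∀ q : Pair (rect a b c₁ c₂), ‖q‖ ≤ 3 * R → ‖q.fst‖ ≤ 3 * R ∧ ‖q.snd‖ ≤ 3 * R := by
      intro q hq
      have h := WithLp.prod_norm_sq_eq_of_L2 q
      constructor
      · exact (pow_le_pow_left₀ (norm_nonneg _) le_rfl 2).trans (by
          rw [h]; linarith [sq_nonneg ‖q.snd‖]) |> (abs_le_of_sq_le_sq' · (norm_nonneg _)) |>.2.trans hq
      · exact (pow_le_pow_left₀ (norm_nonneg _) le_rfl 2).trans (by
          rw [h]; linarith [sq_nonneg ‖q.fst‖]) |> (abs_le_of_sq_le_sq' · (norm_nonneg _)) |>.2.trans hq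
    have hbd : ∀ q : Pair (rect a b c₁ c₂), ‖q‖ ≤ 3 * R →
        ∀ᵐ z ∂(volume.restrict (rect a b c₁ c₂)),
          (|dx q.fst z| ≤ M ∧ |dy q.fst z| ≤ M) ∧ (|dx q.snd z| ≤ M ∧ |dy q.snd z| ≤ M) := by
      intro q hq
      have k1 := mul_le_mul_of_nonneg_left (hcomp q hq).1 hN0
      have k2 := mul_le_mul_of_nonneg_left (hcomp q hq).2 hN0
      filter_upwards [hN q.fst 1 0 (by norm_num), hN q.fst 0 1 (by norm_num),
        hN q.snd 1 0 (by norm_num), hN q.snd 0 1 (by norm_num)] with z m1 m2 m3 m4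
      exact ⟨⟨m1.trans k1, m2.trans k1⟩, ⟨m3.trans k2, m4.trans k2⟩⟩
    have hb : ∀ q ∈ ({x, y} : Set (Pair (rect a b c₁ c₂))),
        ∀ᵐ z ∂(volume.restrict (rect a b c₁ c₂)),
          (|dx q.fst z| ≤ M ∧ |dy q.fst z| ≤ M) ∧ (|dx q.snd z| ≤ M ∧ |dy q.snd z| ≤ M) := by
      rintro q (rfl | rfl)
      exacts [hbd _ hx, hbd _ hy]
    have l1 := component_lower h₁ h₂ hε hS hB p₁ hb
    have l2 := component_lower h₁ h₂ hε hS hB p₂ hb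
    obtain ⟨A1, B1⟩ := car lam hl1 (y - x).fst hxy.1
    obtain ⟨A2, B2⟩ := car lam hl1 (y - x).snd hxy.2
    have e1 : p₁ (y - x) = (y - x).fst := rfl
    have e2 : p₂ (y - x) = (y - x).snd := rfl
    rw [e1] at l1
    rw [e2] at l2
    set T1 := ∫ z in rect a b c₁ c₂, (dxx (y - x).fst z + dyy (y - x).fst z) ^ 2 *
      Real.exp (lam * z.1 ^ 2) ^ 2
    set T2 := ∫ z in rect a b c₁ c₂, (dxx (y - x).snd z + dyy (y - x).snd z) ^ 2 *
      Real.exp (lam * z.1 ^ 2) ^ 2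
    have hT1 : 0 ≤ T1 := integral_nonneg fun z => by positivity
    have hT2 : 0 ≤ T2 := integral_nonneg fun z => by positivity
    have hv : ∀ v : H3 (rect a b c₁ c₂), ‖v‖ ≤ 3 * R → ∀ T, 0 ≤ T →
        C * (1 + ‖v‖ ^ 2) * T / √lam ≤ C * (1 + (3 * R) ^ 2) * (T / √lam) := by
      intro v hv T hT
      rw [mul_div_assoc]
      have := pow_le_pow_left₀ (norm_nonneg v) hv 2
      gcongr
    have b11 := (B1 (p₁ x)).trans (hv _ (hcomp x hx).1 T1 hT1)
    have b12 := (B2 (p₁ x)).trans (hv _ (hcomp x hx).1 T2 hT2)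
    have b21 := (B1 (p₂ x)).trans (hv _ (hcomp x hx).2 T1 hT1)
    have b22 := (B2 (p₂ x)).trans (hv _ (hcomp x hx).2 T2 hT2)
    rw [mul_div_assoc] at A1 A2
    have c1 := mul_le_mul_of_nonneg_left (add_le_add A1 A2)
      (by positivity : 0 ≤ 192 * M ^ 2 * ε⁻¹ ^ 2)
    have c2 := mul_le_mul_of_nonneg_left (add_le_add b11 b12) (by positivity : 0 ≤ 6 * ε⁻¹)
    have c3 := mul_le_mul_of_nonneg_left (add_le_add b21 b22) (by positivity : 0 ≤ 6 * ε⁻¹)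
    have fin : Q * (T1 / √lam + T2 / √lam) ≤ 1 / 2 * (T1 + T2) := by
      rw [← add_div, ← mul_div_assoc, div_le_iff₀ hl0]
      have := mul_le_mul_of_nonneg_right hlQ (add_nonneg hT1 hT2)
      clear_value Q T1 T2
      linarith
    have fin' : 2 * (192 * M ^ 2 * ε⁻¹ ^ 2 * (C * (T1 / √lam) + C * (T2 / √lam))) +
        2 * (6 * ε⁻¹ * (C * (1 + (3 * R) ^ 2) * (T1 / √lam) +
          C * (1 + (3 * R) ^ 2) * (T2 / √lam))) ≤ 1 / 2 * (T1 + T2) := by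
      refine le_of_eq_of_le ?_ fin
      rw [hQ]; ring
    clear b11 b12 b21 b22 A1 A2 B1 B2 hlQ fin
    generalize 192 * M ^ 2 * ε⁻¹ ^ 2 * (C * (T1 / √lam) + C * (T2 / √lam)) = k1 at *
    generalize 6 * ε⁻¹ * (C * (1 + (3 * R) ^ 2) * (T1 / √lam) +
          C * (1 + (3 * R) ^ 2) * (T2 / √lam)) = k2 at *
    have m1 := (sub_le_sub_left (add_le_add c1 c2) _).trans l1
    have m2 := (sub_le_sub_left (add_le_add c1 c3) _).trans l2
    refine le_trans ?_ (add_le_add m1 m2)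
    clear_value T1 T2
    clear m1 m2 l1 l2 c1 c2 c3
    linarith

end Convexity

end EIT


namespace EIT

/-! ### Directional derivatives of functions of class `C²` -/

/-- The derivative in the direction `v`. -/
noncomputable def dirD (v : ℝ × ℝ) (f : ℝ × ℝ → ℝ) (z : ℝ × ℝ) : ℝ := fderiv ℝ f z v

section Calculus

variable {f g : ℝ × ℝ → ℝ} {z v : ℝ × ℝ}

theorem contDiffAt_dirD (hf : ContDiffAt ℝ 2 f z) (v : ℝ × ℝ) : ContDiffAt ℝ 1 (dirD v f) z :=
  (hf.fderiv_right (m := 1) (by norm_num)).clm_apply contDiffAt_const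

theorem ContDiffAt.eventually_two (hf : ContDiffAt ℝ 2 f z) :
    ∀ᶠ y in nhds z, ContDiffAt ℝ 2 f y :=
  ContDiffAt.eventually hf (by simp)

theorem dirD_congr (h : f =ᶠ[nhds z] g) : dirD v f z = dirD v g z := by
  rw [dirD, dirD, h.fderiv_eq]

theorem dirD_sub (hf : DifferentiableAt ℝ f z) (hg : DifferentiableAt ℝ g z) :
    dirD v (fun y => f y - g y) z = dirD v f z - dirD v g z := by
  rw [dirD, fderiv_fun_sub hf hg]; rfl

theorem dirD_add (hf : DifferentiableAt ℝ f z) (hg : DifferentiableAt ℝ g z) :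
    dirD v (fun y => f y + g y) z = dirD v f z + dirD v g z := by
  rw [dirD, fderiv_fun_add hf hg]; rfl

theorem dirD_mul (hf : DifferentiableAt ℝ f z) (hg : DifferentiableAt ℝ g z) :
    dirD v (fun y => f y * g y) z = f z * dirD v g z + g z * dirD v f z := by
  rw [dirD, fderiv_fun_mul hf hg]; rfl

theorem dirD_const_mul (c : ℝ) (hf : DifferentiableAt ℝ f z) :
    dirD v (fun y => c * f y) z = c * dirD v f z := by
  rw [dirD, fderiv_const_mul hf]; rfl

theorem dirD_log (hf : DifferentiableAt ℝ f z) (h0 : f z ≠ 0) :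
    dirD v (fun y => Real.log (f y)) z = dirD v f z / f z := by
  rw [dirD, fderiv.log hf h0]
  simp [dirD, div_eq_inv_mul]

theorem dirD_exp (hf : DifferentiableAt ℝ f z) :
    dirD v (fun y => Real.exp (f y)) z = Real.exp (f z) * dirD v f z := by
  rw [dirD, fderiv_exp hf]; rfl

theorem dirD_dirD_sub (hf : ContDiffAt ℝ 2 f z) (hg : ContDiffAt ℝ 2 g z) :
    dirD v (dirD v fun y => f y - g y) z = dirD v (dirD v f) z - dirD v (dirD v g) z := by
  have h : (dirD v fun y => f y - g y) =ᶠ[nhds z] fun y => dirD v f y - dirD v g y := by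
    filter_upwards [ContDiffAt.eventually_two hf, ContDiffAt.eventually_two hg] with y h1 h2
    exact dirD_sub (h1.differentiableAt (by simp)) (h2.differentiableAt (by simp))
  rw [dirD_congr h, dirD_sub ((contDiffAt_dirD hf v).differentiableAt (by simp))
    ((contDiffAt_dirD hg v).differentiableAt (by simp))]

theorem dirD_dirD_mul (hf : ContDiffAt ℝ 2 f z) (hg : ContDiffAt ℝ 2 g z) :
    dirD v (dirD v fun y => f y * g y) z =
      f z * dirD v (dirD v g) z + 2 * (dirD v f z * dirD v g z) + g z * dirD v (dirD v f) z := by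
  have h : (dirD v fun y => f y * g y) =ᶠ[nhds z]
      fun y => f y * dirD v g y + g y * dirD v f y := by
    filter_upwards [ContDiffAt.eventually_two hf, ContDiffAt.eventually_two hg] with y h1 h2
    exact dirD_mul (h1.differentiableAt (by simp)) (h2.differentiableAt (by simp))
  have f0 := hf.differentiableAt (by simp)
  have g0 := hg.differentiableAt (by simp)
  have f1 := (contDiffAt_dirD hf v).differentiableAt (by simp)
  have g1 := (contDiffAt_dirD hg v).differentiableAt (by simp)
  rw [dirD_congr h, dirD_add (f0.fun_mul g1) (g0.fun_mul f1), dirD_mul f0 g1, dirD_mul g0 f1]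
  ring

/-- Differentiate `f · ∂(ln f) = ∂f` once more. This is the linearizing effect of the logarithm: `Δw
+ |∇w|² = Δp/p` for `w = ln p`. -/
theorem dirD_dirD_log (hf : ContDiffAt ℝ 2 f z) (h0 : f z ≠ 0) :
    dirD v (dirD v fun y => Real.log (f y)) z + dirD v (fun y => Real.log (f y)) z ^ 2 =
      dirD v (dirD v f) z / f z := by
  have f0 := hf.differentiableAt (by simp)
  have hl : ContDiffAt ℝ 2 (fun y => Real.log (f y)) z := hf.log h0
  have l0 := hl.differentiableAt (by simp)
  have l1 := (contDiffAt_dirD hl v).differentiableAt (by simp)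
  have hne : ∀ᶠ y in nhds z, f y ≠ 0 := f0.continuousAt.eventually_ne h0
  have h : dirD v f =ᶠ[nhds z] fun y => f y * dirD v (fun y => Real.log (f y)) y := by
    filter_upwards [ContDiffAt.eventually_two hf, hne] with y h1 h2
    rw [dirD_log (h1.differentiableAt (by simp)) h2]
    field_simp
  rw [dirD_congr h, dirD_mul f0 l1, dirD_log f0 h0]
  field_simp

/-- If the second derivative along a line were negative, the point would also be a local maximum on
the line, so the function would be constant there and the second derivative zero. -/
theorem dirD_dirD_nonneg_of_isLocalMin (hf : ContDiffAt ℝ 2 f z) (hmin : IsLocalMin f z)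
    (v : ℝ × ℝ) : dirD v f z = 0 ∧ 0 ≤ dirD v (dirD v f) z := by
  have h0 : dirD v f z = 0 := by rw [dirD, hmin.fderiv_eq_zero]; rfl
  refine ⟨h0, ?_⟩
  by_contra hneg
  push Not at hneg
  set l : ℝ → ℝ × ℝ := fun t => z + t • v with hl
  have hl0 : l 0 = z := by simp [hl]
  have hlc : Continuous l := by fun_prop
  have hld : ∀ t, HasDerivAt l v t := fun t => by
    have h := ((hasDerivAt_id t).smul_const v).const_add z
    rwa [one_smul] at h
  have hlt : Filter.Tendsto l (nhds 0) (nhds z) := by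
    have := hlc.tendsto 0
    rwa [hl0] at this
  have hd : ∀ {w : ℝ × ℝ → ℝ} {t : ℝ}, DifferentiableAt ℝ w (l t) →
      HasDerivAt (fun s => w (l s)) (dirD v w (l t)) t := fun hw =>
    hw.hasFDerivAt.comp_hasDerivAt _ (hld _)
  have e1 : deriv (fun s => f (l s)) =ᶠ[nhds 0] fun s => dirD v f (l s) := by
    filter_upwards [hlt.eventually (ContDiffAt.eventually_two hf)] with t ht
    exact (hd (ht.differentiableAt (by simp))).deriv
  have f1 : DifferentiableAt ℝ (dirD v f) (l 0) := by
    rw [hl0]; exact (contDiffAt_dirD hf v).differentiableAt (by simp)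
  have e2 : deriv (deriv fun s => f (l s)) 0 = dirD v (dirD v f) z := by
    rw [e1.deriv_eq, (hd f1).deriv, hl0]
  have f0 : DifferentiableAt ℝ f (l 0) := by
    rw [hl0]; exact hf.differentiableAt (by simp)
  have e3 : deriv (fun s => f (l s)) 0 = 0 := by rw [(hd f0).deriv, hl0, h0]
  have hmax := isLocalMax_of_deriv_deriv_neg (by rw [e2]; exact hneg) e3 (hd f0).continuousAt
  have hmin' : ∀ᶠ t in nhds (0 : ℝ), f (l 0) ≤ f (l t) := by
    rw [hl0]; exact hlt.eventually hmin
  have hconst : (fun s => f (l s)) =ᶠ[nhds 0] fun _ => f (l 0) := by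
    filter_upwards [hmax, hmin'] with t h1 h2
    exact le_antisymm h1 h2
  have hd0 : deriv (fun s => f (l s)) =ᶠ[nhds 0] fun _ => (0 : ℝ) := by
    have := hconst.deriv
    filter_upwards [this] with t ht
    simp [ht]
  have : dirD v (dirD v f) z = 0 := by rw [← e2, hd0.deriv_eq]; simp
  exact hneg.ne this

end Calculus

/-! ### The strong minimum principle -/

/-- The operator `div (σ ∇u)`. -/
noncomputable def divGrad (σ u : ℝ × ℝ → ℝ) (z : ℝ × ℝ) : ℝ :=
  pdx (fun y => σ y * pdx u y) z + pdy (fun y => σ y * pdy u y) z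

theorem divGrad_eq {σ u : ℝ × ℝ → ℝ} {z : ℝ × ℝ} (hσ : ContDiffAt ℝ 2 σ z)
    (hu : ContDiffAt ℝ 2 u z) : divGrad σ u z = σ z * lap u z +
      (dirD (1, 0) σ z * dirD (1, 0) u z + dirD (0, 1) σ z * dirD (0, 1) u z) := by
  have s0 := hσ.differentiableAt (by simp)
  have h1 := dirD_mul (v := (1, 0)) s0 ((contDiffAt_dirD hu (1, 0)).differentiableAt (by simp))
  have h2 := dirD_mul (v := (0, 1)) s0 ((contDiffAt_dirD hu (0, 1)).differentiableAt (by simp))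
  have e : divGrad σ u z = dirD (1, 0) (fun y => σ y * dirD (1, 0) u y) z +
    dirD (0, 1) (fun y => σ y * dirD (0, 1) u y) z := rfl
  have e' : lap u z = dirD (1, 0) (dirD (1, 0) u) z + dirD (0, 1) (dirD (0, 1) u) z := rfl
  rw [e, e', h1, h2]
  ring

theorem divGrad_nonneg_of_isLocalMin {σ u : ℝ × ℝ → ℝ} {z : ℝ × ℝ} (hσ : ContDiffAt ℝ 2 σ z)
    (hσ0 : 0 ≤ σ z) (hu : ContDiffAt ℝ 2 u z) (hmin : IsLocalMin u z) : 0 ≤ divGrad σ u z := by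
  obtain ⟨a1, a2⟩ := dirD_dirD_nonneg_of_isLocalMin hu hmin (1, 0)
  obtain ⟨b1, b2⟩ := dirD_dirD_nonneg_of_isLocalMin hu hmin (0, 1)
  rw [divGrad_eq hσ hu, a1, b1]
  have : 0 ≤ lap u z := add_nonneg a2 b2
  have := mul_nonneg hσ0 this
  linarith

theorem divGrad_sub_const_mul {σ u w : ℝ × ℝ → ℝ} {z : ℝ × ℝ} (hσ : ContDiffAt ℝ 2 σ z)
    (hu : ContDiffAt ℝ 2 u z) (hw : ContDiffAt ℝ 2 w z) (η : ℝ) :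
    divGrad σ (fun y => u y - η * w y) z = divGrad σ u z - η * divGrad σ w z := by
  have hw' : ContDiffAt ℝ 2 (fun y => η * w y) z := contDiffAt_const.mul hw
  have hc : ContDiffAt ℝ 2 (fun _ : ℝ × ℝ => η) z := contDiffAt_const
  have k0 : ∀ v y, dirD v (fun _ : ℝ × ℝ => η) y = 0 := fun v y => by simp [dirD]
  have k1 : ∀ v, dirD v (dirD v fun _ : ℝ × ℝ => η) z = 0 := fun v => by
    rw [funext (k0 v)]; simp [dirD]
  have key : ∀ v, dirD v (fun y => u y - η * w y) z = dirD v u z - η * dirD v w z ∧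
      dirD v (dirD v fun y => u y - η * w y) z =
        dirD v (dirD v u) z - η * dirD v (dirD v w) z := fun v => by
    rw [dirD_sub (hu.differentiableAt (by simp)) (hw'.differentiableAt (by simp)),
      dirD_dirD_sub hu hw', dirD_dirD_mul hc hw, k1, k0,
      dirD_const_mul _ (hw.differentiableAt (by simp))]
    constructor <;> ring
  rw [divGrad_eq hσ (hu.sub hw'), divGrad_eq hσ hu, divGrad_eq hσ hw]
  have e : ∀ q : ℝ × ℝ → ℝ, lap q z =
    dirD (1, 0) (dirD (1, 0) q) z + dirD (0, 1) (dirD (0, 1) q) z := fun _ => rfl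
  rw [e, e, e, (key (1, 0)).1, (key (0, 1)).1, (key (1, 0)).2, (key (0, 1)).2]
  ring

/-- The squared Euclidean distance. -/
def sqDist (p z : ℝ × ℝ) : ℝ := (z.1 - p.1) ^ 2 + (z.2 - p.2) ^ 2

theorem continuous_sqDist (p : ℝ × ℝ) : Continuous (sqDist p) := by
  unfold sqDist; fun_prop

theorem sqDist_nonneg (p z : ℝ × ℝ) : 0 ≤ sqDist p z := by unfold sqDist; positivity

/-- The metric of `ℝ × ℝ` is the maximum metric, while the barrier argument needs Euclidean disks;
these are described by `sqDist` and lie in balls of the same radius. -/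
theorem dist_le_of_sqDist_le {p z : ℝ × ℝ} {r : ℝ} (hr : 0 ≤ r) (h : sqDist p z ≤ r ^ 2) :
    dist z p ≤ r := by
  unfold sqDist at h
  rw [Prod.dist_eq, max_le_iff, Real.dist_eq, Real.dist_eq]
  exact ⟨abs_le_of_sq_le_sq (by linarith [sq_nonneg (z.2 - p.2)]) hr,
    abs_le_of_sq_le_sq (by linarith [sq_nonneg (z.1 - p.1)]) hr⟩

theorem isCompact_sqDist_le (p : ℝ × ℝ) {r : ℝ} (hr : 0 ≤ r) :
    IsCompact {z | sqDist p z ≤ r ^ 2} :=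
  (isCompact_closedBall p r).of_isClosed_subset
    (isClosed_le (continuous_sqDist p) continuous_const)
    fun _ hz => Metric.mem_closedBall.2 (dist_le_of_sqDist_le hr hz)

/-- For large `k` the term `4k²σ|z - p|²` dominates away from `p`, so the Gaussian is a strict
subsolution there. It serves as the comparison function in Hopf's argument. -/
theorem divGrad_barrier {σ : ℝ × ℝ → ℝ} {z : ℝ × ℝ} (p : ℝ × ℝ) (k : ℝ)
    (hσ : ContDiffAt ℝ 2 σ z) :
    divGrad σ (fun y => Real.exp (-k * sqDist p y)) z = Real.exp (-k * sqDist p z) *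
      (σ z * (4 * k ^ 2 * sqDist p z - 4 * k) -
        2 * k * (dirD (1, 0) σ z * (z.1 - p.1) + dirD (0, 1) σ z * (z.2 - p.2))) := by
  have hq : ∀ y v, HasFDerivAt (sqDist p) ((2 * (y.1 - p.1)) • ContinuousLinearMap.fst ℝ ℝ ℝ +
      (2 * (y.2 - p.2)) • ContinuousLinearMap.snd ℝ ℝ ℝ) y ∧
      dirD v (sqDist p) y = 2 * (y.1 - p.1) * v.1 + 2 * (y.2 - p.2) * v.2 := by
    intro y v
    have h : HasFDerivAt (sqDist p) ((2 * (y.1 - p.1)) • ContinuousLinearMap.fst ℝ ℝ ℝ +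
      (2 * (y.2 - p.2)) • ContinuousLinearMap.snd ℝ ℝ ℝ) y := by
      have h1 := ((hasFDerivAt_fst (𝕜 := ℝ) (p := y)).sub_const p.1).pow 2
      have h2 := ((hasFDerivAt_snd (𝕜 := ℝ) (p := y)).sub_const p.2).pow 2
      refine (h1.add h2).congr_fderiv ?_
      ext <;> simp
    refine ⟨h, ?_⟩
    rw [dirD, h.fderiv]
    simp
  have hqc : ContDiff ℝ 2 (sqDist p) := by unfold sqDist; fun_prop
  have hb : ContDiff ℝ 2 fun y => Real.exp (-k * sqDist p y) :=
    (contDiff_const.mul hqc).exp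
  have hd : ∀ v y, dirD v (fun y => Real.exp (-k * sqDist p y)) y =
      Real.exp (-k * sqDist p y) * (-k * (2 * (y.1 - p.1) * v.1 + 2 * (y.2 - p.2) * v.2)) := by
    intro v y
    have hqd := (hq y v).1.differentiableAt
    rw [dirD_exp (hqd.const_mul _), dirD_const_mul _ hqd, (hq y v).2]
  have hdd : ∀ v, dirD v (dirD v fun y => Real.exp (-k * sqDist p y)) z =
      Real.exp (-k * sqDist p z) * ((k * (2 * (z.1 - p.1) * v.1 + 2 * (z.2 - p.2) * v.2)) ^ 2 -
        2 * k * (v.1 ^ 2 + v.2 ^ 2)) := by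
    intro v
    have hl : HasFDerivAt (fun y : ℝ × ℝ => -k * (2 * (y.1 - p.1) * v.1 + 2 * (y.2 - p.2) * v.2))
        ((-k * 2 * v.1) • ContinuousLinearMap.fst ℝ ℝ ℝ +
          (-k * 2 * v.2) • ContinuousLinearMap.snd ℝ ℝ ℝ) z := by
      have h1 := ((hasFDerivAt_fst (𝕜 := ℝ) (p := z)).sub_const p.1).const_mul (-k * 2 * v.1)
      have h2 := ((hasFDerivAt_snd (𝕜 := ℝ) (p := z)).sub_const p.2).const_mul (-k * 2 * v.2)
      refine (h1.add h2).congr_of_eventuallyEq (Filter.Eventually.of_forall fun y => ?_)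
      simp only [Pi.add_apply]
      ring
    rw [funext (hd v), dirD_mul (hb.contDiffAt.differentiableAt (by simp)) hl.differentiableAt,
      hd v z, dirD, hl.fderiv]
    simp
    ring
  have e : lap (fun y => Real.exp (-k * sqDist p y)) z =
    dirD (1, 0) (dirD (1, 0) fun y => Real.exp (-k * sqDist p y)) z +
    dirD (0, 1) (dirD (0, 1) fun y => Real.exp (-k * sqDist p y)) z := rfl
  rw [divGrad_eq hσ hb.contDiffAt, e, hdd, hdd, hd, hd]
  simp only [sqDist]
  ring

/-- A supersolution which attains its minimum at `c` is constant near `c`. -/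
theorem eventually_eq_of_min {G : Set (ℝ × ℝ)} (hG : IsOpen G) {σ u : ℝ × ℝ → ℝ}
    (hσ : ContDiffOn ℝ 2 σ G) (hu : ContDiffOn ℝ 2 u G) (hσ1 : ∀ z ∈ G, 1 ≤ σ z)
    (hL : ∀ z ∈ G, divGrad σ u z ≤ 0) {m : ℝ} (hm : ∀ z ∈ G, m ≤ u z) {c : ℝ × ℝ} (hc : c ∈ G)
    (hcm : u c = m) : ∀ᶠ p in nhds c, u p = m := by
  obtain ⟨r, hr, hrG⟩ := Metric.nhds_basis_closedBall.mem_iff.1 (hG.mem_nhds hc)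
  have hev : ∀ᶠ p in nhds c, sqDist p c < (r / 4) ^ 2 := by
    have hcont : Continuous fun p : ℝ × ℝ => sqDist p c := by unfold sqDist; fun_prop
    have := hcont.tendsto c
    rw [show sqDist c c = 0 by simp [sqDist]] at this
    exact this.eventually (gt_mem_nhds (by positivity))
  filter_upwards [hev] with p hp
  by_contra hne
  have hσc : ∀ z ∈ G, ContDiffAt ℝ 2 σ z := fun z hz => hσ.contDiffAt (hG.mem_nhds hz)
  have huc : ∀ z ∈ G, ContDiffAt ℝ 2 u z := fun z hz => hu.contDiffAt (hG.mem_nhds hz)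
  have hpc : dist c p ≤ r / 4 := dist_le_of_sqDist_le (by positivity) hp.le
  have hsub : ∀ z, dist z p ≤ r / 2 → z ∈ G := fun z hz => hrG (by
    have := dist_triangle z p c
    rw [dist_comm p c] at this
    exact Metric.mem_closedBall.2 (by linarith))
  -- the nearest point of the contact set
  have hK : IsCompact ({z | sqDist p z ≤ (r / 4) ^ 2} ∩ {z ∈ {z | sqDist p z ≤ (r / 4) ^ 2} | u z = m}) := by
    have hcl := isCompact_sqDist_le p (show 0 ≤ r / 4 by positivity)
    have hcu : ContinuousOn u {z | sqDist p z ≤ (r / 4) ^ 2} := hu.continuousOn.mono fun z hz =>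
      hsub z ((dist_le_of_sqDist_le (by positivity) hz).trans (by linarith))
    exact hcl.inter_right (hcu.preimage_isClosed_of_isClosed hcl.isClosed isClosed_singleton)
  obtain ⟨q, ⟨-, hqr, hqm⟩, hqmin⟩ := hK.exists_isMinOn ⟨c, hp.le, hp.le, hcm⟩
    (continuous_sqDist p).continuousOn
  replace hqr : sqDist p q ≤ (r / 4) ^ 2 := hqr
  have hq0 : 0 < sqDist p q := by
    refine lt_of_le_of_ne (sqDist_nonneg _ _) fun h0 => hne ?_
    have h1 : dist q p ≤ 0 := dist_le_of_sqDist_le le_rfl (by rw [← h0]; norm_num)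
    rw [← dist_le_zero.1 h1]; exact hqm
  have hlt : ∀ z, sqDist p z < sqDist p q → m < u z := by
    intro z hz
    have hzr : sqDist p z ≤ (r / 4) ^ 2 := hz.le.trans hqr
    have hzG : z ∈ G := hsub z ((dist_le_of_sqDist_le (by positivity) hzr).trans (by linarith))
    refine lt_of_le_of_ne (hm z hzG) fun h => ?_
    exact absurd (hqmin (show z ∈ _ from ⟨hzr, hzr, h.symm⟩)) (not_le.2 hz)
  -- the inner disk, touching the contact set at `q` only
  set o : ℝ × ℝ := ((p.1 + q.1) / 2, (p.2 + q.2) / 2) with ho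
  set s := sqDist p q / 4 with hs
  have hs0 : 0 < s := by positivity
  have hoq : sqDist o q = s := by simp only [ho, hs, sqDist]; ring
  have hin : ∀ z, sqDist o z ≤ s → 0 < sqDist q z → m < u z := by
    intro z h1 h2
    refine hlt z ?_
    -- The parallelogram identity for the midpoint `o` of `p` and `q`: the disk with diameter `pq`
    -- lies in the disk about `p` and meets its circle only at `q`.
    have : sqDist p z = 2 * sqDist o z + 2 * s - sqDist q z := by
      simp only [ho, hs, sqDist]; ring
    rw [this]
    have : sqDist p q = 4 * s := by rw [hs]; ring
    linarith
  set t := √s / 2 with ht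
  have ht0 : 0 < t := by positivity
  have ht2 : t ^ 2 = s / 4 := by rw [ht, div_pow, Real.sq_sqrt hs0.le]; norm_num
  have hDo : ∀ z, sqDist q z ≤ t ^ 2 → s / 4 ≤ sqDist o z := by
    intro z hz
    have h1 : s ≤ 2 * sqDist o z + 2 * sqDist q z := by
      rw [← hoq]
      simp only [sqDist]
      linarith [sq_nonneg (z.1 - o.1 + (z.1 - q.1)), sq_nonneg (z.2 - o.2 + (z.2 - q.2))]
    rw [ht2] at hz
    linarith
  have htr : t ≤ r / 4 := by
    have : t ^ 2 ≤ (r / 4) ^ 2 := by rw [ht2]; linarith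
    exact abs_le_of_sq_le_sq' this (by positivity) |>.2
  have hDG : ∀ z, sqDist q z ≤ t ^ 2 → z ∈ G := by
    intro z hz
    have h1 := dist_le_of_sqDist_le ht0.le hz
    have h2 : dist q p ≤ r / 4 := dist_le_of_sqDist_le (by positivity) hqr
    exact hsub z ((dist_triangle z q p).trans (by linarith))
  have hDc := isCompact_sqDist_le q ht0.le
  have hqD : q ∈ {z | sqDist q z ≤ t ^ 2} := by
    change sqDist q q ≤ t ^ 2
    rw [show sqDist q q = 0 by simp [sqDist]]; positivity
  -- the barrier
  obtain ⟨S, hS⟩ : ∃ S, ∀ z, sqDist q z ≤ t ^ 2 →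
      dirD (1, 0) σ z * (z.1 - o.1) + dirD (0, 1) σ z * (z.2 - o.2) ≤ S := by
    have hcd : ∀ v, ContinuousOn (dirD v σ) {z | sqDist q z ≤ t ^ 2} := fun v z hz =>
      (contDiffAt_dirD (hσc z (hDG z hz)) v).continuousAt.continuousWithinAt
    have hco : ContinuousOn (fun z : ℝ × ℝ => dirD (1, 0) σ z * (z.1 - o.1) +
        dirD (0, 1) σ z * (z.2 - o.2)) {z | sqDist q z ≤ t ^ 2} :=
      ((hcd _).mul (by fun_prop)).add ((hcd _).mul (by fun_prop))
    obtain ⟨S, hS⟩ := hDc.bddAbove_image hco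
    exact ⟨S, fun z hz => hS ⟨z, hz, rfl⟩⟩
  -- With `|z - o|² ≥ s/4` this gives `4k²|z - o|² - 4k ≥ k(1 + 2|S|)`, which exceeds the
  -- first-order loss `2k|S|`.
  set k := (5 + 2 * |S|) / s with hk
  have hk0 : 0 < k := by positivity
  have hks : k * s = 5 + 2 * |S| := by rw [hk]; field_simp
  have hbar : ∀ z, sqDist q z ≤ t ^ 2 →
      0 < divGrad σ (fun y => Real.exp (-k * sqDist o y)) z := by
    intro z hz
    rw [divGrad_barrier o k (hσc z (hDG z hz))]
    refine mul_pos (Real.exp_pos _) ?_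
    have h1 := hS z hz
    have h2 := hDo z hz
    have h3 := hσ1 z (hDG z hz)
    have h4 : k * (1 + 2 * |S|) ≤ 4 * k ^ 2 * sqDist o z - 4 * k := by
      have := mul_le_mul_of_nonneg_left h2 (by positivity : 0 ≤ 4 * k ^ 2)
      have e : 4 * k ^ 2 * (s / 4) = k * (k * s) := by ring
      rw [e, hks] at this
      linarith
    have h5 : 0 ≤ k * (1 + 2 * |S|) := by positivity
    have h6 : k * (1 + 2 * |S|) ≤ σ z * (4 * k ^ 2 * sqDist o z - 4 * k) := by
      refine h4.trans (le_mul_of_one_le_left (h5.trans h4) h3)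
    have h7 := mul_le_mul_of_nonneg_left (h1.trans (le_abs_self S)) (by positivity : 0 ≤ 2 * k)
    linarith
  -- the comparison on the boundary of the small disk
  have hKb : IsCompact ({z | sqDist q z ≤ t ^ 2} ∩ {z | sqDist q z = t ^ 2 ∧ sqDist o z ≤ s}) :=
    hDc.inter_right ((isClosed_eq (continuous_sqDist q) continuous_const).inter
      (isClosed_le (continuous_sqDist o) continuous_const))
  have huD : ContinuousOn u {z | sqDist q z ≤ t ^ 2} := hu.continuousOn.mono hDG
  obtain ⟨η, hη, hηb⟩ : ∃ η, 0 < η ∧ ∀ z, sqDist q z = t ^ 2 → sqDist o z ≤ s → m + η < u z := by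
    rcases ({z | sqDist q z ≤ t ^ 2} ∩
      {z | sqDist q z = t ^ 2 ∧ sqDist o z ≤ s}).eq_empty_or_nonempty with he | hne'
    · refine ⟨1, one_pos, fun z h1 h2 => ?_⟩
      have : z ∈ ({z | sqDist q z ≤ t ^ 2} ∩ {z | sqDist q z = t ^ 2 ∧ sqDist o z ≤ s}) :=
        ⟨h1.le, h1, h2⟩
      rw [he] at this
      exact this.elim
    · obtain ⟨y, ⟨-, hy1, hy2⟩, hymin⟩ := hKb.exists_isMinOn hne' (huD.mono inter_subset_left)
      have hy := hin y hy2 (by rw [hy1]; positivity)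
      refine ⟨(u y - m) / 2, by linarith, fun z h1 h2 => ?_⟩
      have : u y ≤ u z := hymin (show z ∈ _ from ⟨h1.le, h1, h2⟩)
      linarith
  set w := fun y => Real.exp (-k * sqDist o y) with hw
  have hwc : ContDiff ℝ 2 w := by
    have : ContDiff ℝ 2 (sqDist o) := by unfold sqDist; fun_prop
    exact (contDiff_const.mul this).exp
  obtain ⟨y, hyD, hymin⟩ := hDc.exists_isMinOn ⟨q, hqD⟩
    (f := fun y => u y - η * w y) (huD.sub (continuousOn_const.mul hwc.continuous.continuousOn))
  have hyq : u y - η * w y ≤ u q - η * w q := hymin hqD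
  have hqv : w q = Real.exp (-k * s) := by rw [hw]; simp only [hoq]
  -- On the boundary of the small disk `u - ηw` exceeds its value at `q`: inside the inner disk
  -- because `u > m + η` and `w ≤ 1`, outside because `u ≥ m` and `w < exp(-ks)`. So the minimum is
  -- interior, where the strict subsolution property is contradictory.
  have hyt : sqDist q y < t ^ 2 := by
    refine lt_of_le_of_ne hyD fun h => ?_
    rw [hqm, hqv] at hyq
    have e0 := Real.exp_pos (-k * s)
    rcases le_or_gt (sqDist o y) s with h1 | h1
    · have h2 := hηb y h h1
      have h3 : w y ≤ 1 := by
        rw [hw]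
        refine Real.exp_le_one_iff.2 ?_
        have := mul_nonneg hk0.le (sqDist_nonneg o y)
        linarith
      have h4 := mul_le_mul_of_nonneg_left h3 hη.le
      have h5 := mul_pos hη e0
      linarith
    · have h2 := hm y (hDG y hyD)
      have h3 : w y < Real.exp (-k * s) := by
        rw [hw]
        refine Real.exp_lt_exp.2 ?_
        have := mul_lt_mul_of_pos_left h1 hk0
        linarith
      have h4 := mul_lt_mul_of_pos_left h3 hη
      linarith
  have hyG := hDG y hyD
  have hloc : IsLocalMin (fun y => u y - η * w y) y := by
    have : ∀ᶠ z in nhds y, sqDist q z < t ^ 2 :=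
      (continuous_sqDist q).continuousAt.eventually (gt_mem_nhds hyt)
    filter_upwards [this] with z hz using hymin (show z ∈ {z | sqDist q z ≤ t ^ 2} from hz.le)
  have hfin := divGrad_nonneg_of_isLocalMin (hσc y hyG) (zero_le_one.trans (hσ1 y hyG))
    ((huc y hyG).sub (contDiffAt_const.mul hwc.contDiffAt)) hloc
  rw [divGrad_sub_const_mul (hσc y hyG) (huc y hyG) hwc.contDiffAt] at hfin
  have h1 := mul_pos hη (hbar y hyD)
  have h2 := hL y hyG
  linarith

/-- The strong minimum principle for supersolutions with zero boundary values. -/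
theorem pos_of_divGrad_nonpos {G : Set (ℝ × ℝ)} (hG : IsOpen G) (hGc : IsConnected G)
    (hGb : Bornology.IsBounded G) {σ u : ℝ × ℝ → ℝ} (hσ : ContDiffOn ℝ 2 σ G)
    (hu : ContDiffOn ℝ 2 u G) (huc : ContinuousOn u (closure G)) (hσ1 : ∀ z ∈ G, 1 ≤ σ z)
    (hL : ∀ z ∈ G, divGrad σ u z ≤ 0) (hne : ∃ z ∈ G, divGrad σ u z ≠ 0)
    (hb : ∀ z ∈ frontier G, u z = 0) : ∀ z ∈ G, 0 < u z := by
  intro z₀ hz₀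
  by_contra hneg
  push Not at hneg
  have hcl : ∀ y ∈ closure G, y ∈ G ∨ u y = 0 := by
    intro y hy
    by_cases hyG : y ∈ G
    · exact Or.inl hyG
    · exact Or.inr (hb y (by rw [hG.frontier_eq]; exact ⟨hy, hyG⟩))
  obtain ⟨y, hy, hymin⟩ := hGb.isCompact_closure.exists_isMinOn ⟨z₀, subset_closure hz₀⟩ huc
  obtain ⟨c, hc, hcmin⟩ : ∃ c ∈ G, ∀ z ∈ G, u c ≤ u z := by
    rcases hcl y hy with h | h
    · exact ⟨y, h, fun z hz => hymin (subset_closure hz)⟩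
    -- If the minimum over the closure is attained on the boundary, it is zero, and `z₀`, where `u ≤
    -- 0`, is an interior minimum point as well.
    · refine ⟨z₀, hz₀, fun z hz => hneg.trans ?_⟩
      rw [← h]; exact hymin (subset_closure hz)
  have hsub : G ⊆ {z | ∀ᶠ p in nhds z, u p = u c} := by
    -- Both the set where `u` is locally equal to the minimum and the set where it differs from it
    -- are open, so `u` is constant on the connected set `G`. This contradicts a nonzero right-hand
    -- side.
    refine hGc.isPreconnected.subset_left_of_subset_union
      (v := G ∩ {z | u z ≠ u c}) ?_ ?_ ?_ ?_ ?_
    · exact isOpen_setOfPred_eventually_nhds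
    · exact hu.continuousOn.isOpen_inter_preimage hG isOpen_ne
    · exact disjoint_left.2 fun z h1 h2 => h2.2
        (show ∀ᶠ p in nhds z, u p = u c from h1).self_of_nhds
    · intro z hz
      by_cases h : u z = u c
      · exact Or.inl (eventually_eq_of_min hG hσ hu hσ1 hL hcmin hz h)
      · exact Or.inr ⟨hz, h⟩
    · exact ⟨c, hc, eventually_eq_of_min hG hσ hu hσ1 hL hcmin hc rfl⟩
  obtain ⟨z, hz, hz0⟩ := hne
  refine hz0 ?_
  have h1 : u =ᶠ[nhds z] fun _ => u c := hsub hz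
  have h2 : ∀ v, dirD v u =ᶠ[nhds z] fun _ => 0 := fun v => by
    filter_upwards [h1.eventuallyEq_nhds] with y hy
    rw [dirD_congr hy]; simp [dirD]
  have h3 : ∀ v, dirD v (dirD v u) z = 0 := fun v => by
    rw [dirD_congr (h2 v)]; simp [dirD]
  have e : lap u z = dirD (1, 0) (dirD (1, 0) u) z + dirD (0, 1) (dirD (0, 1) u) z := rfl
  rw [divGrad_eq (hσ.contDiffAt (hG.mem_nhds hz)) (hu.contDiffAt (hG.mem_nhds hz)), e, h3, h3,
    (h2 _).self_of_nhds, (h2 _).self_of_nhds]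
  simp

end EIT


namespace EIT

/-! ### The source -/

theorem bump_nonneg (ρ : ℝ) (z : ℝ × ℝ) : 0 ≤ bump ρ z := by
  unfold bump; split_ifs <;> positivity

theorem bump_pos_iff {ρ : ℝ} {z : ℝ × ℝ} : 0 < bump ρ z ↔ z.1 ^ 2 + z.2 ^ 2 < ρ ^ 2 := by
  unfold bump
  split_ifs with h
  · exact ⟨fun _ => h, fun _ => Real.exp_pos _⟩
  · simp [h]

theorem source_nonneg (ρ : ℝ) (z : ℝ × ℝ) : 0 ≤ source ρ z :=
  mul_nonneg (inv_nonneg.2 (integral_nonneg (bump_nonneg ρ))) (bump_nonneg ρ z)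

theorem integrable_bump {ρ : ℝ} (hρ : 0 < ρ) : Integrable (bump ρ) := by
  have hm : Measurable (bump ρ) := by
    unfold bump
    exact Measurable.ite (measurableSet_lt (by fun_prop) (by fun_prop)) (by fun_prop) (by fun_prop)
  have hfin : IntegrableOn (bump ρ) (Metric.closedBall 0 ρ) := by
    refine ⟨hm.aestronglyMeasurable, HasFiniteIntegral.restrict_of_bounded 1
      measure_closedBall_lt_top (Filter.Eventually.of_forall fun z => ?_)⟩
    rw [Real.norm_of_nonneg (bump_nonneg ρ z)]
    unfold bump
    split_ifs with h
    · refine Real.exp_le_one_iff.2 (neg_nonpos.2 (div_nonneg (by positivity) (by linarith)))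
    · exact zero_le_one
  refine hfin.integrable_of_forall_notMem_eq_zero fun z hz => ?_
  refine le_antisymm (not_lt.1 fun h => hz ?_) (bump_nonneg ρ z)
  have h' := bump_pos_iff.1 h
  exact Metric.mem_closedBall.2 (dist_le_of_sqDist_le hρ.le (by simpa [sqDist] using h'.le))

theorem source_zero_pos {ρ : ℝ} (hρ : 0 < ρ) : 0 < source ρ 0 := by
  have h0 : 0 < bump ρ 0 := bump_pos_iff.2 (by simpa using by positivity)
  refine mul_pos (inv_pos.2 ?_) h0
  rw [integral_pos_iff_support_of_nonneg (bump_nonneg ρ) (integrable_bump hρ)]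
  have e : Function.support (bump ρ) = {z | z.1 ^ 2 + z.2 ^ 2 < ρ ^ 2} := by
    ext z
    rw [Function.mem_support, ← (bump_nonneg ρ z).lt_iff_ne']
    exact bump_pos_iff
  rw [e]
  exact (isOpen_lt (by fun_prop) (by fun_prop)).measure_pos volume ⟨0, by simpa using by positivity⟩

/-! ### Positivity of the potential and the equation for its logarithm -/

theorem sourcePoint_mem_circ (a b A φ : ℝ) : sourcePoint a b A φ ∈ circ a b A := by
  change (a + A * Real.cos φ - a) ^ 2 + (b + A * Real.sin φ - b) ^ 2 = A ^ 2
  linear_combination A ^ 2 * Real.cos_sq_add_sin_sq φ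

section Forward

variable {a b c₁ c₂ A ρ : ℝ} {G : Set (ℝ × ℝ)} {σ u : ℝ × ℝ → ℝ} {x₀ : ℝ × ℝ}

/-- Radial approach shows that the circle is in the closure of the disk, hence of `G`; since it
misses the boundary of `G`, it lies in `G`. So the source centres are points where the equation
holds. -/
theorem IsSetting.circ_subset (h : IsSetting a b c₁ c₂ A ρ G) : circ a b A ⊆ G := by
  intro z hz
  have hcl : z ∈ closure G := by
    refine closure_mono h.disk_subset ?_
    set l : ℝ → ℝ × ℝ := fun t => (a + t * (z.1 - a), b + t * (z.2 - b)) with hl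
    have hlc : Continuous l := by fun_prop
    have hmaps : MapsTo l (Ico 0 1) (disk a b A) := by
      intro t ht
      have hz' : (z.1 - a) ^ 2 + (z.2 - b) ^ 2 = A ^ 2 := hz
      have e : (l t).1 - a = t * (z.1 - a) ∧ (l t).2 - b = t * (z.2 - b) := by
        simp only [hl]; constructor <;> ring
      change ((l t).1 - a) ^ 2 + ((l t).2 - b) ^ 2 < A ^ 2
      rw [e.1, e.2, mul_pow, mul_pow, ← mul_add, hz']
      have h1 : t ^ 2 < 1 := by nlinarith [ht.1, ht.2]
      have h2 : 0 < A ^ 2 := by have := h.A_pos; positivity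
      nlinarith
    have h1 : (1 : ℝ) ∈ closure (Ico (0 : ℝ) 1) := by
      rw [closure_Ico zero_ne_one]; exact right_mem_Icc.2 zero_le_one
    have := map_mem_closure hlc h1 hmaps
    have e : l 1 = z := by simp [hl]
    rwa [e] at this
  by_contra hG
  have : z ∈ circ a b A ∩ frontier G := ⟨hz, by rw [h.isOpen.frontier_eq]; exact ⟨hcl, hG⟩⟩
  rw [h.circ_frontier] at this
  exact this.elim

/-- The source is nonnegative, so the potential is a supersolution, and it is strictly positive at
its own centre, which excludes the constant case of the minimum principle. -/
theorem IsPotential.pos (h : IsSetting a b c₁ c₂ A ρ G)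
    (hσ : IsConductivity G (rect a b c₁ c₂) σ) (hx₀ : x₀ ∈ circ a b A)
    (hu : IsPotential G ρ σ x₀ u) : ∀ z ∈ G, 0 < u z := by
  refine pos_of_divGrad_nonpos h.isOpen h.isConnected h.isBounded
    (hσ.contDiffOn.mono subset_closure) (hu.contDiffOn.mono subset_closure)
    hu.contDiffOn.continuousOn hσ.one_le (fun z hz => ?_) ⟨x₀, h.circ_subset hx₀, ?_⟩ hu.boundary
  · exact (hu.equation z hz).trans_le (neg_nonpos.2 (source_nonneg _ _))
  · refine ne_of_eq_of_ne (hu.equation x₀ (h.circ_subset hx₀)) ?_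
    rw [sub_self]
    exact neg_ne_zero.2 (source_zero_pos h.rho_mem.1).ne'

/-- The source vanishes in the rectangle. With `σ = s²` the equation becomes `s(sΔu + 2∇s·∇u) = 0`,
that is `Δ(su) = uΔs`, and therefore `Δ(su)/(su) = Δs/s`, in which the potential no longer appears.
-/
theorem contDiffAt_log_potential (h : IsSetting a b c₁ c₂ A ρ G)
    (hσ : IsConductivity G (rect a b c₁ c₂) σ) (hx₀ : x₀ ∈ circ a b A)
    (hu : IsPotential G ρ σ x₀ u) {z : ℝ × ℝ} (hz : z ∈ rect a b c₁ c₂) :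
    ContDiffAt ℝ 2 (fun y => Real.log (√(σ y) * u y)) z ∧
      lap (fun y => Real.log (√(σ y) * u y)) z +
        (pdx (fun y => Real.log (√(σ y) * u y)) z ^ 2 +
          pdy (fun y => Real.log (√(σ y) * u y)) z ^ 2) = -coeff σ z := by
  have hzG : z ∈ G := h.disk_subset (h.rect_subset hz)
  have hGz := h.isOpen.mem_nhds hzG
  have hσz : ContDiffAt ℝ 2 σ z := (hσ.contDiffOn.mono subset_closure).contDiffAt hGz
  have huz : ContDiffAt ℝ 2 u z := (hu.contDiffOn.mono subset_closure).contDiffAt hGz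
  have hσ0 : 0 < σ z := zero_lt_one.trans_le (hσ.one_le z hzG)
  have hu0 := hu.pos h hσ hx₀ z hzG
  set s := fun y => √(σ y) with hs
  have hsz : ContDiffAt ℝ 2 s z := hσz.sqrt hσ0.ne'
  have hs0 : 0 < s z := Real.sqrt_pos.2 hσ0
  have hp0 : s z * u z ≠ 0 := (mul_pos hs0 hu0).ne'
  have hp : ContDiffAt ℝ 2 (fun y => s y * u y) z := hsz.mul huz
  refine ⟨hp.log hp0, ?_⟩
  have k1 := dirD_dirD_log (v := (1, 0)) hp hp0
  have k2 := dirD_dirD_log (v := (0, 1)) hp hp0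
  rw [dirD_dirD_mul hsz huz] at k1 k2
  have hss : σ =ᶠ[nhds z] fun y => s y * s y := by
    filter_upwards [hGz] with y hy
    rw [hs]
    exact (Real.mul_self_sqrt (zero_le_one.trans (hσ.one_le y hy))).symm
  have hsd := hsz.differentiableAt (by simp)
  have hd : ∀ v, dirD v σ z = 2 * s z * dirD v s z := fun v => by
    rw [dirD_congr hss, dirD_mul hsd hsd]; ring
  have heq : divGrad σ u z = 0 := by
    refine (hu.equation z hzG).trans ?_
    rw [h.source_eq_zero x₀ hx₀ z (subset_closure hz), neg_zero]
  rw [divGrad_eq hσz huz, hd, hd, hss.self_of_nhds] at heq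
  have heq' : s z * lap u z + 2 * (dirD (1, 0) s z * dirD (1, 0) u z +
      dirD (0, 1) s z * dirD (0, 1) u z) = 0 := by
    refine (mul_eq_zero.1 ?_).resolve_left hs0.ne'
    linarith
  have e : ∀ f : ℝ × ℝ → ℝ, lap f z =
    dirD (1, 0) (dirD (1, 0) f) z + dirD (0, 1) (dirD (0, 1) f) z := fun _ => rfl
  have ex : ∀ f : ℝ × ℝ → ℝ, pdx f z = dirD (1, 0) f z := fun _ => rfl
  have ey : ∀ f : ℝ × ℝ → ℝ, pdy f z = dirD (0, 1) f z := fun _ => rfl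
  have hc : -coeff σ z = lap s z / s z := by rw [coeff, neg_neg]
  rw [hc, ex, ey, e, e]
  rw [e] at heq'
  have : lap s z / s z = (u z * lap s z) / (s z * u z) := by field_simp
  rw [e] at this
  rw [this]
  refine Eq.trans ?_ (?_ : (s z * dirD (1, 0) (dirD (1, 0) u) z +
    2 * (dirD (1, 0) s z * dirD (1, 0) u z) + u z * dirD (1, 0) (dirD (1, 0) s) z) / (s z * u z) +
    (s z * dirD (0, 1) (dirD (0, 1) u) z + 2 * (dirD (0, 1) s z * dirD (0, 1) u z) +
      u z * dirD (0, 1) (dirD (0, 1) s) z) / (s z * u z) = _)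
  · rw [← k1, ← k2]; ring
  · rw [← add_div]
    congr 1
    linarith

end Forward

/-! ### Weak derivatives of functions of class `C²` -/

section Weak

variable {Ω : Set (ℝ × ℝ)}

theorem integrable_mul_isTest (hΩ : IsOpen Ω) {g η : ℝ × ℝ → ℝ} (hg : ContinuousOn g Ω)
    (hη : Continuous η) (hc : HasCompactSupport η) (hs : tsupport η ⊆ Ω) :
    Integrable fun z => g z * η z := by
  refine Continuous.integrable_of_hasCompactSupport (continuous_of_tsupport fun z hz => ?_)
    hc.mul_left
  have : z ∈ Ω := hs (tsupport_mul_subset_right hz)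
  exact (hg.continuousAt (hΩ.mem_nhds this)).mul hη.continuousAt

theorem setIntegral_mul_isTest {g η : ℝ × ℝ → ℝ} (hs : tsupport η ⊆ Ω) :
    ∫ z in Ω, g z * η z = ∫ z, g z * η z :=
  setIntegral_eq_integral_of_forall_compl_eq_zero fun z hz => by
    rw [image_eq_zero_of_notMem_tsupport fun h => hz (hs h), mul_zero]

theorem IsTest.dirD {η : ℝ × ℝ → ℝ} (hη : IsTest Ω η) (v : ℝ × ℝ) : IsTest Ω (dirD v η) :=
  ⟨(hη.1.fderiv_right (m := ∞) (by simp)).clm_apply contDiff_const, hη.2.1.fderiv_apply ℝ v,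
    (tsupport_fderiv_apply_subset ℝ v).trans hη.2.2⟩

theorem setIntegral_mul_dirD (hΩ : IsOpen Ω) {g η : ℝ × ℝ → ℝ} (hg : ContDiffOn ℝ 1 g Ω)
    (hη : IsTest Ω η) (v : ℝ × ℝ) :
    ∫ z in Ω, g z * dirD v η z = -∫ z in Ω, dirD v g z * η z := by
  have hη' := hη.dirD v
  rw [setIntegral_mul_isTest hη'.2.2, setIntegral_mul_isTest hη.2.2]
  have hgc : ContinuousOn (dirD v g) Ω := by
    have := hg.continuousOn_fderiv_of_isOpen hΩ le_rfl
    exact this.clm_apply continuousOn_const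
  refine integral_mul_fderiv_eq_neg_fderiv_mul_of_integrable ?_ ?_ ?_ ?_ ?_
  · exact integrable_mul_isTest hΩ hgc hη.1.continuous hη.2.1 hη.2.2
  · exact integrable_mul_isTest hΩ hg.continuousOn hη'.1.continuous hη'.2.1 hη'.2.2
  · exact integrable_mul_isTest hΩ hg.continuousOn hη.1.continuous hη.2.1 hη.2.2
  · exact fun z hz => (hg.contDiffAt (hΩ.mem_nhds (hη.2.2 hz))).differentiableAt (by simp)
  · exact fun z _ => hη.1.contDiffAt.differentiableAt (by simp)

/-- The fundamental lemma of the calculus of variations: weak derivatives are determined by the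
function. It identifies the weak derivatives of the exact pair with classical ones. -/
theorem der_ae_eq [IsFiniteMeasure (volume.restrict Ω)] (hΩ : IsOpen Ω) {u : H3 Ω}
    {g D : ℝ × ℝ → ℝ} {i j : ℕ}
    (hij : i + j ≤ 3) (hu : val u =ᵐ[volume.restrict Ω] g) (hD : ContinuousOn D Ω)
    (h : ∀ η, IsTest Ω η → ∫ z in Ω, g z * pd i j η z = (-1) ^ (i + j) * ∫ z in Ω, D z * η z) :
    der u i j =ᵐ[volume.restrict Ω] D := by
  have hint : IntegrableOn (der u i j) Ω := (Lp.memLp (der u i j)).integrable (by norm_num)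
  have key := hΩ.ae_eq_zero_of_integral_contDiff_smul_eq_zero (μ := volume)
    (f := fun z => der u i j z - D z)
    (hint.locallyIntegrableOn.sub (hD.locallyIntegrableOn hΩ.measurableSet)) ?_
  · refine (ae_restrict_iff' hΩ.measurableSet).2 ?_
    filter_upwards [key] with z hz hzΩ
    exact sub_eq_zero.1 (hz hzΩ)
  · intro η h1 h2 h3
    have hη : IsTest Ω η := ⟨h1, h2, h3⟩
    have e1 : ∫ z, η z • (der u i j z - D z) = ∫ z in Ω, (der u i j z - D z) * η z := by
      rw [setIntegral_mul_isTest h3]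
      exact integral_congr_ae (Filter.Eventually.of_forall fun z => by simp [mul_comm])
    have e2 : ∫ z in Ω, (der u i j z - D z) * η z =
        (∫ z in Ω, der u i j z * η z) - ∫ z in Ω, D z * η z := by
      rw [← integral_sub (integrable_mul_test hη _)
        (integrable_mul_isTest hΩ hD h1.continuous h2 h3).integrableOn]
      exact integral_congr_ae (Filter.Eventually.of_forall fun z => by simp [sub_mul])
    have e3 := integral_der_mul_pd u hij hη
    have e4 : ∫ z in Ω, der u 0 0 z * pd i j η z = ∫ z in Ω, g z * pd i j η z := by
      refine integral_congr_ae ?_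
      filter_upwards [hu] with z hz
      rw [← hz]; rfl
    rw [e4, h η hη] at e3
    rw [e1, e2, mul_left_cancel₀ (pow_ne_zero _ (by norm_num)) e3, sub_self]

theorem classical_derivatives [IsFiniteMeasure (volume.restrict Ω)] (hΩ : IsOpen Ω) {u : H3 Ω}
    {g : ℝ × ℝ → ℝ} (hg : ContDiffOn ℝ 2 g Ω) (hu : val u =ᵐ[volume.restrict Ω] g) :
    dx u =ᵐ[volume.restrict Ω] pdx g ∧ dy u =ᵐ[volume.restrict Ω] pdy g ∧
      dxx u =ᵐ[volume.restrict Ω] pdx (pdx g) ∧ dyy u =ᵐ[volume.restrict Ω] pdy (pdy g) := by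
  have hg1 : ContDiffOn ℝ 1 g Ω := hg.of_le (by norm_num)
  have hd : ∀ v, ContDiffOn ℝ 1 (dirD v g) Ω := fun v z hz =>
    (contDiffAt_dirD (hg.contDiffAt (hΩ.mem_nhds hz)) v).contDiffWithinAt
  have hdd : ∀ v, ContinuousOn (dirD v (dirD v g)) Ω := fun v =>
    ((hd v).continuousOn_fderiv_of_isOpen hΩ le_rfl).clm_apply continuousOn_const
  have h1 : ∀ η, IsTest Ω η → ∀ v, ∫ z in Ω, g z * dirD v η z = -∫ z in Ω, dirD v g z * η z :=
    fun η hη v => setIntegral_mul_dirD hΩ hg1 hη v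
  have h2 : ∀ η, IsTest Ω η → ∀ v,
      ∫ z in Ω, g z * dirD v (dirD v η) z = ∫ z in Ω, dirD v (dirD v g) z * η z := fun η hη v => by
    rw [setIntegral_mul_dirD hΩ hg1 (hη.dirD v) v, setIntegral_mul_dirD hΩ (hd v) hη v, neg_neg]
  refine ⟨?_, ?_, ?_, ?_⟩
  · refine der_ae_eq hΩ (i := 1) (j := 0) (by norm_num) hu (hd (1, 0)).continuousOn fun η hη => ?_
    refine (h1 η hη (1, 0)).trans ?_
    norm_num
    rfl
  · refine der_ae_eq hΩ (i := 0) (j := 1) (by norm_num) hu (hd (0, 1)).continuousOn fun η hη => ?_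
    refine (h1 η hη (0, 1)).trans ?_
    norm_num
    rfl
  · refine der_ae_eq hΩ (i := 2) (j := 0) (by norm_num) hu (hdd (1, 0)) fun η hη => ?_
    refine (h2 η hη (1, 0)).trans ?_
    norm_num
    rfl
  · refine der_ae_eq hΩ (i := 0) (j := 2) (by norm_num) hu (hdd (0, 1)) fun η hη => ?_
    refine (h2 η hη (0, 1)).trans ?_
    norm_num
    rfl

end Weak

end EIT


namespace EIT

/-! ### The reconstruction map -/

section Quad

variable {H Y : Type*} [NormedAddCommGroup H] [InnerProductSpace ℝ H]
  [NormedAddCommGroup Y] [InnerProductSpace ℝ Y]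

theorem norm_quadMap_sub_le (S : H →L[ℝ] Y) (B : H →L[ℝ] H →L[ℝ] Y) {ρ : ℝ} {x y : H}
    (hx : ‖x‖ ≤ ρ) (hy : ‖y‖ ≤ ρ) :
    ‖quadMap S B x - quadMap S B y‖ ≤ (‖S‖ + 2 * ‖B‖ * ρ) * ‖x - y‖ := by
  have e : quadMap S B x - quadMap S B y = S (x - y) + (B (x - y) x + B y (x - y)) := by
    simp [quadMap]; abel
  rw [e]
  have h1 := norm_add_le (S (x - y)) (B (x - y) x + B y (x - y))
  have h2 := norm_add_le (B (x - y) x) (B y (x - y))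
  have h3 := S.le_opNorm (x - y)
  have h4 := B.le_opNorm₂ (x - y) x
  have h5 := B.le_opNorm₂ y (x - y)
  have h6 := mul_le_mul_of_nonneg_left hx (by positivity : 0 ≤ ‖B‖ * ‖x - y‖)
  have h7 := mul_le_mul_of_nonneg_left hy (by positivity : 0 ≤ ‖B‖ * ‖x - y‖)
  linarith

end Quad

section Reconstruction

variable {a b c₁ c₂ : ℝ}

/-- The integrand `Δw + |∇w|²` of the reconstruction formula, with `w = (r - s) / ε`. -/
noncomputable def reconIntegrand {Ω : Set (ℝ × ℝ)} (ε : ℝ) (x : Pair Ω) (z : ℝ × ℝ) : ℝ :=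
  ((dxx x.fst z - dxx x.snd z) / ε + (dyy x.fst z - dyy x.snd z) / ε) +
    (((dx x.fst z - dx x.snd z) / ε) ^ 2 + ((dy x.fst z - dy x.snd z) / ε) ^ 2)

theorem ae_der_quotient {Ω : Set (ℝ × ℝ)} (ε : ℝ) (x : Pair Ω) : ∀ᵐ z ∂(volume.restrict Ω),
    val (ε⁻¹ • (x.fst - x.snd)) z = (val x.fst z - val x.snd z) / ε ∧
    dx (ε⁻¹ • (x.fst - x.snd)) z = (dx x.fst z - dx x.snd z) / ε ∧
    dy (ε⁻¹ • (x.fst - x.snd)) z = (dy x.fst z - dy x.snd z) / ε ∧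
    dxx (ε⁻¹ • (x.fst - x.snd)) z = (dxx x.fst z - dxx x.snd z) / ε ∧
    dyy (ε⁻¹ • (x.fst - x.snd)) z = (dyy x.fst z - dyy x.snd z) / ε := by
  have key : ∀ i j, ∀ᵐ z ∂(volume.restrict Ω),
      der (ε⁻¹ • (x.fst - x.snd)) i j z = (der x.fst i j z - der x.snd i j z) / ε := by
    intro i j
    rw [der_smul, der_sub]
    filter_upwards [Lp.coeFn_smul ε⁻¹ (der x.fst i j - der x.snd i j),
      Lp.coeFn_sub (der x.fst i j) (der x.snd i j)] with z h1 h2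
    rw [h1, Pi.smul_apply, h2, Pi.sub_apply, smul_eq_mul, div_eq_inv_mul]
  filter_upwards [key 0 0, key 1 0, key 0 1, key 2 0, key 0 2] with z h0 h1 h2 h3 h4
  exact ⟨h0, h1, h2, h3, h4⟩

/-- The integrand is again a quadratic map from `H³ × H³` to `L²`, hence Lipschitz on balls. -/
theorem exists_recon (h₁ : 0 < c₁) (h₂ : 0 < c₂) (ε : ℝ) :
    ∃ T : Pair (rect a b c₁ c₂) → L2 (rect a b c₁ c₂), Continuous T ∧
      (∀ x, T x =ᵐ[volume.restrict (rect a b c₁ c₂)] reconIntegrand ε x) ∧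
      ∀ ρ, ∃ K, 0 ≤ K ∧ ∀ x y, ‖x‖ ≤ ρ → ‖y‖ ≤ ρ → ‖T x - T y‖ ≤ K * ‖x - y‖ := by
  obtain ⟨G, hG⟩ := exists_gradMul (a := a) (b := b) h₁ h₂
  let p₁ := WithLp.fstL 2 ℝ (H3 (rect a b c₁ c₂)) (H3 (rect a b c₁ c₂))
  let p₂ := WithLp.sndL 2 ℝ (H3 (rect a b c₁ c₂)) (H3 (rect a b c₁ c₂))
  let π := ε⁻¹ • (p₁ - p₂)
  refine ⟨quadMap ((lapL _).comp π) (G.bilinearComp π π), ?_, fun x => ?_, fun ρ => ?_⟩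
  · exact continuous_iff_continuousAt.2 fun x => (hasFDerivAt_quadMap _ _ x).continuousAt
  · have e : quadMap ((lapL _).comp π) (G.bilinearComp π π) x =
        lapL _ (ε⁻¹ • (x.fst - x.snd)) + G (ε⁻¹ • (x.fst - x.snd)) (ε⁻¹ • (x.fst - x.snd)) := rfl
    rw [e]
    filter_upwards [Lp.coeFn_add (lapL _ (ε⁻¹ • (x.fst - x.snd)))
      (G (ε⁻¹ • (x.fst - x.snd)) (ε⁻¹ • (x.fst - x.snd))), coeFn_lapL (ε⁻¹ • (x.fst - x.snd)),
      hG (ε⁻¹ • (x.fst - x.snd)) (ε⁻¹ • (x.fst - x.snd)), ae_der_quotient ε x] with z k1 k2 k3 k4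
    rw [k1, Pi.add_apply, k2, k3, k4.2.1, k4.2.2.1, k4.2.2.2.1, k4.2.2.2.2, reconIntegrand]
    ring
  · refine ⟨‖(lapL _).comp π‖ + 2 * ‖G.bilinearComp π π‖ * max ρ 0, by positivity,
      fun x y hx hy => norm_quadMap_sub_le _ _ (hx.trans (le_max_left _ _))
        (hy.trans (le_max_left _ _))⟩

/-- The reconstruction formula is exact for the exact pair. -/
theorem reconIntegrand_exact {ε A ρ : ℝ} (hε : 0 < ε) {G : Set (ℝ × ℝ)} {σ : ℝ × ℝ → ℝ}
    {u : ℝ × ℝ → ℝ × ℝ → ℝ} (hG : IsSetting a b c₁ c₂ A ρ G)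
    (hσ : IsConductivity G (rect a b c₁ c₂) σ)
    (hu : ∀ x₀ ∈ circ a b A, IsPotential G ρ σ x₀ (fun z => u z x₀))
    {X : H₂ (rect a b c₁ c₂)} (hX : IsExactPair a b A ε σ u X) (φ : Angle) :
    reconIntegrand ε (X.1 φ) =ᵐ[volume.restrict (rect a b c₁ c₂)] fun z => -coeff σ z := by
  have hx₀ := sourcePoint_mem_circ a b A φ
  have hlog := fun z hz => contDiffAt_log_potential hG hσ hx₀ (hu _ hx₀) (z := z) hz
  set g : ℝ × ℝ → ℝ := fun y => Real.log (√(σ y) * u y (sourcePoint a b A φ)) with hg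
  -- Since `s* = r* - εw*`, the quotient `(r* - s*)/ε` is the logarithmic potential itself, with no
  -- derivative in the angle.
  have hval : val (ε⁻¹ • ((X.1 φ).fst - (X.1 φ).snd)) =ᵐ[volume.restrict (rect a b c₁ c₂)] g := by
    filter_upwards [ae_der_quotient ε (X.1 φ), hX φ] with z k1 k2
    rw [k1.1, k2.2, sub_sub_cancel, mul_div_cancel_left₀ _ hε.ne']
    rfl
  obtain ⟨d1, d2, d3, d4⟩ := classical_derivatives isOpen_rect
    (fun z hz => (hlog z hz).1.contDiffWithinAt) hval
  filter_upwards [ae_der_quotient ε (X.1 φ), d1, d2, d3, d4,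
    ae_restrict_mem isOpen_rect.measurableSet] with z k e1 e2 e3 e4 hz
  rw [reconIntegrand, ← k.2.1, ← k.2.2.1, ← k.2.2.2.1, ← k.2.2.2.2, e1, e2, e3, e4]
  exact (hlog z hz).2

end Reconstruction

end EIT


namespace EIT

/-! ### Bounded measurable families -/

section Families

variable {Ω Γ : Set (ℝ × ℝ)}

theorem exists_family {f : Angle → Pair Ω} (hf : StronglyMeasurable f) {C : ℝ}
    (hC : ∀ φ, ‖f φ‖ ≤ C) : ∃ X : H₂ Ω, ∀ φ, X.1 φ = f φ :=
  ⟨⟨⟨f, memℓp_infty ⟨C, by rintro _ ⟨φ, rfl⟩; exact hC φ⟩⟩, hf⟩, fun _ => rfl⟩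

theorem norm_apply_le (X : H₂ Ω) (φ : Angle) : ‖X.1 φ‖ ≤ ‖X‖ :=
  lp.norm_apply_le_norm (by simp) X.1 φ

theorem norm_family_le {X : H₂ Ω} {C : ℝ} (hC : 0 ≤ C) (h : ∀ φ, ‖X.1 φ‖ ≤ C) : ‖X‖ ≤ C :=
  lp.norm_le_of_forall_le hC h

theorem family_ext {X Y : H₂ Ω} (h : ∀ φ, X.1 φ = Y.1 φ) : X = Y :=
  Subtype.ext (lp.ext (funext h))

theorem HasBoundaryValues.add_mem {u v : H3 Ω} {β₀ β₁ : ℝ × ℝ → ℝ}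
    (hu : HasBoundaryValues Γ u β₀ β₁) (hv : v ∈ H3₀ Ω Γ) : HasBoundaryValues Γ (u + v) β₀ β₁ := by
  obtain ⟨⟨U, hU, hUu, hU0⟩, ⟨U', hU', hUu', hU0'⟩⟩ := hu
  obtain ⟨⟨V, hV, hVv, hV0⟩, ⟨V', hV', hVv', hV0'⟩⟩ := hv
  refine ⟨⟨U + V, hU.add hV, ?_, fun z hz => by simp [hU0 z hz, hV0 z hz]⟩,
    ⟨U' + V', hU'.add hV', ?_, fun z hz => by simp [hU0' z hz, hV0' z hz]⟩⟩
  · exact (Lp.coeFn_add (val u) (val v)).trans (hUu.add hVv)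
  · exact (Lp.coeFn_add (dx u) (dx v)).trans (hUu'.add hVv')

theorem HasBoundaryValues.sub_mem {u v : H3 Ω} {β₀ β₁ : ℝ × ℝ → ℝ}
    (hu : HasBoundaryValues Γ u β₀ β₁) (hv : HasBoundaryValues Γ v β₀ β₁) : u - v ∈ H3₀ Ω Γ := by
  obtain ⟨⟨U, hU, hUu, hU0⟩, ⟨U', hU', hUu', hU0'⟩⟩ := hu
  obtain ⟨⟨V, hV, hVv, hV0⟩, ⟨V', hV', hVv', hV0'⟩⟩ := hv
  refine ⟨⟨U - V, hU.sub hV, ?_, fun z hz => by simp [hU0 z hz, hV0 z hz]⟩,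
    ⟨U' - V', hU'.sub hV', ?_, fun z hz => by simp [hU0' z hz, hV0' z hz]⟩⟩
  · exact (Lp.coeFn_sub (val u) (val v)).trans (hUu.sub hVv)
  · exact (Lp.coeFn_sub (dx u) (dx v)).trans (hUu'.sub hVv')

theorem MatchesData.sub_mem {ε : ℝ} {g₀ g₁ : ℝ × ℝ → ℝ → ℝ} {X Y : H₂ Ω}
    (hX : MatchesData Γ ε g₀ g₁ X) (hY : MatchesData Γ ε g₀ g₁ Y) (φ : Angle) :
    X.1 φ - Y.1 φ ∈ Pair₀ Ω Γ :=
  ⟨(hX φ).1.sub_mem (hY φ).1, (hX φ).2.sub_mem (hY φ).2⟩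

theorem MatchesData.of_sub_mem {ε : ℝ} {g₀ g₁ : ℝ × ℝ → ℝ → ℝ} {X Y : H₂ Ω}
    (hX : MatchesData Γ ε g₀ g₁ X) (h : ∀ φ, Y.1 φ - X.1 φ ∈ Pair₀ Ω Γ) :
    MatchesData Γ ε g₀ g₁ Y := by
  intro φ
  have e1 : (Y.1 φ).fst = (X.1 φ).fst + (Y.1 φ - X.1 φ).fst := (add_sub_cancel _ _).symm
  have e2 : (Y.1 φ).snd = (X.1 φ).snd + (Y.1 φ - X.1 φ).snd := (add_sub_cancel _ _).symm
  rw [e1, e2]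
  exact ⟨(hX φ).1.add_mem (h φ).1, (hX φ).2.add_mem (h φ).2⟩

/-! ### Minimizers and the gradient descent for families -/

variable {ε lam α R : ℝ} {dJ : Pair Ω → Pair Ω →L[ℝ] ℝ}

/-- The problem decouples over the angles: a competitor at a single angle extends to a constant
family, which is measurable and has the same norm. -/
theorem isMinimizer_iff (hR : 0 ≤ R) {P M : H₂ Ω} : IsMinimizer Γ ε lam α R P M ↔
    ∀ φ, ConvexOnBall.IsMin (Pair₀ Ω Γ) (J ε lam α) R (P.1 φ) (M.1 φ) := by
  constructor
  · rintro ⟨⟨h1, h2⟩, h3⟩ φ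
    refine ⟨h2 φ, (norm_apply_le (M - P) φ).trans h1, fun q hq hqn => ?_⟩
    obtain ⟨Q, hQ⟩ := exists_family (Ω := Ω) (f := fun _ => q - P.1 φ) stronglyMeasurable_const
      (fun _ => le_rfl)
    have := h3 Q ⟨norm_family_le (by positivity) fun ψ => by rw [hQ]; exact hqn,
      fun ψ => by rw [hQ]; exact hq⟩ φ
    have e : (Q + P).1 φ = q := by
      change Q.1 φ + P.1 φ = q
      rw [hQ, sub_add_cancel]
    rwa [e] at this
  · intro h
    refine ⟨⟨norm_family_le (by positivity) fun φ => (h φ).2.1, fun φ => (h φ).1⟩,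
      fun Q hQ φ => (h φ).2.2 _ ?_ ?_⟩
    · change Q.1 φ + P.1 φ - P.1 φ ∈ _
      rw [add_sub_cancel_right]
      exact hQ.2 φ
    · change ‖Q.1 φ + P.1 φ - P.1 φ‖ ≤ _
      rw [add_sub_cancel_right]
      exact (norm_apply_le Q φ).trans hQ.1

theorem existsUnique_isMinimizer (hV : IsClosed (Pair₀ Ω Γ : Set (Pair Ω)))
    (h : ConvexOnBall (Pair₀ Ω Γ) (J ε lam α) dJ R α) {P : H₂ Ω} (hP : ‖P‖ ≤ R) :
    ∃! M : H₂ Ω, IsMinimizer Γ ε lam α R P M := by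
  have hR := h.radius_pos
  have hPφ : ∀ φ, ‖P.1 φ‖ ≤ R := fun φ => (norm_apply_le P φ).trans hP
  have hex : ∀ p, ∃ m, ‖p‖ ≤ R → ConvexOnBall.IsMin (Pair₀ Ω Γ) (J ε lam α) R p m := by
    intro p
    by_cases hp : ‖p‖ ≤ R
    · obtain ⟨m, hm⟩ := h.exists_isMin hV hp
      exact ⟨m, fun _ => hm⟩
    · exact ⟨0, fun hp' => absurd hp' hp⟩
  choose T hT using hex
  have hTc := h.continuousOn_of_isMin hT
  -- The minimizer map `T` is continuous only on the ball. Composition with the radial retraction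
  -- onto the ball makes it continuous everywhere without changing it at the values of `P`, and
  -- measurability in the angle follows.
  let r : Pair Ω → Pair Ω := fun x => (R / max R ‖x‖) • x
  have hmax : ∀ x : Pair Ω, 0 < max R ‖x‖ := fun x => lt_max_of_lt_left hR
  have hrc : Continuous r :=
    (continuous_const.div (continuous_const.max continuous_norm) fun x => (hmax x).ne').smul
      continuous_id
  have hr1 : ∀ x, r x ∈ Metric.closedBall (0 : Pair Ω) R := by
    intro x
    rw [mem_closedBall_zero_iff, norm_smul, Real.norm_of_nonneg (div_nonneg hR.le (hmax x).le),
      div_mul_eq_mul_div, div_le_iff₀ (hmax x)]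
    exact mul_le_mul_of_nonneg_left (le_max_right _ _) hR.le
  have hr2 : ∀ x, ‖x‖ ≤ R → r x = x := by
    intro x hx
    change (R / max R ‖x‖) • x = x
    rw [max_eq_left hx, div_self hR.ne', one_smul]
  obtain ⟨M, hM⟩ := exists_family (f := fun φ => T (r (P.1 φ)))
    ((hTc.comp_continuous hrc hr1).comp_stronglyMeasurable P.2) (C := 3 * R) (fun φ => by
      rw [hr2 _ (hPφ φ)]
      exact ConvexOnBall.norm_le_of_sub (hPφ φ) (hT _ (hPφ φ)).2.1)
  refine ⟨M, (isMinimizer_iff hR.le).2 fun φ => ?_, fun M' hM' => family_ext fun φ => ?_⟩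
  · rw [hM, hr2 _ (hPφ φ)]
    exact hT _ (hPφ φ)
  · have := (isMinimizer_iff hR.le).1 hM' φ
    rw [hM, hr2 _ (hPφ φ)]
    exact h.isMin_unique (hPφ φ) this (hT _ (hPφ φ))

theorem isDescent_iff [CompleteSpace (Pair₀ Ω Γ)]
    (h : ConvexOnBall (Pair₀ Ω Γ) (J ε lam α) dJ R α) {γ : ℝ} {X₀ : H₂ Ω} {X : ℕ → H₂ Ω} :
    IsDescent Γ ε lam α γ X₀ X ↔ X 0 = X₀ ∧ ∀ n φ, (X (n + 1)).1 φ =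
      (X n).1 φ - γ • (ConvexOnBall.grad (Pair₀ Ω Γ) dJ ((X n).1 φ) : Pair Ω) := by
  refine and_congr_right fun _ => forall_congr' fun n => forall_congr' fun φ => ?_
  constructor
  · rintro ⟨g, hg, he⟩
    rwa [(h.isGradient_iff _ _).1 hg] at he
  · exact fun he => ⟨_, (h.isGradient_iff _ _).2 rfl, he⟩

/-- A gradient step is continuous and maps bounded sets to bounded sets, so it acts on bounded
strongly measurable families. -/
theorem existsUnique_isDescent [CompleteSpace (Pair₀ Ω Γ)]
    (h : ConvexOnBall (Pair₀ Ω Γ) (J ε lam α) dJ R α) (γ : ℝ) (X₀ : H₂ Ω) :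
    ∃! X : ℕ → H₂ Ω, IsDescent Γ ε lam α γ X₀ X := by
  have hstep : ∀ X : H₂ Ω, ∃ Y : H₂ Ω, ∀ φ, Y.1 φ =
      X.1 φ - γ • (ConvexOnBall.grad (Pair₀ Ω Γ) dJ (X.1 φ) : Pair Ω) := by
    intro X
    obtain ⟨K, hK⟩ := h.exists_norm_grad_le ‖X‖
    have hc : Continuous fun x : Pair Ω =>
        x - γ • (ConvexOnBall.grad (Pair₀ Ω Γ) dJ x : Pair Ω) :=
      continuous_id.sub ((continuous_subtype_val.comp h.continuous_grad).const_smul γ)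
    refine exists_family (hc.comp_stronglyMeasurable X.2) (C := ‖X‖ + |γ| * K) fun φ => ?_
    refine (norm_sub_le _ _).trans (add_le_add (norm_apply_le X φ) ?_)
    rw [norm_smul, Real.norm_eq_abs]
    exact mul_le_mul_of_nonneg_left (hK _ (norm_apply_le X φ)) (abs_nonneg γ)
  choose s hs using hstep
  refine ⟨fun n => s^[n] X₀, (isDescent_iff h).2 ⟨rfl, fun n φ => ?_⟩, fun X hX => ?_⟩
  · simp only [Function.iterate_succ_apply']
    exact hs _ φ
  · obtain ⟨h0, h1⟩ := (isDescent_iff h).1 hX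
    funext n
    induction n with
    | zero => exact h0
    | succ n ih =>
      rw [Function.iterate_succ_apply', ← ih]
      exact family_ext fun φ => (h1 n φ).trans (hs _ φ).symm

/-- Linear convergence of the gradient descent to an interior minimizer. -/
theorem norm_descent_sub_le [CompleteSpace (Pair₀ Ω Γ)]
    (h : ConvexOnBall (Pair₀ Ω Γ) (J ε lam α) dJ R α) {L γ θ : ℝ} (hγ : 0 ≤ γ)
    (hL : ∀ x y, ‖x‖ ≤ 3 * R → ‖y‖ ≤ 3 * R → ‖dJ x - dJ y‖ ≤ L * ‖x - y‖)
    (hγL : γ * L ^ 2 ≤ α) (hθ0 : 0 ≤ θ) (hθ1 : θ ≤ 1) (hθ : θ ^ 2 = 1 - α * γ)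
    {P M X₀ : H₂ Ω} {X : ℕ → H₂ Ω} (hP : ‖P‖ < R) (hM : IsMinimizer Γ ε lam α R P M)
    (hMR : ‖M‖ < R / 3) (hX₀ : ‖X₀‖ < R / 3) (hXP : ∀ φ, X₀.1 φ - P.1 φ ∈ Pair₀ Ω Γ)
    (hX : IsDescent Γ ε lam α γ X₀ X) (n : ℕ) :
    (∀ φ, (X n).1 φ - X₀.1 φ ∈ Pair₀ Ω Γ) ∧ ∀ φ, ‖(X n).1 φ - M.1 φ‖ ≤ θ ^ n * ‖M - X₀‖ := by
  have hR := h.radius_pos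
  obtain ⟨h0, h1⟩ := (isDescent_iff h).1 hX
  have hmin := (isMinimizer_iff hR.le).1 hM
  have hMX : ‖M - X₀‖ ≤ 2 * R / 3 := (norm_sub_le _ _).trans (by linarith)
  -- The minimizer is at distance less than `R/3 + R < 2R` from `P`, so the constraint is inactive.
  have hgrad : ∀ φ, ConvexOnBall.grad (Pair₀ Ω Γ) dJ (M.1 φ) = 0 := fun φ =>
    h.grad_eq_zero_of_isMin (hmin φ) (by
      have e1 := norm_apply_le M φ
      have e2 := norm_apply_le P φ
      have e3 := norm_sub_le (M.1 φ) (P.1 φ)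
      linarith)
  induction n with
  | zero =>
    rw [h0]
    refine ⟨fun φ => by rw [sub_self]; exact zero_mem _, fun φ => ?_⟩
    rw [pow_zero, one_mul, norm_sub_rev]
    exact norm_apply_le (M - X₀) φ
  | succ n ih =>
    obtain ⟨ih1, ih2⟩ := ih
    constructor
    · intro φ
      rw [h1, sub_right_comm]
      exact sub_mem (ih1 φ) (Submodule.smul_mem _ _ (Subtype.prop _))
    · intro φ
      have hMφ : ‖M.1 φ‖ ≤ R / 3 := (norm_apply_le M φ).trans hMR.le
      -- The contraction itself keeps the iterates in the region of convexity: within `2R/3` of `M`,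
      -- which is within `R/3` of the origin.
      have hd : ‖(X n).1 φ - M.1 φ‖ ≤ 2 * R / 3 := (ih2 φ).trans
        ((mul_le_of_le_one_left (norm_nonneg _) (pow_le_one₀ hθ0 hθ1)).trans hMX)
      have hXn : ‖(X n).1 φ‖ ≤ 3 * R := by
        have := norm_add_le ((X n).1 φ - M.1 φ) (M.1 φ)
        rw [sub_add_cancel] at this
        linarith
      have hmem : (X n).1 φ - M.1 φ ∈ Pair₀ Ω Γ := by
        have e : (X n).1 φ - M.1 φ =
            ((X n).1 φ - X₀.1 φ) + (X₀.1 φ - P.1 φ) - (M.1 φ - P.1 φ) := by abel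
        rw [e]
        exact sub_mem (add_mem (ih1 φ) (hXP φ)) (hmin φ).1
      have hs := h.norm_step_le hγ hL hγL (by linarith) hXn hmem (hgrad φ)
      rw [← h1, ← hθ, ← mul_pow] at hs
      have h2 := abs_le_of_sq_le_sq' hs (mul_nonneg hθ0 (norm_nonneg _))
      refine h2.2.trans ?_
      rw [pow_succ', mul_assoc]
      exact mul_le_mul_of_nonneg_left (ih2 φ) hθ0

end Families

/-! ### The reconstructed coefficient -/

/-- The exact integrand is the same `L²` function for all angles, so the reconstruction error is the
mean over the angle of `T(X φ) - T(X' φ)`, bounded by the Lipschitz constant times the supremum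
norm. -/
theorem exists_reconstruction {a b c₁ c₂ ε K ρ : ℝ}
    {T : Pair (rect a b c₁ c₂) → L2 (rect a b c₁ c₂)} (hTc : Continuous T)
    (hT : ∀ x, T x =ᵐ[volume.restrict (rect a b c₁ c₂)] reconIntegrand ε x)
    (hK0 : 0 ≤ K) (hK : ∀ x y, ‖x‖ ≤ ρ → ‖y‖ ≤ ρ → ‖T x - T y‖ ≤ K * ‖x - y‖)
    {X X' : H₂ (rect a b c₁ c₂)} (hX : ‖X‖ ≤ ρ) (hX' : ‖X'‖ ≤ ρ) {k : ℝ × ℝ → ℝ}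
    (hk : ∀ φ, reconIntegrand ε (X'.1 φ) =ᵐ[volume.restrict (rect a b c₁ c₂)] fun z => -k z) :
    ∃ c, IsReconstruction ε X c ∧
      eLpNorm (fun z => c z - k z) 2 (volume.restrict (rect a b c₁ c₂)) ≤
        ENNReal.ofReal (K * ‖X - X'‖) := by
  have hemb : MeasurableEmbedding (Subtype.val : Angle → ℝ) :=
    MeasurableEmbedding.subtype_coe measurableSet_Ioo
  set F : ℝ → L2 (rect a b c₁ c₂) := Function.extend Subtype.val (fun φ => T (X.1 φ)) 0 with hF
  have hFφ : ∀ φ : Angle, F φ = T (X.1 φ) := fun φ => Subtype.val_injective.extend_apply _ _ φ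
  have hFm : StronglyMeasurable F :=
    hemb.stronglyMeasurable_extend (hTc.comp_stronglyMeasurable X.2) stronglyMeasurable_zero
  have hpi : (Real.pi : ℝ) ∈ Ioo (0 : ℝ) (2 * Real.pi) :=
    ⟨Real.pi_pos, by linarith [Real.pi_pos]⟩
  -- The exact coefficient as an element of `L²`; the angle `π` is an arbitrary choice.
  set κ : L2 (rect a b c₁ c₂) := -T (X'.1 ⟨Real.pi, hpi⟩) with hκ
  have hκk : κ =ᵐ[volume.restrict (rect a b c₁ c₂)] k := by
    filter_upwards [Lp.coeFn_neg (T (X'.1 ⟨Real.pi, hpi⟩)), hT (X'.1 ⟨Real.pi, hpi⟩),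
      hk ⟨Real.pi, hpi⟩] with z h1 h2 h3
    rw [hκ, h1, Pi.neg_apply, h2, h3, neg_neg]
  have hTκ : ∀ φ, T (X'.1 φ) = -κ := by
    intro φ
    refine Lp.ext ?_
    filter_upwards [Lp.coeFn_neg κ, hκk, hT (X'.1 φ), hk φ] with z h1 h2 h3 h4
    rw [h1, Pi.neg_apply, h2, h3, h4]
  have hbd : ∀ φ ∈ Ioo (0 : ℝ) (2 * Real.pi), ‖F φ + κ‖ ≤ K * ‖X - X'‖ := by
    intro φ hφ
    have e : F φ + κ = T (X.1 ⟨φ, hφ⟩) - T (X'.1 ⟨φ, hφ⟩) := by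
      rw [hTκ, sub_neg_eq_add, ← hFφ]
    rw [e]
    exact (hK _ _ ((norm_apply_le X _).trans hX) ((norm_apply_le X' _).trans hX')).trans
      (mul_le_mul_of_nonneg_left (norm_apply_le (X - X') _) hK0)
  have hint : IntegrableOn F (Ioo 0 (2 * Real.pi)) := by
    refine Integrable.of_bound hFm.aestronglyMeasurable (K * ‖X - X'‖ + ‖κ‖) ?_
    filter_upwards [ae_restrict_mem measurableSet_Ioo] with φ hφ
    have := norm_sub_le (F φ + κ) κ
    rw [add_sub_cancel_right] at this
    linarith [hbd φ hφ]
  refine ⟨-((1 / (2 * Real.pi)) • ∫ φ in Ioo 0 (2 * Real.pi), F φ),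
    ⟨F, fun φ => ?_, hint, rfl⟩, ?_⟩
  · rw [hFφ]; exact hT _
  set c := -((1 / (2 * Real.pi)) • ∫ φ in Ioo 0 (2 * Real.pi), F φ) with hc
  have h2pi : 0 < 2 * Real.pi := by linarith [Real.pi_pos]
  have hvol : volume.real (Ioo (0 : ℝ) (2 * Real.pi)) = 2 * Real.pi := by
    rw [Real.volume_real_Ioo_of_le h2pi.le, sub_zero]
  have e1 : c - κ = -((1 / (2 * Real.pi)) • ∫ φ in Ioo 0 (2 * Real.pi), (F φ + κ)) := by
    rw [integral_add hint (integrable_const κ), setIntegral_const, hvol, smul_add, smul_smul,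
      one_div_mul_cancel h2pi.ne', one_smul, neg_add, hc, sub_eq_add_neg]
  have e2 : ‖c - κ‖ ≤ K * ‖X - X'‖ := by
    have h1 := norm_setIntegral_le_of_norm_le_const (μ := volume) measure_Ioo_lt_top hbd
    rw [hvol] at h1
    rw [e1, norm_neg, norm_smul, Real.norm_of_nonneg (by positivity), one_div_mul_eq_div,
      div_le_iff₀ h2pi]
    exact h1
  have e3 : eLpNorm (fun z => c z - k z) 2 (volume.restrict (rect a b c₁ c₂)) =
      eLpNorm (c - κ) 2 (volume.restrict (rect a b c₁ c₂)) := by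
    refine eLpNorm_congr_ae ?_
    filter_upwards [Lp.coeFn_sub c κ, hκk] with z h1 h2
    rw [h1, Pi.sub_apply, h2]
  rw [e3, ← ENNReal.ofReal_toReal (Lp.eLpNorm_ne_top (c - κ)), ← Lp.norm_def]
  exact ENNReal.ofReal_le_ofReal e2

end EIT



/-! ### Choice of the constants and conclusion -/

theorem theorem5p3 (a b c₁ c₂ R ε : ℝ) (hc₁ : 0 < c₁) (hc₂ : 0 < c₂) (ha : 0 < a - c₁)
    (hR : 0 < R) (hε : ε ∈ Ioo (0 : ℝ) 1)
    (Ω Γ : Set (ℝ × ℝ)) (hΩ : Ω = rect a b c₁ c₂) (hΓ : Γ = rightSide a b c₁ c₂) :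
    ∃ Λ : ℝ, 1 ≤ Λ ∧ ∃ K : ℝ, 0 < K ∧
    ∀ lam : ℝ, Λ ≤ lam → ∀ ξ ∈ Ioo (0 : ℝ) 1,
    ∃ γ₀ ∈ Ioo (0 : ℝ) 1, ∀ γ ∈ Ioc (0 : ℝ) γ₀, ∃ θ ∈ Ioo (0 : ℝ) 1,
    ∀ (G : Set (ℝ × ℝ)) (A ρ : ℝ) (σ : ℝ × ℝ → ℝ) (u : ℝ × ℝ → ℝ × ℝ → ℝ)
      (g₀ g₁ g₀' g₁' : ℝ × ℝ → ℝ → ℝ) (P P' X' : H₂ Ω) (C : ℝ),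
    -- the exact conductivity, its potentials, the noiseless data and the exact pair
    IsSetting a b c₁ c₂ A ρ G → IsConductivity G Ω σ →
    (∀ x₀ ∈ circ a b A, IsPotential G ρ σ x₀ (fun z => u z x₀)) →
    (g₀' = fun z φ => u z (sourcePoint a b A φ)) →
    (g₁' = fun z φ => pdx (fun y => u y (sourcePoint a b A φ)) z) →
    IsExactPair a b A ε σ u X' →
    -- the noisy data, and the liftings of both data at distance less than the noise level
    IsData Ω Γ g₀ g₁ → P ∈ ballB Γ ε g₀ g₁ R → P' ∈ ballB Γ ε g₀' g₁' R → ‖P - P'‖ < ξ →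
    -- the a priori bound for the exact pair
    0 < C → 0 < R / 3 - C * ξ → X' ∈ ballB Γ ε g₀' g₁' (R / 3 - C * ξ) →
    (∃! M : H₂ Ω, IsMinimizer Γ ε lam (ξ ^ 2) R P M) ∧
    ∀ M : H₂ Ω, IsMinimizer Γ ε lam (ξ ^ 2) R P M → ‖M - X'‖ ≤ C * ξ →
    ∀ X₀ ∈ ballB Γ ε g₀ g₁ (R / 3),
      (∃! X : ℕ → H₂ Ω, IsDescent Γ ε lam (ξ ^ 2) γ X₀ X) ∧
      ∀ X : ℕ → H₂ Ω, IsDescent Γ ε lam (ξ ^ 2) γ X₀ X → ∀ n : ℕ,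
        X n ∈ ballB Γ ε g₀ g₁ R ∧
        ‖X n - X'‖ ≤ C * ξ + θ ^ n * ‖M - X₀‖ ∧
        ∃ c : L2 Ω, IsReconstruction ε (X n) c ∧
          eLpNorm (fun z => c z - coeff σ z) 2 (volume.restrict Ω) ≤
            ENNReal.ofReal (K * (C * ξ + θ ^ n * ‖M - X₀‖)) := by
  subst hΩ hΓ
  obtain ⟨Λ, hΛ1, hΛ⟩ := exists_convexOnBall (b := b) ha hc₁ hc₂ hR hε.1
  obtain ⟨T, hTc, hT, hTlip⟩ := exists_recon (a := a) (b := b) hc₁ hc₂ ε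
  obtain ⟨K, hK0, hK⟩ := hTlip R
  have hV := isClosed_Pair₀ (a := a) (b := b) hc₁ hc₂
  have : CompleteSpace (Pair₀ (rect a b c₁ c₂) (rightSide a b c₁ c₂)) := hV.completeSpace_coe
  -- `K` is the Lipschitz constant of the reconstruction on the ball of radius `R`, which contains
  -- all iterates and the exact pair; adding one makes it positive.
  refine ⟨Λ, hΛ1, K + 1, by positivity, fun lam hlam ξ hξ => ?_⟩
  have hα : 0 < ξ ^ 2 := pow_pos hξ.1 2
  have hα1 : ξ ^ 2 < 1 := pow_lt_one₀ hξ.1.le hξ.2 two_ne_zero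
  obtain ⟨dJ, hJ⟩ := hΛ lam hlam (ξ ^ 2) hα
  obtain ⟨L, hL0, hL⟩ := hJ.lip (3 * R)
  -- The second bound ensures `γL² ≤ α`, as the contraction requires; the first keeps `γ₀` below one
  -- and `αγ < 1`.
  refine ⟨min (1 / 2) (ξ ^ 2 / (L ^ 2 + 1)), ⟨by positivity,
    (min_le_left _ _).trans_lt (by norm_num)⟩, fun γ hγ => ?_⟩
  have hγ1 : γ ≤ 1 / 2 := hγ.2.trans (min_le_left _ _)
  have hγL : γ * L ^ 2 ≤ ξ ^ 2 := by
    have h1 := hγ.2.trans (min_le_right _ _)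
    rw [le_div_iff₀ (by positivity)] at h1
    linarith [hγ.1]
  have hαγ : 0 < ξ ^ 2 * γ := mul_pos hα hγ.1
  have hαγ1 : ξ ^ 2 * γ < 1 := by
    have := mul_lt_mul_of_pos_right hα1 hγ.1
    linarith
  have hθsq : √(1 - ξ ^ 2 * γ) ^ 2 = 1 - ξ ^ 2 * γ := Real.sq_sqrt (by linarith)
  have hθ1 : √(1 - ξ ^ 2 * γ) < 1 := by
    rw [Real.sqrt_lt' one_pos]; linarith
  refine ⟨√(1 - ξ ^ 2 * γ), ⟨Real.sqrt_pos.2 (by linarith), hθ1⟩, ?_⟩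
  intro G A ρ σ u g₀ g₁ g₀' g₁' P P' X' C hG hσ hu _ _ hX'e _ hP _ _ hC hCR hX'
  have hCξ : 0 < C * ξ := mul_pos hC hξ.1
  refine ⟨existsUnique_isMinimizer hV hJ hP.1.le, fun M hM hMX X₀ hX₀ =>
    ⟨existsUnique_isDescent hJ γ X₀, fun X hX n => ?_⟩⟩
  have hX'n : ‖X'‖ < R / 3 - C * ξ := hX'.1
  -- The assumed distance `Cξ` of the minimizer to the exact pair is exactly the margin left in the
  -- a priori bound.
  have hMR : ‖M‖ < R / 3 := by
    have := norm_add_le (M - X') X'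
    rw [sub_add_cancel] at this
    linarith
  obtain ⟨k1, k2⟩ := norm_descent_sub_le hJ hγ.1.le hL hγL (Real.sqrt_nonneg _) hθ1.le hθsq hP.1 hM
    hMR hX₀.1 (hX₀.2.sub_mem hP.2) hX n
  set θ := √(1 - ξ ^ 2 * γ)
  have hθ0 : 0 ≤ θ := Real.sqrt_nonneg _
  have hbd : 0 ≤ θ ^ n * ‖M - X₀‖ := by positivity
  have hXM : ‖X n - M‖ ≤ θ ^ n * ‖M - X₀‖ := norm_family_le hbd k2
  have hXR : ‖X n‖ < R := by
    have h1 := norm_add_le (X n - M) M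
    rw [sub_add_cancel] at h1
    have h2 := mul_le_of_le_one_left (norm_nonneg (M - X₀)) (pow_le_one₀ (n := n) hθ0 hθ1.le)
    have h3 := norm_sub_le M X₀
    have h4 : ‖X₀‖ < R / 3 := hX₀.1
    linarith
  have hXX' : ‖X n - X'‖ ≤ C * ξ + θ ^ n * ‖M - X₀‖ := by
    have h1 := norm_add_le (X n - M) (M - X')
    rw [sub_add_sub_cancel] at h1
    linarith
  refine ⟨⟨hXR, hX₀.2.of_sub_mem k1⟩, hXX', ?_⟩
  obtain ⟨c, hc, hce⟩ := exists_reconstruction hTc hT hK0 hK hXR.le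
    (show ‖X'‖ ≤ R by linarith) (reconIntegrand_exact hε.1 hG hσ hu hX'e)
  refine ⟨c, hc, hce.trans (ENNReal.ofReal_le_ofReal ?_)⟩
  exact mul_le_mul (by linarith) hXX' (norm_nonneg _) (by positivity)
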